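/- Let $(X,\Sigma_X,\mu_X)$ and $(Y,\Sigma_Y,\mu_Y)$ be $\sigma$-finite measure spaces, $\bar\Sigma_X,\bar\Sigma_Y$ the completed $\sigma$-algebras, and $\varphi:Y\to X$ a $(\bar\Sigma_Y,\bar\Sigma_X)$-measurable map with $\varphi_*\mu_Y=\mu_X$. A lifting of $\mu$ is a map $\ell$ from measurable sets to $\bar\Sigma$ with $\ell(\varnothing)=\varnothing$, $\ell(\mathrm{whole\ space})=\mathrm{whole\ space}$, $\ell(E\cup F)=\ell(E)\cup\ell(F)$, $\ell(E\cap F)=\ell(E)\cap\ell(F)$, $\ell(E)=\ell(F)$ if $\mu(E\Delta F)=0$, and $\mu(E\Delta\ell(E))=0$; it induces a linear continuous map $\ell:L^\infty(\mu)\to\mathcal L^\infty(\bar\Sigma)$ (bounded measurable functions) with $\ell([1_E])=1_{\ell(E)}$. Let $\ell_X,\ell_Y$ be liftings of $\mu_X,\mu_Y$ with $\ell_Y(\varphi^{-1}(E))=\varphi^{-1}(\ell_X(E))$ for all $E\in\Sigma_X$. An $L^\infty$-normed module (over $L^\infty(\mu)$, or over $\mathcal L^\infty(\bar\Sigma)$)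 is a module over this ring with a pointwise norm $|\cdot|$ valued in it such that $|v|\ge0$ with equality iff $v=0$, $|v+w|\le|v|+|w|$, $|fv|=|f||v|$, which is complete for $\|v\|=\||v|\|_{L^\infty}$ and has the glueing property: for every countable measurable partition $(E_n)$ and $v_n$ with $\sup_n\|1_{E_n}v_n\|<\infty$ there is $v$ with $1_{E_n}v=1_{E_n}v_n$ for all $n$. A subset generates the module if the elements glued in this way from its elements are dense. Let $\mathscr M$ be an $L^\infty(\mu_X)$-normed module; let $(\ell_X\mathscr M,\ell_X)$ be its lifting, i.e. the $\mathcal L^\infty(\bar\Sigma_X)$-normed module with a linear map $\ell_X:\mathscr M\to\ell_X\mathscr M$ such that $|\ell_X(v)|=\ell_X(|v|)$ and the image of $\ell_X$ generates; let $(\varphi^*\mathscr M,\varphi^*)$ be its pullback, i.e. the $L^\infty(\mu_Y)$-normed module with a linear map $\varphi^*:\mathscr M\to\varphi^*\mathscr M$ such that $|\varphi^*v|=|v|\circ\varphi$ and the image of $\varphi^*$ generates. (Both couples are unique up to unique isomorphism.) The dual $(\varphi^*\mathscr M)^*$ is the $L^\infty(\mu_Y)$-module of continuous $L^\infty(\mu_Y)$-linear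 maps $L:\varphi^*\mathscr M\to L^\infty(\mu_Y)$, with $|L|=\operatorname{ess\,sup}\{|L(V)|:\|V\|\le1\}$. For $x\in X$ the fibre $\ell_X\mathscr M_x$ is $1_{\{x\}}\cdot\ell_X\mathscr M$ if $\{x\}\in\bar\Sigma_X$, and $1_A\cdot\ell_X\mathscr M$ if $\{x\}\notin\bar\Sigma_X$ and $x$ lies in $A=\ell_X(A')$ for an atom $A'$ of $\mu_X$; it is normed by $\|v\|_x=|v|(x)$ (vectors with $\|v\|_x=0$ are identified with $0$), and $v_x$ is the class of $1_{\{x\}}v$, resp. $1_Av$. Let $L^\infty_{\sf weak}(\ell_X\mathscr M'_{\varphi(\star)};\mu_Y)$ be the space of sections $\omega$ assigning to each $y\in Y$ an element $\omega(y)$ of the Banach dual $(\ell_X\mathscr M_{\varphi(y)})'$, such that $y\mapsto\langle\omega(y),\ell_X(v)_{\varphi(y)}\rangle$ is measurable off a $\mu_Y$-null set for every $v\in\mathscr M$, and such that $$|\omega|:=\operatorname{ess\,sup}\Big\{\langle\omega,w\rangle:\ w=\textstyle\sum_{i\le n}f_i\,\ell_X(v_i)_{\varphi(\cdot)},\ f_i:Y\to\mathbb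 R\ \bar\Sigma_Y\text{-measurable},\ v_i\in\mathscr M,\ \|w(y)\|_{\varphi(y)}\le1\ \forall y\Big\}$$ is in $L^\infty(\mu_Y)$, where $\omega,\omega'$ are identified if $\langle\omega-\omega',\ell_X(v)_{\varphi(\cdot)}\rangle=0$ $\mu_Y$-a.e. for every $v\in\mathscr M$. Then $L^\infty_{\sf weak}(\ell_X\mathscr M'_{\varphi(\star)};\mu_Y)$, with the pointwise norm $|\cdot|$, is an $L^\infty(\mu_Y)$-normed module. For every $\omega$ in it there is a unique $\mathcal I(\omega)\in(\varphi^*\mathscr M)^*$ such that $$\mathcal I(\omega)(\varphi^*v)=\langle\omega_\cdot,\ell_X(v)_{\varphi(\cdot)}\rangle\quad\mu_Y\text{-a.e.}\qquad\text{for every }v\in\mathscr M,$$ and the map $\mathcal I:L^\infty_{\sf weak}(\ell_X\mathscr M'_{\varphi(\star)};\mu_Y)\to(\varphi^*\mathscr M)^*$ is an isomorphism of $L^\infty(\mu_Y)$-normed modules: it is $L^\infty(\mu_Y)$-linear, bijective, and $|\mathcal I(\omega)|=|\omega|$. -/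

import Mathlib

open MeasureTheory Filter Topology

noncomputable section

namespace LinftyModule

/-! ### The spaces `L^∞(Σ, N)` -/

/-- The completion of the σ-algebra of the measure space `(X, μ)`: the σ-algebra of
`μ`-null-measurable sets. -/
abbrev complSigma {X : Type*} [MeasurableSpace X] (μ : Measure X) : MeasurableSpace X :=
  inferInstanceAs (MeasurableSpace (NullMeasurableSpace X μ))

/-- `𝓛^∞(Σ)`: the ring of real-valued bounded `Σ`-measurable functions. -/
def boundedMeasurable {X : Type*} (m : MeasurableSpace X) : Subring (X → ℝ) where
  carrier := {f | Measurable[m] f ∧ ∃ C : ℝ, ∀ x, |f x| ≤ C}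
  mul_mem' := by
    rintro f g ⟨hf, C, hC⟩ ⟨hg, D, hD⟩
    refine ⟨hf.mul hg, C * D, fun x => ?_⟩
    rw [Pi.mul_apply, abs_mul]
    exact mul_le_mul (hC x) (hD x) (abs_nonneg _) ((abs_nonneg _).trans (hC x))
  one_mem' := ⟨measurable_const, 1, fun x => by simp⟩
  add_mem' := by
    rintro f g ⟨hf, C, hC⟩ ⟨hg, D, hD⟩
    exact ⟨hf.add hg, C + D, fun x => (abs_add_le _ _).trans (add_le_add (hC x) (hD x))⟩
  zero_mem' := ⟨measurable_const, 0, fun x => by simp⟩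
  neg_mem' := by
    rintro f ⟨hf, C, hC⟩
    exact ⟨hf.neg, C, fun x => by simpa using hC x⟩

/-- `L^∞(Σ, N)`: bounded `Σ`-measurable functions modulo equality off a negligible set. The σ-ideal
`N` of negligible sets is encoded by the filter `l` of sets with negligible complement, so that
`l = ae μ` gives `L^∞(μ)` and `l = ⊤` (only `∅` is negligible) gives `𝓛^∞(Σ)`. -/
def Linf {X : Type*} (m : MeasurableSpace X) (l : Filter X) : Subring (Germ l ℝ) :=
  (boundedMeasurable m).map (Germ.coeRingHom l)

/-- `L^∞(μ)`. -/
abbrev LinfMu {X : Type*} [MeasurableSpace X] (μ : Measure X) : Subring (Germ (ae μ) ℝ) :=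
  Linf (complSigma μ) (ae μ)

/-- Passing to the completed σ-algebra does not change `L^∞(μ)`. -/
theorem linf_ae_eq {X : Type*} [m : MeasurableSpace X] (μ : Measure X) :
    Linf m (ae μ) = LinfMu μ := by
  apply le_antisymm
  · rintro _ ⟨f, ⟨hf, hb⟩, rfl⟩
    exact ⟨f, ⟨hf.nullMeasurable, hb⟩, rfl⟩
  · rintro _ ⟨f, ⟨hf, C, hC⟩, rfl⟩
    have hf' : AEMeasurable f μ := NullMeasurable.aemeasurable hf
    refine ⟨fun x => max (-C) (min C (hf'.mk f x)),
      ⟨measurable_const.max (measurable_const.min hf'.measurable_mk), |C|, fun x => ?_⟩, ?_⟩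
    · have h0 : 0 ≤ C := (abs_nonneg _).trans (hC x)
      rw [abs_of_nonneg h0, abs_le]
      exact ⟨le_max_left _ _, max_le (by linarith) (min_le_left _ _)⟩
    · refine Germ.coe_eq.2 ?_
      filter_upwards [hf'.ae_eq_mk] with x hx
      have h1 := abs_le.1 (hC x)
      rw [← hx, min_eq_right h1.2, max_eq_right h1.1]

/-- `𝓛^∞(Σ)` as the case in which only `∅` is negligible. -/
abbrev LinfTop {X : Type*} (m : MeasurableSpace X) : Subring (Germ (⊤ : Filter X) ℝ) :=
  Linf m ⊤

section Linf

variable {X : Type*} {m : MeasurableSpace X} {l : Filter X}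

/-- The projection `𝓛^∞(Σ) → L^∞(Σ, N)`. -/
def Linf.proj (m : MeasurableSpace X) (l : Filter X) : boundedMeasurable m →+* Linf m l :=
  ((Germ.coeRingHom l).comp (boundedMeasurable m).subtype).codRestrict (Linf m l)
    (fun f => ⟨f, f.2, rfl⟩)

theorem Linf.proj_surjective : Function.Surjective (Linf.proj m l) := by
  rintro ⟨g, f, hf, rfl⟩
  exact ⟨⟨f, hf⟩, rfl⟩

/-- A bounded measurable representative. -/
def Linf.rep (g : Linf m l) : boundedMeasurable m := (Linf.proj_surjective g).choose

theorem Linf.proj_rep (g : Linf m l) : Linf.proj m l (Linf.rep g) = g :=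
  (Linf.proj_surjective g).choose_spec

/-- `L^∞(Σ, N)` as a real algebra, through the constant functions. -/
instance : Algebra ℝ (Linf m l) :=
  ((Linf.proj m l).comp ((Pi.constRingHom X ℝ).codRestrict (boundedMeasurable m)
    (fun c => ⟨measurable_const, |c|, fun _ => le_rfl⟩))).toAlgebra

theorem indicator_mem_boundedMeasurable (s : Set X) (hs : MeasurableSet[m] s) :
    s.indicator 1 ∈ boundedMeasurable m :=
  ⟨measurable_one.indicator hs, 1, fun x => by by_cases h : x ∈ s <;> simp [h]⟩

theorem smul_mem_boundedMeasurable {f : X → ℝ}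
    (hf : f ∈ boundedMeasurable m) (c : ℝ) : c • f ∈ boundedMeasurable m :=
  mul_mem (show (fun _ => c) ∈ boundedMeasurable m from
    ⟨measurable_const, |c|, fun _ => le_rfl⟩) hf

/-- The class of the characteristic function of a measurable set. -/
def Linf.ind (l : Filter X) (s : Set X) (hs : MeasurableSet[m] s) : Linf m l :=
  Linf.proj m l ⟨s.indicator 1, indicator_mem_boundedMeasurable s hs⟩

/-- The norm of `L^∞(Σ, N)`: the infimum of the bounds which hold off a negligible set. -/
def Linf.nrm (g : Linf m l) : ℝ :=
  sInf {C : ℝ | 0 ≤ C ∧ |(g : Germ l ℝ)| ≤ ((fun _ => C : X → ℝ) : Germ l ℝ)}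

/-- The value at a point of an element of `𝓛^∞(Σ)`. -/
def Linf.eval (x : X) (g : LinfTop m) : ℝ :=
  Germ.liftOn (g : Germ (⊤ : Filter X) ℝ) (fun f => f x) (fun _ _ h => (eventually_top.1 h) x)

/-- The (essential) supremum of a family in `L^∞(Σ, N)`: its least upper bound for the pointwise
order off negligible sets. (It is used for bounded families over a σ-finite measure.) -/
def Linf.esssup (S : Set (Linf m l)) : Linf m l := by
  classical
  exact if h : ∃ g : Linf m l, IsLUB S g then h.choose else 0

theorem Linf.exists_rep (g : Linf m l) :
    ∃ f : X → ℝ, Measurable[m] f ∧ (∃ C : ℝ, ∀ x, |f x| ≤ C) ∧ (g : Germ l ℝ) = (f : Germ l ℝ) := by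
  obtain ⟨g, f, hf, rfl⟩ := g
  exact ⟨f, hf.1, hf.2, rfl⟩

end Linf

/-! ### Normed modules -/

section NormedModule

variable {X : Type*} {m : MeasurableSpace X} {l : Filter X}

/-- `(E n)` is a partition of the whole space into measurable sets (possibly empty). -/
structure IsPartition (m : MeasurableSpace X) (E : ℕ → Set X) : Prop where
  measurable : ∀ n, MeasurableSet[m] (E n)
  disjoint : Pairwise (Function.onFun Disjoint E)
  cover : ⋃ n, E n = Set.univ

/-- `M`, with the pointwise norm `pn`, is an `L^∞(Σ, N)`-normed module. The norm of `v` is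
`‖|v|‖_{L^∞}`, and `complete` says that it makes `M` a Banach space. -/
structure IsNormedModule {M : Type*} [AddCommGroup M] [Module (Linf m l) M]
    (pn : M → Linf m l) : Prop where
  nonneg : ∀ v, 0 ≤ pn v
  eq_zero_iff : ∀ v, pn v = 0 ↔ v = 0
  add_le : ∀ v w, pn (v + w) ≤ pn v + pn w
  smul_eq : ∀ (f : Linf m l) (v : M), (pn (f • v) : Germ l ℝ) = |(f : Germ l ℝ)| * pn v
  glueing : ∀ (E : ℕ → Set X) (hE : IsPartition m E) (v : ℕ → M),
    (∃ C : ℝ, ∀ n, Linf.nrm (Linf.ind l (E n) (hE.measurable n) * pn (v n)) ≤ C) →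
    ∃ w : M, ∀ n, Linf.ind l (E n) (hE.measurable n) • w =
      Linf.ind l (E n) (hE.measurable n) • v n
  complete : ∀ u : ℕ → M,
    (∀ ε : ℝ, 0 < ε → ∃ N, ∀ i, N ≤ i → ∀ j, N ≤ j → Linf.nrm (pn (u i - u j)) < ε) →
    ∃ w : M, Tendsto (fun n => Linf.nrm (pn (u n - w))) atTop (𝓝 0)

/-- The set `V` generates the normed module `M`: the elements `∑ₙ 1_{Eₙ} vₙ` obtained by glueing
elements `vₙ` of `V` along a partition are dense in `M`. -/
def Generates {M : Type*} [AddCommGroup M] [Module (Linf m l) M]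
    (pn : M → Linf m l) (V : Set M) : Prop :=
  ∀ (w : M) (ε : ℝ), 0 < ε → ∃ u : M, Linf.nrm (pn (w - u)) < ε ∧
    ∃ (E : ℕ → Set X) (hE : IsPartition m E) (v : ℕ → M), (∀ n, v n ∈ V) ∧
      (∃ C : ℝ, ∀ n, Linf.nrm (pn (Linf.ind l (E n) (hE.measurable n) • v n)) ≤ C) ∧
      ∀ n, Linf.ind l (E n) (hE.measurable n) • u = Linf.ind l (E n) (hE.measurable n) • v n

theorem Linf.nrm_nonneg (g : Linf m l) : 0 ≤ Linf.nrm g :=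
  Real.sInf_nonneg fun _ h => h.1

theorem Linf.nrm_le (g : Linf m l) {C : ℝ} (hC : 0 ≤ C)
    (h : |(g : Germ l ℝ)| ≤ ((fun _ => C : X → ℝ) : Germ l ℝ)) : Linf.nrm g ≤ C :=
  csInf_le ⟨0, fun _ h => h.1⟩ ⟨hC, h⟩

theorem Linf.exists_bound (g : Linf m l) {ε : ℝ} (hε : 0 < ε) :
    ∃ C : ℝ, 0 ≤ C ∧ C < Linf.nrm g + ε ∧
      |(g : Germ l ℝ)| ≤ ((fun _ => C : X → ℝ) : Germ l ℝ) := by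
  have hne : {C : ℝ | 0 ≤ C ∧
      |(g : Germ l ℝ)| ≤ ((fun _ => C : X → ℝ) : Germ l ℝ)}.Nonempty := by
    obtain ⟨f, -, ⟨C, hC⟩, hf⟩ := Linf.exists_rep g
    refine ⟨|C|, abs_nonneg _, ?_⟩
    rw [hf]
    exact Eventually.of_forall fun x => (hC x).trans (le_abs_self C)
  obtain ⟨C, hC, hlt⟩ := exists_lt_of_csInf_lt hne (lt_add_of_pos_right (Linf.nrm g) hε)
  exact ⟨C, hC.1, hlt, hC.2⟩

theorem Linf.nrm_add_le (g h : Linf m l) : Linf.nrm (g + h) ≤ Linf.nrm g + Linf.nrm h := by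
  refine le_of_forall_pos_le_add fun ε hε => ?_
  obtain ⟨C, hC, hlt, hb⟩ := Linf.exists_bound g (half_pos hε)
  obtain ⟨D, hD, hlt', hb'⟩ := Linf.exists_bound h (half_pos hε)
  refine (Linf.nrm_le _ (add_nonneg hC hD) ?_).trans (b := C + D) (by linarith)
  obtain ⟨f, -, -, hf⟩ := Linf.exists_rep g
  obtain ⟨f', -, -, hf'⟩ := Linf.exists_rep h
  rw [hf] at hb
  rw [hf'] at hb'
  rw [Subring.coe_add, hf, hf']
  have hb : ∀ᶠ x in l, |f x| ≤ C := hb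
  have hb' : ∀ᶠ x in l, |f' x| ≤ D := hb'
  change ∀ᶠ x in l, |f x + f' x| ≤ C + D
  filter_upwards [hb, hb'] with x hx hx'
  exact (abs_add_le _ _).trans (add_le_add hx hx')

theorem Linf.nrm_mul_le (g h : Linf m l) : Linf.nrm (g * h) ≤ Linf.nrm g * Linf.nrm h := by
  have key : ∀ ε : ℝ, 0 < ε → Linf.nrm (g * h) ≤ (Linf.nrm g + ε) * (Linf.nrm h + ε) := by
    intro ε hε
    obtain ⟨C, hC, hlt, hb⟩ := Linf.exists_bound g hε
    obtain ⟨D, hD, hlt', hb'⟩ := Linf.exists_bound h hε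
    refine (Linf.nrm_le _ (mul_nonneg hC hD) ?_).trans (b := C * D)
      (mul_le_mul hlt.le hlt'.le hD (hC.trans hlt.le))
    obtain ⟨f, -, -, hf⟩ := Linf.exists_rep g
    obtain ⟨f', -, -, hf'⟩ := Linf.exists_rep h
    rw [hf] at hb
    rw [hf'] at hb'
    rw [Subring.coe_mul, hf, hf']
    have hb : ∀ᶠ x in l, |f x| ≤ C := hb
    have hb' : ∀ᶠ x in l, |f' x| ≤ D := hb'
    change ∀ᶠ x in l, |f x * f' x| ≤ C * D
    filter_upwards [hb, hb'] with x hx hx'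
    rw [abs_mul]
    exact mul_le_mul hx hx' (abs_nonneg _) hC
  have ht : Tendsto (fun ε : ℝ => (Linf.nrm g + ε) * (Linf.nrm h + ε)) (𝓝[>] 0)
      (𝓝 (Linf.nrm g * Linf.nrm h)) := by
    have hc : Continuous fun ε : ℝ => (Linf.nrm g + ε) * (Linf.nrm h + ε) := by fun_prop
    simpa using (hc.tendsto 0).mono_left nhdsWithin_le_nhds
  exact ge_of_tendsto ht (eventually_mem_nhdsWithin.mono fun ε hε => key ε hε)

theorem Linf.nrm_zero : Linf.nrm (0 : Linf m l) = 0 := by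
  refine le_antisymm (Linf.nrm_le _ le_rfl ?_) (Linf.nrm_nonneg _)
  change ∀ᶠ x in l, |(0 : ℝ)| ≤ 0
  simp

theorem Linf.eval_add (x : X) (f g : LinfTop m) :
    Linf.eval x (f + g) = Linf.eval x f + Linf.eval x g := by
  obtain ⟨f, f', _, rfl⟩ := f
  obtain ⟨g, g', _, rfl⟩ := g
  rfl

theorem Linf.eval_mono (x : X) {f g : LinfTop m} (hfg : f ≤ g) :
    Linf.eval x f ≤ Linf.eval x g := by
  obtain ⟨f, f', _, rfl⟩ := f
  obtain ⟨g, g', _, rfl⟩ := g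
  have : ∀ᶠ y in (⊤ : Filter X), f' y ≤ g' y := hfg
  exact eventually_top.1 this x

theorem IsNormedModule.eval_smul {M : Type*} [AddCommGroup M] [Module (LinfTop m) M]
    {pn : M → LinfTop m} (h : IsNormedModule pn) (x : X) (f : LinfTop m) (v : M) :
    Linf.eval x (pn (f • v)) = |Linf.eval x f| * Linf.eval x (pn v) := by
  have key := h.smul_eq f v
  generalize pn (f • v) = a at key ⊢
  generalize pn v = b at key ⊢
  obtain ⟨f, f', _, rfl⟩ := f
  obtain ⟨a, a', _, rfl⟩ := a
  obtain ⟨b, b', _, rfl⟩ := b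
  have : ∀ᶠ y in (⊤ : Filter X), a' y = |f' y| * b' y := Germ.coe_eq.1 key
  exact eventually_top.1 this x

/-- The module dual `M^*`: the bounded (that is, continuous) `L^∞`-linear maps `M → L^∞`. -/
def Dual {M : Type*} [AddCommGroup M] [Module (Linf m l) M] (pn : M → Linf m l) :
    Submodule (Linf m l) (M →ₗ[Linf m l] Linf m l) where
  carrier := {L | ∃ C : ℝ, ∀ v, Linf.nrm (L v) ≤ C * Linf.nrm (pn v)}
  add_mem' := by
    rintro L L' ⟨C, hC⟩ ⟨D, hD⟩
    refine ⟨C + D, fun v => (Linf.nrm_add_le _ _).trans ?_⟩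
    linarith [hC v, hD v]
  zero_mem' := ⟨0, fun v => by simp [Linf.nrm_zero]⟩
  smul_mem' := by
    rintro f L ⟨C, hC⟩
    refine ⟨Linf.nrm f * C, fun v => (Linf.nrm_mul_le _ _).trans ?_⟩
    rw [mul_assoc]
    exact mul_le_mul_of_nonneg_left (hC v) (Linf.nrm_nonneg _)

/-- The pointwise norm of the module dual: `|L| = ess sup {|L v| : ‖v‖ ≤ 1}`. -/
def dualNorm {M : Type*} [AddCommGroup M] [Module (Linf m l) M] (pn : M → Linf m l)
    (L : Dual pn) : Linf m l :=
  Linf.esssup {g | ∃ v : M, Linf.nrm (pn v) ≤ 1 ∧ (g : Germ l ℝ) = |(L.1 v : Germ l ℝ)|}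

end NormedModule

/-! ### Liftings -/

/-- A (set) lifting of `μ`, with values in the completed σ-algebra. It does not distinguish sets
which agree off a `μ`-null set, so it is the same to define it on the σ-algebra or, as here, on
its completion. -/
structure Lifting {X : Type*} [MeasurableSpace X] (μ : Measure X) where
  toFun : Set X → Set X
  measurable : ∀ E, NullMeasurableSet E μ → NullMeasurableSet (toFun E) μ
  map_empty : toFun ∅ = ∅
  map_univ : toFun Set.univ = Set.univ
  map_union : ∀ E F, NullMeasurableSet E μ → NullMeasurableSet F μ →
    toFun (E ∪ F) = toFun E ∪ toFun F
  map_inter : ∀ E F, NullMeasurableSet E μ → NullMeasurableSet F μ →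
    toFun (E ∩ F) = toFun E ∩ toFun F
  congr : ∀ E F, NullMeasurableSet E μ → NullMeasurableSet F μ → μ (symmDiff E F) = 0 →
    toFun E = toFun F
  ae_eq : ∀ E, NullMeasurableSet E μ → μ (symmDiff E (toFun E)) = 0

namespace Lifting

variable {X : Type*} [MeasurableSpace X] {μ : Measure X} (ℓ : Lifting μ)

/-- The function `x ↦ sup {c : x ∈ ℓ({f > c})}`. -/
def funLift (f : X → ℝ) (x : X) : ℝ := sSup {c : ℝ | x ∈ ℓ.toFun {y | c < f y}}

theorem mono {E F : Set X} (hE : NullMeasurableSet E μ) (hF : NullMeasurableSet F μ)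
    (h : E ⊆ F) : ℓ.toFun E ⊆ ℓ.toFun F := by
  have := ℓ.map_union E F hE hF
  rw [Set.union_eq_self_of_subset_left h] at this
  rw [this]
  exact Set.subset_union_left

theorem nullMeasurableSet_lt {f : X → ℝ} (hf : f ∈ boundedMeasurable (complSigma μ)) (c : ℝ) :
    NullMeasurableSet {y | c < f y} μ :=
  hf.1 measurableSet_Ioi

theorem bddAbove_funLift {f : X → ℝ} (hf : f ∈ boundedMeasurable (complSigma μ)) :
    ∃ C : ℝ, ∀ x, (∀ c, x ∈ ℓ.toFun {y | c < f y} → c < C) ∧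
      (∀ c, c < -C → x ∈ ℓ.toFun {y | c < f y}) := by
  obtain ⟨C, hC⟩ := hf.2
  refine ⟨C, fun x => ⟨fun c hc => ?_, fun c hc => ?_⟩⟩
  · by_contra! h
    have : {y | c < f y} = ∅ := by
      ext y
      simpa using ((le_abs_self _).trans (hC y)).trans h
    rw [this, ℓ.map_empty] at hc
    exact hc
  · have : {y | c < f y} = Set.univ := by
      ext y
      simpa using hc.trans_le (abs_le.1 (hC y)).1
    rw [this, ℓ.map_univ]
    trivial

theorem lt_funLift_iff {f : X → ℝ} (hf : f ∈ boundedMeasurable (complSigma μ)) (x : X) (c : ℝ) :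
    c < ℓ.funLift f x ↔ ∃ q : ℚ, c < q ∧ x ∈ ℓ.toFun {y | (q : ℝ) < f y} := by
  obtain ⟨C, hC⟩ := ℓ.bddAbove_funLift hf
  have hbdd : BddAbove {c : ℝ | x ∈ ℓ.toFun {y | c < f y}} := ⟨C, fun c hc => ((hC x).1 c hc).le⟩
  constructor
  · intro h
    obtain ⟨d, hd, hcd⟩ := exists_lt_of_lt_csSup
      (s := {c : ℝ | x ∈ ℓ.toFun {y | c < f y}})
      ⟨-C - 1, (hC x).2 _ (by linarith)⟩ h
    obtain ⟨q, hq, hq'⟩ := exists_rat_btwn hcd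
    exact ⟨q, hq, ℓ.mono (nullMeasurableSet_lt hf _) (nullMeasurableSet_lt hf _)
      (fun y hy => hq'.trans hy) hd⟩
  · rintro ⟨q, hq, hx⟩
    exact hq.trans_le (le_csSup hbdd hx)

theorem funLift_mem {f : X → ℝ} (hf : f ∈ boundedMeasurable (complSigma μ)) :
    ℓ.funLift f ∈ boundedMeasurable (complSigma μ) := by
  refine ⟨?_, ?_⟩
  · refine measurable_of_Ioi (mδ := complSigma μ) fun c => ?_
    have : ℓ.funLift f ⁻¹' Set.Ioi c =
        ⋃ q : {q : ℚ // c < q}, ℓ.toFun {y | ((q : ℚ) : ℝ) < f y} := by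
      ext x
      simp only [Set.mem_preimage, Set.mem_Ioi, ℓ.lt_funLift_iff hf, Set.mem_iUnion, Subtype.exists,
        exists_prop]
    rw [this]
    exact NullMeasurableSet.iUnion fun q => ℓ.measurable _ (nullMeasurableSet_lt hf _)
  · obtain ⟨C, hC⟩ := ℓ.bddAbove_funLift hf
    refine ⟨C, fun x => abs_le.2 ⟨?_, ?_⟩⟩
    · refine le_of_forall_lt fun c hc => ?_
      rw [ℓ.lt_funLift_iff hf]
      obtain ⟨q, hq, hq'⟩ := exists_rat_btwn hc
      exact ⟨q, hq, (hC x).2 _ hq'⟩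
    · exact csSup_le ⟨-C - 1, (hC x).2 _ (by linarith)⟩ fun c hc => ((hC x).1 c hc).le

theorem mono_ae {E F : Set X} (hE : NullMeasurableSet E μ) (hF : NullMeasurableSet F μ)
    (h : ∀ᵐ y ∂μ, y ∈ E → y ∈ F) : ℓ.toFun E ⊆ ℓ.toFun F := by
  have h0 : μ (symmDiff (E ∪ F) F) = 0 := by
    rw [measure_symmDiff_eq_zero_iff]
    filter_upwards [h] with y hy
    exact propext ⟨fun h' => h'.elim hy id, Or.inr⟩
  have h1 := ℓ.congr _ _ (hE.union hF) hF h0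
  rw [ℓ.map_union E F hE hF] at h1
  rw [← h1]
  exact Set.subset_union_left

theorem le_funLift {f : X → ℝ} (hf : f ∈ boundedMeasurable (complSigma μ)) {x : X} {c : ℝ}
    (h : x ∈ ℓ.toFun {y | c < f y}) : c ≤ ℓ.funLift f x := by
  obtain ⟨C, hC⟩ := ℓ.bddAbove_funLift hf
  exact le_csSup ⟨C, fun c hc => ((hC x).1 c hc).le⟩ h

theorem funLift_le {f : X → ℝ} (hf : f ∈ boundedMeasurable (complSigma μ)) {x : X} {a : ℝ}
    (h : ∀ c, x ∈ ℓ.toFun {y | c < f y} → c ≤ a) : ℓ.funLift f x ≤ a := by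
  obtain ⟨C, hC⟩ := ℓ.bddAbove_funLift hf
  exact csSup_le ⟨-C - 1, (hC x).2 _ (by linarith)⟩ h

theorem funLift_mono {f g : X → ℝ} (hf : f ∈ boundedMeasurable (complSigma μ))
    (hg : g ∈ boundedMeasurable (complSigma μ)) (h : ∀ᵐ y ∂μ, f y ≤ g y) (x : X) :
    ℓ.funLift f x ≤ ℓ.funLift g x := by
  refine ℓ.funLift_le hf fun c hc => ℓ.le_funLift hg ?_
  refine ℓ.mono_ae (nullMeasurableSet_lt hf c) (nullMeasurableSet_lt hg c) ?_ hc
  filter_upwards [h] with y hy hy'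
  exact lt_of_lt_of_le hy' hy

theorem funLift_add_le {f g : X → ℝ} (hf : f ∈ boundedMeasurable (complSigma μ))
    (hg : g ∈ boundedMeasurable (complSigma μ)) (x : X) :
    ℓ.funLift (f + g) x ≤ ℓ.funLift f x + ℓ.funLift g x := by
  refine ℓ.funLift_le (add_mem hf hg) fun c hc => ?_
  by_contra! hlt
  set d := (c - (ℓ.funLift f x + ℓ.funLift g x)) / 2 with hd
  have hsub : {y | c < (f + g) y} ⊆
      {y | ℓ.funLift f x + d < f y} ∪ {y | ℓ.funLift g x + d < g y} := by
    intro y hy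
    by_contra hn
    simp only [Set.mem_union, Set.mem_ofPred_eq, not_or, not_lt, Pi.add_apply] at hn hy
    linarith
  have := ℓ.mono (nullMeasurableSet_lt (add_mem hf hg) c)
    ((nullMeasurableSet_lt hf _).union (nullMeasurableSet_lt hg _)) hsub hc
  rw [ℓ.map_union _ _ (nullMeasurableSet_lt hf _) (nullMeasurableSet_lt hg _)] at this
  rcases this with h | h
  · linarith [ℓ.le_funLift hf h]
  · linarith [ℓ.le_funLift hg h]

theorem funLift_neg {f : X → ℝ} (hf : f ∈ boundedMeasurable (complSigma μ)) (x : X) :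
    ℓ.funLift (-f) x = -ℓ.funLift f x := by
  apply le_antisymm
  · by_contra! h
    obtain ⟨a, ha, hx⟩ := (ℓ.lt_funLift_iff (neg_mem hf) x _).1 h
    obtain ⟨b, hb, hx'⟩ := (ℓ.lt_funLift_iff hf x (-a)).1 (by linarith)
    have hx2 : x ∈ ℓ.toFun ({y | (a : ℝ) < (-f) y} ∩ {y | (b : ℝ) < f y}) := by
      rw [ℓ.map_inter _ _ (nullMeasurableSet_lt (neg_mem hf) _) (nullMeasurableSet_lt hf _)]
      exact ⟨hx, hx'⟩
    have he : {y | (a : ℝ) < (-f) y} ∩ {y | (b : ℝ) < f y} = ∅ := by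
      ext y
      simp only [Set.mem_inter_iff, Set.mem_ofPred_eq, Pi.neg_apply, Set.mem_empty_iff_false,
        iff_false, not_and, not_lt]
      intro h1
      linarith
    rw [he, ℓ.map_empty] at hx2
    exact hx2
  · have h0 : (0 : ℝ) ≤ ℓ.funLift (f + -f) x := by
      rw [add_neg_cancel]
      refine le_of_forall_lt fun c hc => ?_
      rw [ℓ.lt_funLift_iff (zero_mem _)]
      obtain ⟨q, hq, hq'⟩ := exists_rat_btwn hc
      refine ⟨q, hq, ?_⟩
      have : {y : X | (q : ℝ) < (0 : X → ℝ) y} = Set.univ := by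
        ext y
        simpa using hq'
      rw [this, ℓ.map_univ]
      trivial
    linarith [ℓ.funLift_add_le hf (neg_mem hf) x]

theorem funLift_add {f g : X → ℝ} (hf : f ∈ boundedMeasurable (complSigma μ))
    (hg : g ∈ boundedMeasurable (complSigma μ)) (x : X) :
    ℓ.funLift (f + g) x = ℓ.funLift f x + ℓ.funLift g x := by
  refine le_antisymm (ℓ.funLift_add_le hf hg x) ?_
  have h := ℓ.funLift_add_le (add_mem hf hg) (neg_mem hg) x
  rw [add_neg_cancel_right, ℓ.funLift_neg hg] at h
  linarith

theorem funLift_smul {f : X → ℝ} (hf : f ∈ boundedMeasurable (complSigma μ)) (c : ℝ) (x : X) :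
    ℓ.funLift (c • f) x = c * ℓ.funLift f x := by
  have key : ∀ {f : X → ℝ}, f ∈ boundedMeasurable (complSigma μ) → ∀ {c : ℝ}, 0 < c →
      ℓ.funLift (c • f) x ≤ c * ℓ.funLift f x := by
    intro f hf c hc
    refine ℓ.funLift_le (smul_mem_boundedMeasurable hf c) fun d hd => ?_
    have : {y | d < (c • f) y} = {y | d / c < f y} := by
      ext y
      simp [div_lt_iff₀' hc]
    rw [this] at hd
    exact (div_le_iff₀' hc).1 (ℓ.le_funLift hf hd)
  have key2 : ∀ {f : X → ℝ}, f ∈ boundedMeasurable (complSigma μ) → ∀ {c : ℝ}, 0 < c →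
      ℓ.funLift (c • f) x = c * ℓ.funLift f x := by
    intro f hf c hc
    refine le_antisymm (key hf hc) ?_
    have h := key (smul_mem_boundedMeasurable hf c) (inv_pos.2 hc)
    rw [smul_smul, inv_mul_cancel₀ hc.ne', one_smul] at h
    calc c * ℓ.funLift f x ≤ c * (c⁻¹ * ℓ.funLift (c • f) x) :=
          mul_le_mul_of_nonneg_left h hc.le
      _ = ℓ.funLift (c • f) x := by field_simp
  rcases lt_trichotomy c 0 with hc | rfl | hc
  · have h := key2 (neg_mem hf) (neg_pos.2 hc)
    rw [ℓ.funLift_neg hf] at h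
    have e : -c • -f = c • f := by simp
    rw [e] at h
    rw [h]
    ring
  · have h := ℓ.funLift_neg (zero_mem (boundedMeasurable (complSigma μ))) x
    rw [neg_zero] at h
    rw [zero_smul]
    linarith
  · exact key2 hf hc

/-- The lifting of functions extends the lifting of sets; being linear and order preserving
(`funLift_add`, `funLift_smul`, `funLift_mono`), it is the only continuous linear extension. -/
theorem funLift_indicator {E : Set X} (hE : NullMeasurableSet E μ) :
    ℓ.funLift (E.indicator 1) = (ℓ.toFun E).indicator 1 := by
  have hmem : E.indicator 1 ∈ boundedMeasurable (complSigma μ) :=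
    (indicator_mem_boundedMeasurable E hE)
  funext x
  have h1 : ∀ c : ℝ, 1 ≤ c → {y : X | c < E.indicator (1 : X → ℝ) y} = ∅ := by
    intro c hc
    ext y
    by_cases h : y ∈ E <;> simp [h, hc, le_trans zero_le_one hc]
  have h2 : ∀ c : ℝ, 0 ≤ c → c < 1 → {y : X | c < E.indicator (1 : X → ℝ) y} = E := by
    intro c hc hc'
    ext y
    by_cases h : y ∈ E <;> simp [h, hc, hc']
  have h3 : ∀ c : ℝ, c < 0 → {y : X | c < E.indicator (1 : X → ℝ) y} = Set.univ := by
    intro c hc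
    ext y
    by_cases h : y ∈ E <;> simp [h, hc, hc.trans zero_lt_one]
  have hle : ∀ c, x ∈ ℓ.toFun {y : X | c < E.indicator (1 : X → ℝ) y} → c < 1 := by
    intro c hc
    by_contra! h
    rw [h1 c h, ℓ.map_empty] at hc
    exact hc
  by_cases hx : x ∈ ℓ.toFun E
  · rw [Set.indicator_of_mem hx]
    refine le_antisymm (ℓ.funLift_le hmem fun c hc => (hle c hc).le)
      (le_of_forall_lt fun c hc => ?_)
    obtain ⟨d, hd, hd'⟩ := exists_between (max_lt hc zero_lt_one)
    refine ((le_max_left _ _).trans_lt hd).trans_le (ℓ.le_funLift hmem ?_)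
    rwa [h2 d ((le_max_right _ _).trans hd.le) hd']
  · rw [Set.indicator_of_notMem hx]
    refine le_antisymm (ℓ.funLift_le hmem fun c hc => ?_) (le_of_forall_lt fun c hc => ?_)
    · by_contra! h
      rw [h2 c h.le (hle c hc)] at hc
      exact hx hc
    · obtain ⟨d, hd, hd'⟩ := exists_between hc
      refine hd.trans_le (ℓ.le_funLift hmem ?_)
      rw [h3 d hd', ℓ.map_univ]
      trivial

theorem funLift_ae_eq {f : X → ℝ} (hf : f ∈ boundedMeasurable (complSigma μ)) :
    ∀ᵐ x ∂μ, ℓ.funLift f x = f x := by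
  have h : ∀ᵐ x ∂μ, ∀ q : ℚ, ((q : ℝ) < f x ↔ x ∈ ℓ.toFun {y | (q : ℝ) < f y}) := by
    rw [ae_all_iff]
    intro q
    have := ℓ.ae_eq _ (nullMeasurableSet_lt hf q)
    rw [measure_symmDiff_eq_zero_iff] at this
    filter_upwards [this] with x hx
    exact iff_of_eq hx
  filter_upwards [h] with x hx
  refine eq_of_forall_lt_iff fun c => ?_
  rw [ℓ.lt_funLift_iff hf]
  constructor
  · rintro ⟨q, hq, hq'⟩
    exact hq.trans ((hx q).2 hq')
  · intro hc
    obtain ⟨q, hq, hq'⟩ := exists_rat_btwn hc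
    exact ⟨q, hq, (hx q).1 hq'⟩

/-- The lifting `ℓ : L^∞(μ) → 𝓛^∞(Σ̄)` of functions induced by the lifting of sets. -/
def lift (g : LinfMu μ) : LinfTop (complSigma μ) :=
  Linf.proj _ _ ⟨ℓ.funLift (Linf.rep g), ℓ.funLift_mem (Linf.rep g).2⟩

end Lifting

/-! ### Liftings and pullbacks of normed modules -/

/-- `(LM, T)` is the lifting of the `L^∞(μ)`-normed module `M` along `ℓ`: `LM` is an
`𝓛^∞(Σ̄)`-normed module, `T : M → LM` is linear with `|T v| = ℓ(|v|)`, and the image of `T`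
generates `LM`. -/
structure IsModuleLifting {X : Type*} [MeasurableSpace X] {μ : Measure X} (ℓ : Lifting μ)
    {M : Type*} [AddCommGroup M] [Module (LinfMu μ) M] [Module ℝ M] (pn : M → LinfMu μ)
    {LM : Type*} [AddCommGroup LM] [Module (LinfTop (complSigma μ)) LM] [Module ℝ LM]
    (pnL : LM → LinfTop (complSigma μ)) (T : M →ₗ[ℝ] LM) : Prop where
  normed : IsNormedModule pnL
  norm_map : ∀ v, pnL (T v) = ℓ.lift (pn v)
  generates : Generates pnL (Set.range T)

/-- `(PM, P)` is the pullback of the `L^∞(μX)`-normed module `M` along `φ`: `PM` is an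
`L^∞(μY)`-normed module, `P : M → PM` is linear with `|P v| = |v| ∘ φ`, and the image of `P`
generates `PM`. -/
structure IsPullback {X Y : Type*} [MeasurableSpace X] [MeasurableSpace Y] {μX : Measure X}
    {μY : Measure Y} (φ : Y → X)
    {M : Type*} [AddCommGroup M] [Module (LinfMu μX) M] [Module ℝ M] (pn : M → LinfMu μX)
    {PM : Type*} [AddCommGroup PM] [Module (LinfMu μY) PM] [Module ℝ PM]
    (pnP : PM → LinfMu μY) (P : M →ₗ[ℝ] PM) : Prop where
  normed : IsNormedModule pnP
  norm_map : ∀ (v : M) (f : X → ℝ), (pn v : Germ (ae μX) ℝ) = (f : Germ (ae μX) ℝ) →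
    (pnP (P v) : Germ (ae μY) ℝ) = ((f ∘ φ : Y → ℝ) : Germ (ae μY) ℝ)
  generates : Generates pnP (Set.range P)

/-! ### Existence of liftings and pullbacks of normed modules -/

section Existence

universe u v

variable {Y : Type u} {m : MeasurableSpace Y} {M : Type v} [AddCommGroup M] [Module ℝ M]

/-- A pointwise seminorm on `M`, with values in the bounded measurable functions on `Y`. -/
structure PtSeminorm (m : MeasurableSpace Y) (M : Type v) [AddCommGroup M] [Module ℝ M] where
  toFun : M → Y → ℝ
  mem : ∀ v, toFun v ∈ boundedMeasurable m
  add_le : ∀ v w y, toFun (v + w) y ≤ toFun v y + toFun w y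
  smul_eq : ∀ (c : ℝ) v y, toFun (c • v) y = |c| * toFun v y

/-- `M` with the seminorm at the point `y`. -/
def PtSeminorm.At (_p : PtSeminorm m M) (_y : Y) : Type v := M

namespace PtSeminorm

variable (p : PtSeminorm m M)

instance (y : Y) : AddCommGroup (p.At y) := inferInstanceAs (AddCommGroup M)
instance (y : Y) : Module ℝ (p.At y) := inferInstanceAs (Module ℝ M)

/-- The seminorm at `y`. -/
def seminormAt (y : Y) : Seminorm ℝ (p.At y) :=
  Seminorm.of (fun v => p.toFun v y) (fun v w => p.add_le v w y) (fun c v => p.smul_eq c v y)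

instance (y : Y) : SeminormedAddCommGroup (p.At y) :=
  (p.seminormAt y).toAddGroupSeminorm.toSeminormedAddCommGroup

instance (y : Y) : NormedSpace ℝ (p.At y) where
  norm_smul_le c v := ((p.seminormAt y).smul' c v).le

/-- The completed fibre at `y`. -/
abbrev Fib (y : Y) : Type v := UniformSpace.Completion (p.At y)

/-- The sections of the completed fibres. -/
def Sec : Type (max u v) := ∀ y, p.Fib y

instance : AddCommGroup p.Sec := inferInstanceAs (AddCommGroup (∀ y, p.Fib y))
instance : Module (Y → ℝ) p.Sec := inferInstanceAs (Module (Y → ℝ) (∀ y, p.Fib y))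

/-- The canonical map to the fibre. -/
def ι (y : Y) : M →ₗ[ℝ] p.Fib y :=
  (UniformSpace.Completion.toComplₗᵢ (𝕜 := ℝ) (E := p.At y)).toLinearMap

theorem norm_ι (y : Y) (v : M) : ‖p.ι y v‖ = p.toFun v y :=
  (UniformSpace.Completion.toComplₗᵢ (𝕜 := ℝ) (E := p.At y)).norm_map v

/-- Uniform approximability by countably valued sections. -/
def Approx (s : p.Sec) : Prop := ∀ ε : ℝ, 0 < ε → ∃ (k : Y → ℕ) (v : ℕ → M),
  Measurable[m] k ∧ ∀ y, ‖s y - p.ι y (v (k y))‖ ≤ ε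

theorem approx_of_countable {s : p.Sec} (K : ℝ → Type) [∀ ε, Countable (K ε)]
    (h : ∀ ε : ℝ, 0 < ε → ∃ (k : Y → K ε) (v : K ε → M),
      Measurable[m, ⊤] k ∧ ∀ y, ‖s y - p.ι y (v (k y))‖ ≤ ε) : p.Approx s := by
  classical
  intro ε hε
  obtain ⟨k, v, hk, hv⟩ := h ε hε
  obtain ⟨e, he⟩ := exists_injective_nat (K ε)
  refine ⟨fun y => e (k y), fun n => if h : ∃ a, e a = n then v h.choose else 0, ?_, fun y => ?_⟩
  · exact (measurable_from_top (f := e)).comp hk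
  · have hex : ∃ a, e a = e (k y) := ⟨k y, rfl⟩
    have : hex.choose = k y := he hex.choose_spec
    simp only [dif_pos hex, this]
    exact hv y

/-- The bounded strongly measurable sections. -/
def sections : Submodule (boundedMeasurable m) p.Sec where
  carrier := {s | p.Approx s ∧ ∃ C : ℝ, ∀ y, ‖s y‖ ≤ C}
  add_mem' := by
    rintro s t ⟨hs, C, hC⟩ ⟨ht, D, hD⟩
    refine ⟨?_, C + D, fun y => (norm_add_le _ _).trans (add_le_add (hC y) (hD y))⟩
    refine p.approx_of_countable (fun _ => ℕ × ℕ) fun ε hε => ?_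
    obtain ⟨k, v, hk, hv⟩ := hs (ε / 2) (half_pos hε)
    obtain ⟨k', v', hk', hv'⟩ := ht (ε / 2) (half_pos hε)
    refine ⟨fun y => (k y, k' y), fun a => v a.1 + v' a.2, ?_, fun y => ?_⟩
    · have : Measurable[m] fun y => (k y, k' y) := hk.prodMk hk'
      exact fun a _ => this (MeasurableSet.of_discrete (s := a))
    · have e : (s + t) y - p.ι y (v (k y) + v' (k' y)) =
          (s y - p.ι y (v (k y))) + (t y - p.ι y (v' (k' y))) := by
        rw [map_add]
        change s y + t y - _ = _
        abel
      change ‖(s + t) y - p.ι y (v (k y) + v' (k' y))‖ ≤ ε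
      rw [e]
      exact (norm_add_le _ _).trans (by linarith [hv y, hv' y])
  zero_mem' := ⟨fun ε hε => ⟨fun _ => 0, fun _ => 0, measurable_const, fun y => by
      rw [map_zero, sub_zero]
      exact (norm_zero (E := p.Fib y)).le.trans hε.le⟩,
    0, fun y => (norm_zero (E := p.Fib y)).le⟩
  smul_mem' := by
    rintro ⟨f, hf, B, hB⟩ s ⟨hs, C, hC⟩
    refine ⟨?_, |B| * |C|, fun y => ?_⟩
    · refine p.approx_of_countable (fun _ => ℤ × ℕ) fun ε hε => ?_
      have hC0 : 0 < |C| + 1 := by positivity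
      set η := ε / 2 / (|C| + 1) with hη
      have hηpos : 0 < η := by positivity
      have hB0 : 0 < |B| + η + 1 := by positivity
      set δ := ε / 2 / (|B| + η + 1) with hδ
      have hδpos : 0 < δ := by positivity
      obtain ⟨k, v, hk, hv⟩ := hs δ hδpos
      refine ⟨fun y => (⌊f y / η⌋, k y), fun a => ((a.1 : ℝ) * η) • v a.2, ?_, fun y => ?_⟩
      · have : Measurable[m] fun y => (⌊f y / η⌋, k y) :=
          (Int.measurable_floor.comp (hf.div_const η)).prodMk hk
        exact fun a _ => this (MeasurableSet.of_discrete (s := a))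
      · change ‖f y • s y - p.ι y (((⌊f y / η⌋ : ℝ) * η) • v (k y))‖ ≤ ε
        set q := (⌊f y / η⌋ : ℝ) * η with hq
        have h1 : |f y - q| ≤ η := by
          have h2 := Int.floor_le (f y / η)
          have h3 := Int.lt_floor_add_one (f y / η)
          rw [le_div_iff₀ hηpos] at h2
          rw [div_lt_iff₀ hηpos] at h3
          rw [abs_le]
          constructor <;> linarith
        have h4 : |q| ≤ |B| + η := by
          have : |q| ≤ |f y| + |f y - q| := by
            have := abs_sub_abs_le_abs_sub q (f y)
            rw [abs_sub_comm] at this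
            linarith
          linarith [hB y, le_abs_self B]
        have e : f y • s y - p.ι y (q • v (k y)) =
            (f y - q) • s y + q • (s y - p.ι y (v (k y))) := by
          rw [map_smul, sub_smul, smul_sub]
          abel
        rw [e]
        refine (norm_add_le _ _).trans ?_
        rw [norm_smul, norm_smul, Real.norm_eq_abs, Real.norm_eq_abs]
        have h5 : |f y - q| * ‖s y‖ ≤ η * (|C| + 1) :=
          mul_le_mul h1 (((hC y).trans (le_abs_self C)).trans (by linarith)) (norm_nonneg _)
            hηpos.le
        have h6 : |q| * ‖s y - p.ι y (v (k y))‖ ≤ (|B| + η + 1) * δ :=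
          mul_le_mul (h4.trans (by linarith)) (hv y) (norm_nonneg _) hB0.le
        have h7 : η * (|C| + 1) = ε / 2 := by rw [hη]; field_simp
        have h8 : (|B| + η + 1) * δ = ε / 2 := by rw [hδ]; field_simp
        linarith
    · change ‖f y • s y‖ ≤ _
      rw [norm_smul, Real.norm_eq_abs]
      exact mul_le_mul ((hB y).trans (le_abs_self B)) ((hC y).trans (le_abs_self C))
        (norm_nonneg _) (abs_nonneg _)

theorem norm_mem (s : p.sections) : (fun y => ‖s.1 y‖) ∈ boundedMeasurable m := by
  obtain ⟨s, hs, C, hC⟩ := s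
  refine ⟨?_, C, fun y => by rw [abs_of_nonneg (norm_nonneg _)]; exact hC y⟩
  choose k v hk hv using fun n : ℕ => hs (1 / ((n : ℝ) + 1)) (by positivity)
  refine measurable_of_tendsto_metrizable (f := fun n y => p.toFun (v n (k n y)) y) ?_ ?_
  · intro n
    have h1 : Measurable fun x : ℕ × Y => p.toFun (v n x.1) x.2 :=
      measurable_from_prod_countable_right fun i => (p.mem (v n i)).1
    exact h1.comp ((hk n).prodMk measurable_id)
  · rw [tendsto_pi_nhds]
    intro y
    rw [tendsto_iff_norm_sub_tendsto_zero]
    refine squeeze_zero (fun _ => norm_nonneg _) (fun n => ?_)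
      (tendsto_one_div_add_atTop_nhds_zero_nat (𝕜 := ℝ))
    rw [← p.norm_ι, norm_sub_rev]
    exact (abs_norm_sub_norm_le _ _).trans (hv n y)

/-- The sections which vanish off a negligible set. -/
def null (l : Filter Y) : Submodule (boundedMeasurable m) p.sections where
  carrier := {s | ∀ᶠ y in l, s.1 y = 0}
  add_mem' := by
    intro s t hs ht
    filter_upwards [hs, ht] with y h h'
    change s.1 y + t.1 y = 0
    rw [h, h', add_zero]
  zero_mem' := Eventually.of_forall fun y => rfl
  smul_mem' := by
    intro f s hs
    filter_upwards [hs] with y h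
    change f.1 y • s.1 y = 0
    rw [h, smul_zero]

/-- The module of bounded strongly measurable sections modulo equality off negligible sets. -/
def Quot (l : Filter Y) : Type (max u v) := p.sections ⧸ p.null l

variable {l : Filter Y}

instance : AddCommGroup (p.Quot l) := inferInstanceAs (AddCommGroup (p.sections ⧸ p.null l))
instance : Module (boundedMeasurable m) (p.Quot l) :=
  inferInstanceAs (Module _ (p.sections ⧸ p.null l))

/-- The class of a section. -/
def cls (l : Filter Y) : p.sections →ₗ[boundedMeasurable m] p.Quot l := (p.null l).mkQ

theorem cls_surjective : Function.Surjective (p.cls l) := Submodule.mkQ_surjective _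

theorem cls_eq_iff {s t : p.sections} : p.cls l s = p.cls l t ↔ ∀ᶠ y in l, s.1 y = t.1 y := by
  have h1 : p.cls l s = p.cls l t ↔ s - t ∈ p.null l := Submodule.Quotient.eq _
  rw [h1]
  refine eventually_congr (Eventually.of_forall fun y => ?_)
  change s.1 y - t.1 y = 0 ↔ _
  rw [sub_eq_zero]

instance : SMul (Linf m l) (p.Quot l) := ⟨fun g q => Linf.rep g • q⟩

theorem proj_smul (f : boundedMeasurable m) (q : p.Quot l) : Linf.proj m l f • q = f • q := by
  obtain ⟨s, rfl⟩ := p.cls_surjective q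
  have hfg : ∀ᶠ y in l, (Linf.rep (Linf.proj m l f)).1 y = f.1 y :=
    Germ.coe_eq.1 (congrArg Subtype.val (Linf.proj_rep (Linf.proj m l f)))
  change Linf.rep (Linf.proj m l f) • p.cls l s = _
  rw [← map_smul, ← map_smul, cls_eq_iff]
  filter_upwards [hfg] with y hy
  change (Linf.rep (Linf.proj m l f)).1 y • s.1 y = f.1 y • s.1 y
  rw [hy]

instance : Module (Linf m l) (p.Quot l) :=
  Function.Surjective.moduleLeft (Linf.proj m l) Linf.proj_surjective p.proj_smul

instance : Module ℝ (p.Quot l) := Module.compHom _ (algebraMap ℝ (Linf m l))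

instance : IsScalarTower ℝ (Linf m l) (p.Quot l) where
  smul_assoc c f q := by
    rw [Algebra.smul_def, mul_smul]
    rfl

/-- The pointwise norm. -/
def ptNorm (q : p.Quot l) : Linf m l :=
  Linf.proj m l ⟨_, p.norm_mem (p.cls_surjective q).choose⟩

theorem ptNorm_cls (s : p.sections) :
    p.ptNorm (p.cls l s) = Linf.proj m l ⟨_, p.norm_mem s⟩ := by
  have h := p.cls_eq_iff.1 (p.cls_surjective (p.cls l s)).choose_spec
  refine Subtype.ext (Germ.coe_eq.2 ?_)
  filter_upwards [h] with y hy
  change ‖(p.cls_surjective (p.cls l s)).choose.1 y‖ = ‖s.1 y‖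
  rw [hy]

theorem ι_mem_sections (v : M) : (fun y => p.ι y v : p.Sec) ∈ p.sections := by
  obtain ⟨C, hC⟩ := (p.mem v).2
  refine ⟨fun ε hε => ⟨fun _ => 0, fun _ => v, measurable_const, fun y => ?_⟩, C, fun y => ?_⟩
  · rw [sub_self]
    exact (norm_zero (E := p.Fib y)).le.trans hε.le
  · rw [norm_ι]
    exact (le_abs_self _).trans (hC y)

/-- The canonical map into the module of sections. -/
def toQuot (l : Filter Y) : M →ₗ[ℝ] p.Quot l where
  toFun v := p.cls l ⟨_, p.ι_mem_sections v⟩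
  map_add' v w := by
    rw [← map_add, cls_eq_iff]
    exact Eventually.of_forall fun y => map_add (p.ι y) v w
  map_smul' c v := by
    have h : ∀ q : p.Quot l, c • q =
        (⟨fun _ => c, measurable_const, |c|, fun _ => le_rfl⟩ : boundedMeasurable m) • q :=
      fun q => p.proj_smul _ q
    rw [RingHom.id_apply, h, ← map_smul, cls_eq_iff]
    exact Eventually.of_forall fun y => map_smul (p.ι y) c v

theorem ptNorm_toQuot (v : M) :
    p.ptNorm (p.toQuot l v) = Linf.proj m l ⟨_, p.mem v⟩ := by
  refine (p.ptNorm_cls _).trans (congrArg _ (Subtype.ext (funext fun y => p.norm_ι y v)))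

theorem ind_smul_cls (E : Set Y) (hE : MeasurableSet[m] E) (s t : p.sections) :
    Linf.ind l E hE • p.cls l s = Linf.ind l E hE • p.cls l t ↔
      ∀ᶠ y in l, y ∈ E → s.1 y = t.1 y := by
  unfold Linf.ind
  rw [p.proj_smul, p.proj_smul, ← map_smul, ← map_smul, cls_eq_iff]
  refine eventually_congr (Eventually.of_forall fun y => ?_)
  change E.indicator (1 : Y → ℝ) y • s.1 y = E.indicator (1 : Y → ℝ) y • t.1 y ↔ _
  by_cases h : y ∈ E <;> simp [h]

theorem eventually_of_nrm_lt {f : boundedMeasurable m} {C : ℝ}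
    (h : Linf.nrm (Linf.proj m l f) < C) : ∀ᶠ y in l, |f.1 y| ≤ C := by
  obtain ⟨D, hD, hlt, hb⟩ := Linf.exists_bound (Linf.proj m l f) (sub_pos.2 h)
  have hb : ∀ᶠ y in l, |f.1 y| ≤ D := hb
  filter_upwards [hb] with y hy
  linarith

theorem nrm_proj_le {f : boundedMeasurable m} {C : ℝ} (hC : 0 ≤ C)
    (h : ∀ᶠ y in l, |f.1 y| ≤ C) : Linf.nrm (Linf.proj m l f) ≤ C :=
  Linf.nrm_le _ hC h

/-- Countably valued sections, glued along a measurable index. -/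
theorem glue_mem {s : p.Sec} (idx : Y → ℕ) (hidx : Measurable[m] idx) (t : ℕ → p.sections)
    (ht : ∀ y, s y = (t (idx y)).1 y) (C : ℝ) (hC : ∀ y, ‖s y‖ ≤ C) : s ∈ p.sections := by
  refine ⟨p.approx_of_countable (fun _ => ℕ × ℕ) fun ε hε => ?_, C, hC⟩
  choose k v hk hv using fun n => (t n).2.1 ε hε
  refine ⟨fun y => (idx y, k (idx y) y), fun a => v a.1 a.2, ?_, fun y => ?_⟩
  · have h1 : Measurable fun x : ℕ × Y => k x.1 x.2 :=
      measurable_from_prod_countable_right fun i => hk i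
    have h2 : Measurable[m] fun y => (idx y, k (idx y) y) :=
      hidx.prodMk (h1.comp (hidx.prodMk measurable_id))
    exact fun a _ => h2 (MeasurableSet.of_discrete (s := a))
  · rw [ht]
    exact hv (idx y) y

theorem exists_index {E : ℕ → Set Y} (hE : IsPartition m E) :
    ∃ idx : Y → ℕ, Measurable[m] idx ∧ ∀ n y, y ∈ E n ↔ idx y = n := by
  have hcov : ∀ y, ∃ n, y ∈ E n := fun y => by
    simpa using (Set.ext_iff.1 hE.cover y).2 trivial
  choose idx hidx using hcov
  have hiff : ∀ n y, y ∈ E n ↔ idx y = n := by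
    intro n y
    constructor
    · intro h
      by_contra hne
      exact Set.disjoint_left.1 (hE.disjoint hne) (hidx y) h
    · rintro rfl
      exact hidx y
  refine ⟨idx, measurable_to_countable' fun n => ?_, hiff⟩
  have : idx ⁻¹' {n} = E n := by
    ext y
    simp [hiff]
  rw [this]
  exact hE.measurable n

theorem exists_glue (E : ℕ → Set Y) (hE : IsPartition m E) (v : ℕ → p.Quot l) (C : ℝ)
    (hC : ∀ n, Linf.nrm (Linf.ind l (E n) (hE.measurable n) * p.ptNorm (v n)) ≤ C) :
    ∃ w : p.Quot l, ∀ n, Linf.ind l (E n) (hE.measurable n) • w =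
      Linf.ind l (E n) (hE.measurable n) • v n := by
  choose s hs using fun n => p.cls_surjective (l := l) (v n)
  obtain ⟨idx, hidx, hiff⟩ := exists_index hE
  have hb : ∀ n, ∀ᶠ y in l, y ∈ E n → ‖(s n).1 y‖ ≤ C + 1 := by
    intro n
    have h1 : Linf.nrm (Linf.ind l (E n) (hE.measurable n) * p.ptNorm (v n)) < C + 1 :=
      (hC n).trans_lt (lt_add_one C)
    rw [← hs n, ptNorm_cls] at h1
    unfold Linf.ind at h1
    rw [← map_mul] at h1
    filter_upwards [eventually_of_nrm_lt h1] with y hy hyE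
    have h2 : |(E n).indicator (1 : Y → ℝ) y * ‖(s n).1 y‖| ≤ C + 1 := hy
    rw [Set.indicator_of_mem hyE, Pi.one_apply, one_mul, abs_norm] at h2
    exact h2
  let n0 : Y → ℝ := fun y => ‖(s (idx y)).1 y‖
  have hn0m : Measurable[m] n0 := by
    have key : ∀ g : ℕ → Y → ℝ, (∀ i, Measurable[m] (g i)) → Measurable[m] fun y => g (idx y) y := by
      intro g hg
      have h1 : Measurable fun x : ℕ × Y => g x.1 x.2 :=
        measurable_from_prod_countable_right hg
      exact h1.comp (hidx.prodMk measurable_id)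
    exact key (fun i y => ‖(s i).1 y‖) fun i => (p.norm_mem (s i)).1
  classical
  let idx' : Y → ℕ := fun y => if n0 y ≤ C + 1 then idx y + 1 else 0
  have hidx'm : Measurable[m] idx' :=
    Measurable.ite (measurableSet_le hn0m measurable_const)
      ((measurable_from_top (f := fun n : ℕ => n + 1)).comp hidx) measurable_const
  let t : ℕ → p.sections := fun n => Nat.casesOn n 0 s
  have hw : (fun y => (t (idx' y)).1 y : p.Sec) ∈ p.sections := by
    refine p.glue_mem idx' hidx'm t (fun y => rfl) |C + 1| fun y => ?_
    by_cases h : n0 y ≤ C + 1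
    · have : idx' y = idx y + 1 := if_pos h
      rw [this]
      exact h.trans (le_abs_self _)
    · have : idx' y = 0 := if_neg h
      rw [this]
      exact (norm_zero (E := p.Fib y)).le.trans (abs_nonneg _)
  refine ⟨p.cls l ⟨_, hw⟩, fun n => ?_⟩
  rw [← hs n, ind_smul_cls]
  filter_upwards [hb n] with y hy hyE
  have h1 : idx y = n := (hiff n y).1 hyE
  have h2 : n0 y ≤ C + 1 := by
    change ‖(s (idx y)).1 y‖ ≤ C + 1
    rw [h1]
    exact hy hyE
  have h3 : idx' y = n + 1 := by
    rw [← h1]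
    exact if_pos h2
  change (t (idx' y)).1 y = (s n).1 y
  rw [h3]

theorem exists_limit [CountableInterFilter l] (u : ℕ → p.Quot l)
    (hu : ∀ ε : ℝ, 0 < ε → ∃ N, ∀ i, N ≤ i → ∀ j, N ≤ j →
      Linf.nrm (p.ptNorm (u i - u j)) < ε) :
    ∃ w : p.Quot l, Tendsto (fun n => Linf.nrm (p.ptNorm (u n - w))) atTop (𝓝 0) := by
  choose s hs using fun n => p.cls_surjective (l := l) (u n)
  have hu' : ∀ k : ℕ, ∃ N, ∀ i, N ≤ i → ∀ j, N ≤ j →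
      ∀ᶠ y in l, ‖(s i).1 y - (s j).1 y‖ ≤ (1 / 2 : ℝ) ^ k := by
    intro k
    obtain ⟨N, hN⟩ := hu ((1 / 2 : ℝ) ^ k) (by positivity)
    refine ⟨N, fun i hi j hj => ?_⟩
    have h1 := hN i hi j hj
    rw [← hs i, ← hs j, ← map_sub, ptNorm_cls] at h1
    filter_upwards [eventually_of_nrm_lt h1] with y hy
    have h2 : |‖(s i).1 y - (s j).1 y‖| ≤ (1 / 2 : ℝ) ^ k := hy
    rwa [abs_norm] at h2
  choose N hN using hu'
  let K : ℕ → ℕ := fun k => ∑ i ∈ Finset.range (k + 1), N i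
  have hKN : ∀ k, N k ≤ K k := fun k =>
    Finset.single_le_sum (f := N) (fun _ _ => Nat.zero_le _) (Finset.self_mem_range_succ k)
  have hKK : ∀ k, N k ≤ K (k + 1) := fun k => (hKN k).trans
    (Finset.sum_le_sum_of_subset (Finset.range_subset_range.2 (Nat.le_succ _)))
  set A : Set Y := {y | ∀ k, ‖(s (K k)).1 y - (s (K (k + 1))).1 y‖ ≤ (1 / 2 : ℝ) ^ k} with hA
  have hAm : MeasurableSet[m] A := by
    rw [hA, Set.ofPred_forall]
    exact MeasurableSet.iInter fun k =>
      measurableSet_le (p.norm_mem (s (K k) - s (K (k + 1)))).1 measurable_const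
  have hAl : ∀ᶠ y in l, y ∈ A := by
    have : ∀ᶠ y in l, ∀ k, ‖(s (K k)).1 y - (s (K (k + 1))).1 y‖ ≤ (1 / 2 : ℝ) ^ k :=
      eventually_countable_forall.2 fun k => hN k _ (hKN k) _ (hKK k)
    exact this
  let a : boundedMeasurable m := ⟨_, indicator_mem_boundedMeasurable A hAm⟩
  let t : ℕ → p.sections := fun k => a • s (K k)
  have htA : ∀ k y, y ∈ A → (t k).1 y = (s (K k)).1 y := by
    intro k y hy
    change A.indicator (1 : Y → ℝ) y • (s (K k)).1 y = _
    rw [Set.indicator_of_mem hy, Pi.one_apply, one_smul]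
  have htA' : ∀ k y, y ∉ A → (t k).1 y = 0 := by
    intro k y hy
    change A.indicator (1 : Y → ℝ) y • (s (K k)).1 y = _
    rw [Set.indicator_of_notMem hy, zero_smul]
  have hdist : ∀ y k, dist ((t k).1 y) ((t (k + 1)).1 y) ≤ 1 * (1 / 2 : ℝ) ^ k := by
    intro y k
    rw [dist_eq_norm, one_mul]
    by_cases hy : y ∈ A
    · rw [htA _ _ hy, htA _ _ hy]
      exact hy k
    · rw [htA' _ _ hy, htA' _ _ hy, sub_zero]
      exact (norm_zero (E := p.Fib y)).le.trans (by positivity)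
  have hcau : ∀ y, CauchySeq fun k => (t k).1 y := fun y =>
    cauchySeq_of_le_geometric (1 / 2) 1 (by norm_num) (hdist y)
  choose w hw using fun y => cauchySeq_tendsto_of_complete (hcau y)
  have hwd : ∀ y k, ‖(t k).1 y - w y‖ ≤ 2 * (1 / 2 : ℝ) ^ k := by
    intro y k
    have h1 := dist_le_of_le_geometric_of_tendsto (1 / 2) 1 (by norm_num) (hdist y) (hw y) k
    rw [dist_eq_norm] at h1
    refine h1.trans (le_of_eq ?_)
    norm_num
    ring
  have hwm : (w : p.Sec) ∈ p.sections := by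
    obtain ⟨C, hC⟩ := (t 0).2.2
    refine ⟨fun ε hε => ?_, C + 2, fun y => ?_⟩
    · obtain ⟨k, hk⟩ := exists_pow_lt_of_lt_one (show 0 < ε / 4 by positivity)
        (show (1 / 2 : ℝ) < 1 by norm_num)
      obtain ⟨κ, v, hκ, hv⟩ := (t k).2.1 (ε / 2) (half_pos hε)
      refine ⟨κ, v, hκ, fun y => ?_⟩
      have e : w y - p.ι y (v (κ y)) =
          -((t k).1 y - w y) + ((t k).1 y - p.ι y (v (κ y))) := by abel
      rw [e]
      refine (norm_add_le _ _).trans ?_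
      rw [norm_neg]
      linarith [hwd y k, hv y]
    · have e : w y = (t 0).1 y - ((t 0).1 y - w y) := by abel
      rw [e]
      refine (norm_sub_le _ _).trans ?_
      have := hwd y 0
      rw [pow_zero] at this
      linarith [hC y]
  refine ⟨p.cls l ⟨w, hwm⟩, ?_⟩
  rw [Metric.tendsto_atTop]
  intro ε hε
  obtain ⟨k, hk⟩ := exists_pow_lt_of_lt_one (show 0 < ε / 4 by positivity)
    (show (1 / 2 : ℝ) < 1 by norm_num)
  refine ⟨N k, fun i hi => ?_⟩
  rw [Real.dist_eq, sub_zero, abs_of_nonneg (Linf.nrm_nonneg _), ← hs i, ← map_sub, ptNorm_cls]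
  have h3 : 3 * (1 / 2 : ℝ) ^ k < ε := by linarith
  refine (nrm_proj_le (by positivity) ?_).trans_lt h3
  filter_upwards [hAl, hN k i hi (K k) (hKN k)] with y hy hy'
  change |‖(s i).1 y - w y‖| ≤ _
  rw [abs_norm]
  have e : (s i).1 y - w y = ((s i).1 y - (s (K k)).1 y) + ((t k).1 y - w y) := by
    rw [htA k y hy]
    abel
  rw [e]
  exact (norm_add_le _ _).trans (by linarith [hwd y k])

theorem isNormedModule [CountableInterFilter l] :
    IsNormedModule (p.ptNorm : p.Quot l → Linf m l) where
  nonneg q := by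
    obtain ⟨s, rfl⟩ := p.cls_surjective q
    rw [ptNorm_cls]
    exact Eventually.of_forall fun y => norm_nonneg (s.1 y)
  eq_zero_iff q := by
    obtain ⟨s, rfl⟩ := p.cls_surjective q
    rw [ptNorm_cls, ← map_zero (p.cls l), cls_eq_iff, ← Subtype.coe_inj]
    refine Germ.coe_eq.trans (eventually_congr (Eventually.of_forall fun y => ?_))
    exact norm_eq_zero (a := (s.1 y : p.Fib y))
  add_le q r := by
    obtain ⟨s, rfl⟩ := p.cls_surjective q
    obtain ⟨t, rfl⟩ := p.cls_surjective r
    rw [← map_add, ptNorm_cls, ptNorm_cls, ptNorm_cls]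
    exact Eventually.of_forall fun y => norm_add_le (s.1 y) (t.1 y)
  smul_eq g q := by
    obtain ⟨s, rfl⟩ := p.cls_surjective q
    obtain ⟨f, rfl⟩ := Linf.proj_surjective g
    rw [proj_smul, ← map_smul, ptNorm_cls, ptNorm_cls]
    exact Germ.coe_eq.2 (Eventually.of_forall fun y => norm_smul (f.1 y) (s.1 y))
  glueing E hE v := fun ⟨C, hC⟩ => p.exists_glue E hE v C hC
  complete u hu := p.exists_limit u hu

theorem generates : Generates (p.ptNorm : p.Quot l → Linf m l) (Set.range (p.toQuot l)) := by
  intro q ε hε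
  obtain ⟨s, rfl⟩ := p.cls_surjective q
  obtain ⟨k, v, hk, hv⟩ := s.2.1 (ε / 2) (half_pos hε)
  obtain ⟨C, hC⟩ := s.2.2
  have hbd : ∀ y, ‖p.ι y (v (k y))‖ ≤ |C| + ε / 2 := by
    intro y
    have e : p.ι y (v (k y)) = s.1 y - (s.1 y - p.ι y (v (k y))) := by abel
    rw [e]
    exact (norm_sub_le _ _).trans (add_le_add ((hC y).trans (le_abs_self C)) (hv y))
  have hu : (fun y => p.ι y (v (k y)) : p.Sec) ∈ p.sections :=
    p.glue_mem k hk (fun n => ⟨_, p.ι_mem_sections (v n)⟩) (fun y => rfl) _ hbd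
  have hE : IsPartition m fun n => k ⁻¹' {n} :=
    { measurable := fun n => hk (MeasurableSet.singleton n)
      disjoint := fun i j hij => Set.disjoint_left.2 fun y hi hj => hij (hi.symm.trans hj)
      cover := Set.eq_univ_of_forall fun y => Set.mem_iUnion.2 ⟨k y, rfl⟩ }
  refine ⟨p.cls l ⟨_, hu⟩, ?_, _, hE, fun n => p.toQuot l (v n), fun n => ⟨v n, rfl⟩,
    ⟨|C| + ε / 2, fun n => ?_⟩, fun n => ?_⟩
  · rw [← map_sub, ptNorm_cls]
    refine (nrm_proj_le (half_pos hε).le (Eventually.of_forall fun y => ?_)).trans_lt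
      (half_lt_self hε)
    change |‖s.1 y - p.ι y (v (k y))‖| ≤ _
    rw [abs_norm]
    exact hv y
  · unfold Linf.ind
    rw [proj_smul]
    change Linf.nrm (p.ptNorm (_ • p.cls l _)) ≤ _
    rw [← map_smul, ptNorm_cls]
    refine nrm_proj_le (by positivity) (Eventually.of_forall fun y => ?_)
    change |‖(k ⁻¹' {n}).indicator (1 : Y → ℝ) y • p.ι y (v n)‖| ≤ _
    rw [abs_norm]
    by_cases h : y ∈ k ⁻¹' {n}
    · rw [Set.indicator_of_mem h, Pi.one_apply, one_smul]
      have h' : k y = n := h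
      rw [← h']
      exact hbd y
    · rw [Set.indicator_of_notMem h, zero_smul]
      exact (norm_zero (E := p.Fib y)).le.trans (by positivity)
  · refine (p.ind_smul_cls _ _ _ _).2 (Eventually.of_forall fun y hy => ?_)
    have h' : k y = n := hy
    change p.ι y (v (k y)) = p.ι y (v n)
    rw [h']

end PtSeminorm

end Existence

section

universe u v w

variable {X : Type u} [MeasurableSpace X] {μX : Measure X} {M : Type v} [AddCommGroup M]
  [Module (LinfMu μX) M] [Module ℝ M] [IsScalarTower ℝ (LinfMu μX) M]

/-- The pointwise seminorm `v ↦ ℓ(|v|) ∘ φ`. -/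
def liftSeminorm {Y : Type w} {m : MeasurableSpace Y} (ℓ : Lifting μX) (φ : Y → X)
    (hφ : Measurable[m, complSigma μX] φ) (pn : M → LinfMu μX) (hM : IsNormedModule pn) :
    PtSeminorm m M where
  toFun v y := ℓ.funLift (Linf.rep (pn v)) (φ y)
  mem v := by
    obtain ⟨h1, C, hC⟩ := ℓ.funLift_mem (Linf.rep (pn v)).2
    exact ⟨h1.comp hφ, C, fun y => hC _⟩
  add_le v w y := by
    refine (ℓ.funLift_mono (g := (Linf.rep (pn v)).1 + (Linf.rep (pn w)).1) (Linf.rep (pn (v + w))).2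
      (add_mem (Linf.rep (pn v)).2 (Linf.rep (pn w)).2) ?_ _).trans
      (ℓ.funLift_add_le (Linf.rep (pn v)).2 (Linf.rep (pn w)).2 _)
    have h := hM.add_le v w
    rw [← Linf.proj_rep (pn (v + w)), ← Linf.proj_rep (pn v), ← Linf.proj_rep (pn w)] at h
    exact h
  smul_eq c v y := by
    have h := hM.smul_eq (algebraMap ℝ _ c) v
    rw [algebraMap_smul] at h
    rw [← Linf.proj_rep (pn (c • v)), ← Linf.proj_rep (pn v)] at h
    have h' : ∀ᵐ x ∂μX, (Linf.rep (pn (c • v))).1 x = |c| * (Linf.rep (pn v)).1 x :=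
      Germ.coe_eq.1 h
    rw [← ℓ.funLift_smul (Linf.rep (pn v)).2]
    have hm := smul_mem_boundedMeasurable (Linf.rep (pn v)).2 |c|
    exact le_antisymm
      (ℓ.funLift_mono (Linf.rep (pn (c • v))).2 hm (h'.mono fun x hx => hx.le) _)
      (ℓ.funLift_mono hm (Linf.rep (pn (c • v))).2 (h'.mono fun x hx => hx.ge) _)

/-- Every normed module has a lifting. -/
theorem exists_isModuleLifting (ℓ : Lifting μX) (pn : M → LinfMu μX) (hM : IsNormedModule pn) :
    ∃ (LM : Type (max u v)) (_ : AddCommGroup LM) (_ : Module (LinfTop (complSigma μX)) LM)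
      (_ : Module ℝ LM) (_ : IsScalarTower ℝ (LinfTop (complSigma μX)) LM)
      (pnL : LM → LinfTop (complSigma μX)) (T : M →ₗ[ℝ] LM), IsModuleLifting ℓ pn pnL T := by
  let p : PtSeminorm (complSigma μX) M := liftSeminorm ℓ id measurable_id pn hM
  exact ⟨p.Quot ⊤, inferInstance, inferInstance, inferInstance, inferInstance, p.ptNorm,
    p.toQuot ⊤, p.isNormedModule, fun v => p.ptNorm_toQuot v, p.generates⟩

/-- Every normed module has a pullback. -/
theorem exists_isPullback {Y : Type w} [MeasurableSpace Y] {μY : Measure Y} (ℓ : Lifting μX)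
    (φ : Y → X) (hφ : @MeasurePreserving (NullMeasurableSpace Y μY) (NullMeasurableSpace X μX) _ _
      φ μY.completion μX.completion) (pn : M → LinfMu μX) (hM : IsNormedModule pn) :
    ∃ (PM : Type (max w v)) (_ : AddCommGroup PM) (_ : Module (LinfMu μY) PM)
      (_ : Module ℝ PM) (_ : IsScalarTower ℝ (LinfMu μY) PM)
      (pnP : PM → LinfMu μY) (P : M →ₗ[ℝ] PM), IsPullback φ pn pnP P := by
  let p : PtSeminorm (complSigma μY) M := liftSeminorm ℓ φ hφ.measurable pn hM
  refine ⟨p.Quot (ae μY), inferInstance, inferInstance, inferInstance, inferInstance, p.ptNorm,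
    p.toQuot (ae μY), p.isNormedModule, fun v f hf => ?_, p.generates⟩
  rw [p.ptNorm_toQuot v]
  refine Germ.coe_eq.2 ?_
  have h1 : ∀ᵐ x ∂μX, ℓ.funLift (Linf.rep (pn v)) x = f x := by
    rw [← Linf.proj_rep (pn v)] at hf
    filter_upwards [ℓ.funLift_ae_eq (Linf.rep (pn v)).2, Germ.coe_eq.1 hf] with x h h'
    exact h.trans h'
  have h2 : Tendsto φ (ae μY) (ae μX) := hφ.quasiMeasurePreserving.tendsto_ae
  exact h2.eventually h1

end

/-! ### Fibres of the lifted module -/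

section Fibre

variable {X : Type*} [MeasurableSpace X] {μ : Measure X}

/-- Atoms of a measure. -/
structure IsMeasureAtom (μ : Measure X) (A : Set X) : Prop where
  measurable : NullMeasurableSet A μ
  ne_zero : μ A ≠ 0
  eq_or : ∀ B, B ⊆ A → NullMeasurableSet B μ → μ B = 0 ∨ μ (A \ B) = 0

open Classical in
/-- The set carrying the fibre at `x`: the singleton `{x}` if it belongs to `Σ̄`, and the lifted
atom containing `x` otherwise. (For a σ-finite measure these two cases are exhaustive, so that the
value `univ` is never used; equivalent atoms have the same lifting and inequivalent ones have
disjoint liftings, so the choice of the atom does not matter.) -/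
def Lifting.fibreSet (ℓ : Lifting μ) (x : X) : Set X :=
  if NullMeasurableSet {x} μ then {x}
  else if h : ∃ A, IsMeasureAtom μ A ∧ x ∈ ℓ.toFun A then ℓ.toFun h.choose
  else Set.univ

theorem Lifting.mem_fibreSet (ℓ : Lifting μ) (x : X) : x ∈ ℓ.fibreSet x := by
  unfold Lifting.fibreSet
  split_ifs with h h'
  · rfl
  · exact h'.choose_spec.2
  · trivial

theorem Lifting.nullMeasurableSet_fibreSet (ℓ : Lifting μ) (x : X) :
    NullMeasurableSet (ℓ.fibreSet x) μ := by
  unfold Lifting.fibreSet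
  split_ifs with h h'
  · exact h
  · exact ℓ.measurable _ h'.choose_spec.1.measurable
  · exact MeasurableSet.univ.nullMeasurableSet

/-- The characteristic function of the set carrying the fibre at `x`. -/
def Lifting.fibreInd (ℓ : Lifting μ) (x : X) : LinfTop (complSigma μ) :=
  Linf.ind ⊤ (ℓ.fibreSet x) (ℓ.nullMeasurableSet_fibreSet x)

variable {LM : Type*} [AddCommGroup LM] [Module (LinfTop (complSigma μ)) LM]
  [Module ℝ LM] [IsScalarTower ℝ (LinfTop (complSigma μ)) LM]
  {pnL : LM → LinfTop (complSigma μ)}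

/-- The submodule `1_{x} · LM` (or `1_A · LM`, if `x` is in the lifted atom `A` and `{x}` is not
measurable), which is to be given the seminorm `v ↦ |v|(x)`. -/
def PreFibre (_h : IsNormedModule pnL) (ℓ : Lifting μ) (x : X) : Type _ :=
  ↥(LinearMap.range (LinearMap.lsmul (LinfTop (complSigma μ)) LM (ℓ.fibreInd x)))

variable (h : IsNormedModule pnL) (ℓ : Lifting μ) (x : X)

instance : AddCommGroup (PreFibre h ℓ x) :=
  inferInstanceAs (AddCommGroup
    ↥(LinearMap.range (LinearMap.lsmul (LinfTop (complSigma μ)) LM (ℓ.fibreInd x))))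

instance : Module ℝ (PreFibre h ℓ x) :=
  inferInstanceAs (Module ℝ
    ↥(LinearMap.range (LinearMap.lsmul (LinfTop (complSigma μ)) LM (ℓ.fibreInd x))))

/-- The element `1_{x} · v` (or `1_A · v`). -/
def PreFibre.mk (v : LM) : PreFibre h ℓ x := ⟨ℓ.fibreInd x • v, v, rfl⟩

/-- The seminorm `v ↦ |v|(x)`. -/
def preFibreSeminorm : Seminorm ℝ (PreFibre h ℓ x) :=
  Seminorm.of (fun v => Linf.eval x (pnL v.1))
    (fun v w => by
      have h1 := Linf.eval_mono x (h.add_le v.1 w.1)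
      rwa [Linf.eval_add] at h1)
    (fun c v => by
      have h1 := h.eval_smul x (algebraMap ℝ _ c) v.1
      rw [algebraMap_smul] at h1
      exact h1)

instance : SeminormedAddCommGroup (PreFibre h ℓ x) :=
  (preFibreSeminorm h ℓ x).toAddGroupSeminorm.toSeminormedAddCommGroup

instance : NormedSpace ℝ (PreFibre h ℓ x) where
  norm_smul_le c v := ((preFibreSeminorm h ℓ x).smul' c v).le

/-- The fibre at `x` of the lifted module: the submodule `1_{x} · LM` (or `1_A · LM`) with the norm
`v ↦ |v|(x)`, vectors of norm zero being identified with `0`. (If `{x}` is measurable then `0` is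
the only vector of norm zero.) -/
abbrev Fibre : Type _ := SeparationQuotient (PreFibre h ℓ x)

/-- The value `v_x` at `x` of an element `v` of the lifted module. -/
def valueAt (v : LM) : Fibre h ℓ x := SeparationQuotient.mk (PreFibre.mk h ℓ x v)

/-- The test vectors `y ↦ (T v)_{φ(y)}`, `v ∈ M`, on the collection of fibres over `φ(y)`. -/
def pullbackTest {Y : Type*} (φ : Y → X) {M : Type*} (T : M → LM) :
    Set (∀ y, Fibre h ℓ (φ y)) :=
  Set.range fun v y => valueAt h ℓ (φ y) (T v)

end Fibre

/-! ### Weak Banach bundles -/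

section WeakBundle

variable {Y : Type*} [MeasurableSpace Y] (μ : Measure Y) {V : Y → Type*}
  [∀ y, NormedAddCommGroup (V y)] [∀ y, NormedSpace ℝ (V y)]

/-- The sections `∑ᵢ fᵢ vᵢ` with `fᵢ` measurable functions and `vᵢ` test vectors. -/
def combinations (Test : Set (∀ y, V y)) : Set (∀ y, V y) :=
  {v | ∃ (n : ℕ) (f : Fin n → Y → ℝ) (t : Fin n → ∀ y, V y),
    (∀ i, Measurable[complSigma μ] (f i)) ∧ (∀ i, t i ∈ Test) ∧ ∀ y, v y = ∑ i, f i y • t i y}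

/-- The sections of the collection of dual spaces `(V y)'`. -/
def DualSections (V : Y → Type*) [∀ y, NormedAddCommGroup (V y)] [∀ y, NormedSpace ℝ (V y)] :
    Type _ := ∀ y, StrongDual ℝ (V y)

instance : AddCommGroup (DualSections V) :=
  inferInstanceAs (AddCommGroup (∀ y, StrongDual ℝ (V y)))

instance : Module (Y → ℝ) (DualSections V) :=
  inferInstanceAs (Module (Y → ℝ) (∀ y, StrongDual ℝ (V y)))

/-- The sections `w` of the dual spaces `(V y)'` which are weakly measurable (for every test vector
`v` the function `⟨w, v⟩` is measurable off a null set) and whose pointwise norm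
`|w| = ess sup {⟨w, v⟩ : v ∈ combinations μ Test, ‖v(·)‖ ≤ 1}` is in `L^∞(μ)`. -/
def weakSections (Test : Set (∀ y, V y)) :
    Submodule (boundedMeasurable (complSigma μ)) (DualSections V) where
  carrier := {w | (∀ v ∈ Test, AEMeasurable (fun y => w y (v y)) μ) ∧
    ∃ C : ℝ, ∀ v ∈ combinations μ Test, (∀ y, ‖v y‖ ≤ 1) → ∀ᵐ y ∂μ, |w y (v y)| ≤ C}
  add_mem' := by
    rintro w w' ⟨hw, C, hC⟩ ⟨hw', D, hD⟩
    refine ⟨fun v hv => (hw v hv).add (hw' v hv), C + D, fun v hv h1 => ?_⟩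
    filter_upwards [hC v hv h1, hD v hv h1] with y hy hy'
    exact (abs_add_le _ _).trans (add_le_add hy hy')
  zero_mem' := ⟨fun v _ => (measurable_const (a := (0 : ℝ))).aemeasurable, 0, fun v _ _ =>
    Eventually.of_forall fun y => abs_zero.le⟩
  smul_mem' := by
    rintro ⟨f, hf, B, hB⟩ w ⟨hw, C, hC⟩
    have hf' : AEMeasurable f μ := NullMeasurable.aemeasurable hf
    refine ⟨fun v hv => hf'.mul (hw v hv), B * C, fun v hv h1 => ?_⟩
    filter_upwards [hC v hv h1] with y hy
    change |f y * w y (v y)| ≤ _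
    rw [abs_mul]
    exact mul_le_mul (hB y) hy (abs_nonneg _) ((abs_nonneg _).trans (hB y))

/-- The sections `w` which are equivalent to `0`, that is, `⟨w, v⟩ = 0` off a null set for every
test vector `v`. -/
def weakNull (Test : Set (∀ y, V y)) :
    Submodule (boundedMeasurable (complSigma μ)) (weakSections μ Test) where
  carrier := {w | ∀ v ∈ Test, ∀ᵐ y ∂μ, w.1 y (v y) = 0}
  add_mem' := by
    intro w w' hw hw' v hv
    filter_upwards [hw v hv, hw' v hv] with y hy hy'
    change w.1 y (v y) + w'.1 y (v y) = 0
    rw [hy, hy', add_zero]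
  zero_mem' := fun v _ => Eventually.of_forall fun y => rfl
  smul_mem' := by
    intro f w hw v hv
    filter_upwards [hw v hv] with y hy
    change f.1 y * w.1 y (v y) = 0
    rw [hy, mul_zero]

/-- `L^∞_weak(V'; μ)`. -/
def LinfWeak (Test : Set (∀ y, V y)) : Type _ := weakSections μ Test ⧸ weakNull μ Test

variable {μ} {Test : Set (∀ y, V y)}

instance : AddCommGroup (LinfWeak μ Test) :=
  inferInstanceAs (AddCommGroup (weakSections μ Test ⧸ weakNull μ Test))

instance : Module (boundedMeasurable (complSigma μ)) (LinfWeak μ Test) :=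
  inferInstanceAs (Module _ (weakSections μ Test ⧸ weakNull μ Test))

/-- The class of a section in `L^∞_weak(V'; μ)`. -/
def LinfWeak.mk (w : weakSections μ Test) : LinfWeak μ Test := Submodule.Quotient.mk w

instance : SMul (LinfMu μ) (LinfWeak μ Test) := ⟨fun g q => Linf.rep g • q⟩

theorem LinfWeak.proj_smul (f : boundedMeasurable (complSigma μ)) (q : LinfWeak μ Test) :
    Linf.proj (complSigma μ) (ae μ) f • q = f • q := by
  obtain ⟨w, rfl⟩ := Submodule.Quotient.mk_surjective _ q
  set g := Linf.rep (Linf.proj (complSigma μ) (ae μ) f) with hg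
  have hfg : ∀ᵐ y ∂μ, g.1 y = f.1 y := by
    have := congrArg Subtype.val (Linf.proj_rep (Linf.proj (complSigma μ) (ae μ) f))
    exact Germ.coe_eq.1 this
  change Submodule.Quotient.mk (g • w) = Submodule.Quotient.mk (f • w)
  rw [Submodule.Quotient.eq]
  intro v _
  filter_upwards [hfg] with y hy
  change g.1 y * w.1 y (v y) - f.1 y * w.1 y (v y) = 0
  rw [hy, sub_self]

/-- Multiplication by `L^∞(μ)`-functions, induced by the pointwise product of a section with a
bounded measurable function. -/
instance : Module (LinfMu μ) (LinfWeak μ Test) :=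
  Function.Surjective.moduleLeft (Linf.proj (complSigma μ) (ae μ)) Linf.proj_surjective
    LinfWeak.proj_smul

/-- The pointwise norm
`|w| = ess sup {⟨w, v⟩ : v ∈ combinations μ Test, ‖v(·)‖ ≤ 1}`. -/
def weakNorm (q : LinfWeak μ Test) : LinfMu μ :=
  Linf.esssup {g | ∃ w : weakSections μ Test, LinfWeak.mk w = q ∧
    ∃ v ∈ combinations μ Test, (∀ y, ‖v y‖ ≤ 1) ∧
      (g : Germ (ae μ) ℝ) = ((fun y => w.1 y (v y) : Y → ℝ) : Germ (ae μ) ℝ)}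

end WeakBundle

end LinftyModule

end

open LinftyModule

/-!
The test vectors `τ y v = (T v)_{φ(y)}` depend linearly on `v`, and the compatibility of the two
liftings with `φ` turns `|T v| = ℓX(|v|)` and `|P v| = |v| ∘ φ` into the identity
`‖τ y v‖ = ℓY(|P v|)(y)`, valid at *every* point `y` (`Lifting.funLift_comp`, `norm_valueAt`). The
theorem depends on the fibres only through this identity, and `exists_linfWeak_equiv_dual` proves it
for any family of linear maps `τ y : M → V y` which satisfies it.

From sections to the dual. Testing `ω` with the combinations `± (‖τ v‖ + ε)⁻¹ τ v` gives
`|⟨ω, τ v⟩| ≤ C ‖τ v‖ = C |P v|` off a null set (`abs_apply_test_le`). Such a linear family of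
functions extends uniquely to an `L^∞`-linear map on the module generated by the `P v`
(`Dual.exists_extension`, `Dual.ext_of_generates`).

From the dual to sections. For `L` in the dual, the form `v ↦ ℓY(L(P v))(y)` is linear and bounded
by `C ‖τ y v‖` at every point `y`, because the lifting of functions is linear and monotone. Hence it
factors through `τ y` and extends to the fibre by the Hahn-Banach theorem
(`Dual.exists_represents`).

Norms. Both pointwise norms are essential suprema, and an element of `L^∞` bounds one family if and
only if it bounds the other (`Represents.apply_le`, `Represents.abs_fn_le`). The dual of a normed
module is itself a normed module (`Dual.isNormedModule`): the essential supremum exists by order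
completeness (`Linf.exists_isLUB`) and is the smallest `G ≥ 0` with `|L v| ≤ G |v|`. The
isomorphism carries this structure over to `L^∞_weak`.
-/

noncomputable section

namespace LinftyModule

/-! ### Representatives of elements of `L^∞(μ)` -/

section Representatives

variable {Y : Type*} [MeasurableSpace Y] {μ : Measure Y}

/-- A bounded representative of an element of `L^∞(μ)`, as a function. -/
def Linf.fn (g : LinfMu μ) : Y → ℝ := (Linf.rep g).1

theorem Linf.coe_fn (g : LinfMu μ) : ((Linf.fn g : Y → ℝ) : Germ (ae μ) ℝ) = g :=
  congrArg Subtype.val (Linf.proj_rep g)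

theorem Linf.aemeasurable_fn (g : LinfMu μ) : AEMeasurable (Linf.fn g) μ :=
  NullMeasurable.aemeasurable (Linf.rep g).2.1

theorem Linf.coe_eq_iff (g : LinfMu μ) (f : Y → ℝ) :
    (g : Germ (ae μ) ℝ) = (f : Germ (ae μ) ℝ) ↔ ∀ᵐ y ∂μ, Linf.fn g y = f y := by
  rw [← Linf.coe_fn g]
  exact Germ.coe_eq

theorem Linf.fn_proj (f : boundedMeasurable (complSigma μ)) :
    ∀ᵐ y ∂μ, Linf.fn (Linf.proj _ (ae μ) f) y = f.1 y :=
  (Linf.coe_eq_iff _ _).1 rfl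

theorem Linf.eq_iff {g h : LinfMu μ} : g = h ↔ ∀ᵐ y ∂μ, Linf.fn g y = Linf.fn h y := by
  rw [← Linf.coe_eq_iff, Linf.coe_fn, Subtype.ext_iff]

theorem Linf.le_iff {g h : LinfMu μ} : g ≤ h ↔ ∀ᵐ y ∂μ, Linf.fn g y ≤ Linf.fn h y := by
  rw [← Subtype.coe_le_coe, ← Linf.coe_fn g, ← Linf.coe_fn h]
  exact Iff.rfl

theorem Linf.fn_add (g h : LinfMu μ) :
    ∀ᵐ y ∂μ, Linf.fn (g + h) y = Linf.fn g y + Linf.fn h y := by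
  refine (Linf.coe_eq_iff _ (Linf.fn g + Linf.fn h)).1 ?_
  rw [Germ.coe_add, Linf.coe_fn, Linf.coe_fn]
  rfl

theorem Linf.fn_mul (g h : LinfMu μ) :
    ∀ᵐ y ∂μ, Linf.fn (g * h) y = Linf.fn g y * Linf.fn h y := by
  refine (Linf.coe_eq_iff _ (Linf.fn g * Linf.fn h)).1 ?_
  rw [Germ.coe_mul, Linf.coe_fn, Linf.coe_fn]
  rfl

theorem Linf.fn_sub (g h : LinfMu μ) :
    ∀ᵐ y ∂μ, Linf.fn (g - h) y = Linf.fn g y - Linf.fn h y := by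
  refine (Linf.coe_eq_iff _ (Linf.fn g - Linf.fn h)).1 ?_
  rw [Germ.coe_sub, Linf.coe_fn, Linf.coe_fn]
  rfl

theorem Linf.fn_zero : ∀ᵐ y ∂μ, Linf.fn (0 : LinfMu μ) y = 0 :=
  (Linf.coe_eq_iff _ (0 : Y → ℝ)).1 rfl

theorem Linf.fn_ind {E : Set Y} (hE : MeasurableSet[complSigma μ] E) :
    ∀ᵐ y ∂μ, Linf.fn (Linf.ind (ae μ) E hE) y = E.indicator 1 y :=
  Linf.fn_proj _

theorem Linf.fn_algebraMap (c : ℝ) : ∀ᵐ y ∂μ, Linf.fn (algebraMap ℝ (LinfMu μ) c) y = c :=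
  (Linf.coe_eq_iff _ (fun _ => c)).1 rfl

theorem Linf.fn_smul (c : ℝ) (g : LinfMu μ) : ∀ᵐ y ∂μ, Linf.fn (c • g) y = c * Linf.fn g y := by
  rw [Algebra.smul_def]
  filter_upwards [Linf.fn_mul (algebraMap ℝ (LinfMu μ) c) g, Linf.fn_algebraMap (μ := μ) c]
    with y h1 h2
  rw [h1, h2]

theorem Linf.abs_le_const_iff (g : LinfMu μ) (C : ℝ) :
    |(g : Germ (ae μ) ℝ)| ≤ ((fun _ => C : Y → ℝ) : Germ (ae μ) ℝ) ↔
      ∀ᵐ y ∂μ, |Linf.fn g y| ≤ C := by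
  rw [← Linf.coe_fn g]
  exact Iff.rfl

theorem Linf.coe_eq_abs_iff (g h : LinfMu μ) :
    (g : Germ (ae μ) ℝ) = |(h : Germ (ae μ) ℝ)| ↔ ∀ᵐ y ∂μ, Linf.fn g y = |Linf.fn h y| := by
  rw [← Linf.coe_eq_iff g (fun y => |Linf.fn h y|), ← Linf.coe_fn h]
  exact Iff.rfl

theorem Linf.abs_fn_le_nrm (g : LinfMu μ) : ∀ᵐ y ∂μ, |Linf.fn g y| ≤ Linf.nrm g := by
  have h : ∀ n : ℕ, ∀ᵐ y ∂μ, |Linf.fn g y| ≤ Linf.nrm g + 1 / ((n : ℝ) + 1) := by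
    intro n
    obtain ⟨C, -, hC, hb⟩ := Linf.exists_bound g (show (0 : ℝ) < 1 / ((n : ℝ) + 1) by positivity)
    filter_upwards [(Linf.abs_le_const_iff g C).1 hb] with y hy
    linarith
  filter_upwards [ae_all_iff.2 h] with y hy
  refine le_of_forall_pos_le_add fun ε hε => ?_
  obtain ⟨n, hn⟩ := exists_nat_one_div_lt hε
  linarith [hy n]

theorem Linf.nrm_le_iff (g : LinfMu μ) {C : ℝ} (hC : 0 ≤ C) :
    Linf.nrm g ≤ C ↔ ∀ᵐ y ∂μ, |Linf.fn g y| ≤ C := by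
  constructor
  · intro h
    filter_upwards [Linf.abs_fn_le_nrm g] with y hy
    exact hy.trans h
  · intro h
    exact Linf.nrm_le _ hC ((Linf.abs_le_const_iff g C).2 h)

theorem Linf.exists_fn_eq {f : Y → ℝ} (hf : AEMeasurable f μ) {C : ℝ}
    (hC : ∀ᵐ y ∂μ, |f y| ≤ C) : ∃ g : LinfMu μ, ∀ᵐ y ∂μ, Linf.fn g y = f y := by
  have hm : (fun y => max (-|C|) (min |C| (hf.mk f y))) ∈ boundedMeasurable (complSigma μ) := by
    refine ⟨(measurable_const.max (measurable_const.min hf.measurable_mk)).nullMeasurable,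
      |C|, fun y => abs_le.2 ⟨le_max_left _ _, max_le ?_ (min_le_left _ _)⟩⟩
    linarith [abs_nonneg C]
  refine ⟨Linf.proj _ _ ⟨_, hm⟩, ?_⟩
  filter_upwards [Linf.fn_proj ⟨_, hm⟩, hf.ae_eq_mk, hC] with y h1 h2 h3
  have h4 := abs_le.1 (h3.trans (le_abs_self C))
  rw [h1]
  change max (-|C|) (min |C| (hf.mk f y)) = f y
  rw [← h2, min_eq_right h4.2, max_eq_right h4.1]

theorem aemeasurable_glue {k : Y → ℕ} (hk : AEMeasurable k μ) {g : ℕ → Y → ℝ}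
    (hg : ∀ n, AEMeasurable (g n) μ) : AEMeasurable (fun y => g (k y) y) μ := by
  have h1 : Measurable fun x : ℕ × Y => (hg x.1).mk (g x.1) x.2 :=
    measurable_from_prod_countable_right fun n => (hg n).measurable_mk
  refine ⟨fun y => (hg (hk.mk k y)).mk (g (hk.mk k y)) y,
    h1.comp (hk.measurable_mk.prodMk measurable_id), ?_⟩
  filter_upwards [hk.ae_eq_mk, ae_all_iff.2 fun n => (hg n).ae_eq_mk] with y h2 h3
  rw [← h2, h3]

end Representatives

/-! ### Order completeness of `L^∞(μ)` -/

section EssSup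

variable {Y : Type*} [MeasurableSpace Y] {μ : Measure Y}

theorem Linf.isLUB_esssup {S : Set (LinfMu μ)} (h : ∃ g, IsLUB S g) :
    IsLUB S (Linf.esssup S) := by
  classical
  unfold Linf.esssup
  rw [dif_pos h]
  exact h.choose_spec

/-- The essential supremum depends on the family only through its upper bounds. -/
theorem Linf.esssup_congr {S S' : Set (LinfMu μ)} (h : upperBounds S = upperBounds S') :
    Linf.esssup S = Linf.esssup S' := by
  have : IsLUB S = IsLUB S' := funext fun g => by rw [IsLUB, IsLUB, h]
  unfold Linf.esssup
  rw [this]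

/-- `L^∞` of a σ-finite measure is order complete; here for nonnegative families. For a finite measure `ν` equivalent to `μ`, a
sequence in the family whose pointwise supremum has the largest `ν`-integral attains the essential
supremum. -/
theorem Linf.exists_isLUB [SigmaFinite μ] {S : Set (LinfMu μ)} (hne : S.Nonempty)
    (h0 : ∀ s ∈ S, 0 ≤ s) (C : ℝ) (hC : ∀ s ∈ S, ∀ᵐ y ∂μ, Linf.fn s y ≤ C) :
    ∃ g, IsLUB S g := by
  set ν : Measure Y := μ.toFinite with hν
  have hae : ae ν = ae μ := ae_toFinite
  have hpos : ∀ s ∈ S, ∀ᵐ y ∂μ, 0 ≤ Linf.fn s y := by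
    intro s hs
    filter_upwards [Linf.le_iff.1 (h0 s hs), Linf.fn_zero (μ := μ)] with y h1 h2
    rwa [h2] at h1
  have : Nonempty S := hne.to_subtype
  let H : (ℕ → S) → Y → ENNReal := fun u y => ⨆ n, ENNReal.ofReal (Linf.fn (u n).1 y)
  have hmeas : ∀ s : LinfMu μ, AEMeasurable (fun y => ENNReal.ofReal (Linf.fn s y)) μ := fun s =>
    (Linf.aemeasurable_fn s).ennreal_ofReal
  have hH : ∀ u, AEMeasurable (H u) μ := fun u => AEMeasurable.iSup fun n => hmeas _
  have hHν : ∀ u, AEMeasurable (H u) ν := fun u => (hH u).mono_ac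
    (Measure.ae_le_iff_absolutelyContinuous.1 hae.le)
  have hHC : ∀ u, ∀ᵐ y ∂μ, H u y ≤ ENNReal.ofReal C := by
    intro u
    filter_upwards [ae_all_iff.2 fun n => hC _ (u n).2] with y hy
    exact iSup_le fun n => ENNReal.ofReal_le_ofReal (hy n)
  let Φ : (ℕ → S) → ENNReal := fun u => ∫⁻ y, H u y ∂ν
  have hΦC : ∀ u, Φ u ≠ ⊤ := by
    intro u
    have : Φ u ≤ ∫⁻ _, ENNReal.ofReal C ∂ν := lintegral_mono_ae (by rw [hae]; exact hHC u)
    refine ne_top_of_le_ne_top ?_ this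
    rw [lintegral_const]
    exact ENNReal.mul_ne_top ENNReal.ofReal_ne_top (measure_ne_top _ _)
  obtain ⟨t, -, ht, htr⟩ := exists_seq_tendsto_sSup (S := Set.range Φ) (Set.range_nonempty Φ)
    (OrderTop.bddAbove _)
  choose u hu using htr
  -- A single sequence containing a maximising sequence of sequences.
  let w : ℕ → S := fun n => u n.unpair.1 n.unpair.2
  have hw : ∀ v, Φ v ≤ Φ w := by
    intro v
    refine (le_sSup (Set.mem_range_self v)).trans (le_of_tendsto' ht fun j => ?_)
    rw [← hu]
    refine lintegral_mono fun y => iSup_le fun n => ?_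
    refine le_iSup_of_le (Nat.pair j n) ?_
    simp only [w, Nat.unpair_pair]
    exact le_rfl
  -- Prepending `s` to `w` cannot increase the integral, so `s` is already below the supremum.
  have hub : ∀ s ∈ S, ∀ᵐ y ∂μ, ENNReal.ofReal (Linf.fn s y) ≤ H w y := by
    intro s hs
    let w' : ℕ → S := fun n => Nat.casesOn n ⟨s, hs⟩ w
    have hle : H w ≤ H w' := fun y => iSup_le fun n => le_iSup_of_le (n + 1) le_rfl
    have h1 := ae_eq_of_ae_le_of_lintegral_le (Eventually.of_forall hle) (hΦC w) (hHν w') (hw w')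
    rw [hae] at h1
    filter_upwards [h1] with y hy
    rw [hy]
    exact le_iSup_of_le 0 le_rfl
  have hC0 : ∀ᵐ y ∂μ, |(H w y).toReal| ≤ |C| := by
    filter_upwards [hHC w] with y hy
    rw [abs_of_nonneg ENNReal.toReal_nonneg]
    refine ENNReal.toReal_le_of_le_ofReal (abs_nonneg C) (hy.trans ?_)
    exact ENNReal.ofReal_le_ofReal (le_abs_self C)
  obtain ⟨g, hg⟩ := Linf.exists_fn_eq (hH w).ennreal_toReal hC0
  refine ⟨g, fun s hs => Linf.le_iff.2 ?_, fun b hb => Linf.le_iff.2 ?_⟩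
  · filter_upwards [hg, hub s hs, hHC w, hpos s hs] with y h1 h2 h3 h4
    rw [h1, ← ENNReal.toReal_ofReal h4]
    exact ENNReal.toReal_mono (ne_top_of_le_ne_top ENNReal.ofReal_ne_top h3) h2
  · have h5 : ∀ n, ∀ᵐ y ∂μ, Linf.fn (w n).1 y ≤ Linf.fn b y := fun n =>
      Linf.le_iff.1 (hb (w n).2)
    filter_upwards [hg, ae_all_iff.2 h5, hpos _ (w 0).2] with y h1 h2 h3
    rw [h1]
    refine ENNReal.toReal_le_of_le_ofReal (h3.trans (h2 0)) ?_
    exact iSup_le fun n => ENNReal.ofReal_le_ofReal (h2 n)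

end EssSup

/-! ### Normed modules over `L^∞(μ)`, off null sets -/

section ModuleAE

variable {Y : Type*} [MeasurableSpace Y] {μ : Measure Y}
  {N : Type*} [AddCommGroup N] [Module (LinfMu μ) N] {pn : N → LinfMu μ}

namespace IsNormedModule

theorem fn_nonneg (h : IsNormedModule pn) (v : N) : ∀ᵐ y ∂μ, 0 ≤ Linf.fn (pn v) y := by
  filter_upwards [Linf.le_iff.1 (h.nonneg v), Linf.fn_zero (μ := μ)] with y h1 h2
  rwa [h2] at h1

theorem eq_zero_of_fn (h : IsNormedModule pn) {v : N} (hv : ∀ᵐ y ∂μ, Linf.fn (pn v) y = 0) :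
    v = 0 := by
  refine (h.eq_zero_iff v).1 (Linf.eq_iff.2 ?_)
  filter_upwards [hv, Linf.fn_zero (μ := μ)] with y h1 h2
  rw [h1, h2]

theorem fn_map_zero (h : IsNormedModule pn) : ∀ᵐ y ∂μ, Linf.fn (pn 0) y = 0 := by
  rw [(h.eq_zero_iff 0).2 rfl]
  exact Linf.fn_zero

theorem fn_add_le (h : IsNormedModule pn) (v w : N) :
    ∀ᵐ y ∂μ, Linf.fn (pn (v + w)) y ≤ Linf.fn (pn v) y + Linf.fn (pn w) y := by
  filter_upwards [Linf.le_iff.1 (h.add_le v w), Linf.fn_add (pn v) (pn w)] with y h1 h2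
  rwa [h2] at h1

theorem fn_smul (h : IsNormedModule pn) (f : LinfMu μ) (v : N) :
    ∀ᵐ y ∂μ, Linf.fn (pn (f • v)) y = |Linf.fn f y| * Linf.fn (pn v) y := by
  refine (Linf.coe_eq_iff _ fun y => |Linf.fn f y| * Linf.fn (pn v) y).1 ((h.smul_eq f v).trans ?_)
  rw [← Linf.coe_fn f, ← Linf.coe_fn (pn v)]
  rfl

theorem fn_neg (h : IsNormedModule pn) (v : N) :
    ∀ᵐ y ∂μ, Linf.fn (pn (-v)) y = Linf.fn (pn v) y := by
  have h1 := h.fn_smul (algebraMap ℝ (LinfMu μ) (-1)) v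
  rw [map_neg, map_one, neg_one_smul] at h1
  have h2 := Linf.fn_algebraMap (μ := μ) (-1)
  rw [map_neg, map_one] at h2
  filter_upwards [h1, h2] with y h3 h4
  rw [h3, h4, abs_neg, abs_one, one_mul]

theorem fn_sub_le (h : IsNormedModule pn) (v w : N) :
    ∀ᵐ y ∂μ, Linf.fn (pn (v - w)) y ≤ Linf.fn (pn v) y + Linf.fn (pn w) y := by
  rw [sub_eq_add_neg]
  filter_upwards [h.fn_add_le v (-w), h.fn_neg w] with y h1 h2
  rwa [h2] at h1

theorem fn_sub_comm (h : IsNormedModule pn) (v w : N) :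
    ∀ᵐ y ∂μ, Linf.fn (pn (v - w)) y = Linf.fn (pn (w - v)) y := by
  rw [← neg_sub]
  exact h.fn_neg _

theorem fn_sub_le_sub_add_sub (h : IsNormedModule pn) (u v w : N) :
    ∀ᵐ y ∂μ, Linf.fn (pn (u - w)) y ≤ Linf.fn (pn (u - v)) y + Linf.fn (pn (v - w)) y := by
  rw [← sub_add_sub_cancel u v w]
  exact h.fn_add_le _ _

theorem ind_smul_eq_iff (h : IsNormedModule pn) {E : Set Y} (hE : MeasurableSet[complSigma μ] E)
    (v w : N) : Linf.ind (ae μ) E hE • v = Linf.ind (ae μ) E hE • w ↔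
      ∀ᵐ y ∂μ, y ∈ E → Linf.fn (pn (v - w)) y = 0 := by
  rw [← sub_eq_zero, ← smul_sub]
  constructor
  · intro h0
    have h1 := h.fn_smul (Linf.ind (ae μ) E hE) (v - w)
    rw [h0] at h1
    filter_upwards [h1, Linf.fn_ind hE, h.fn_map_zero] with y h2 h3 h4 hy
    rw [h3, h4, Set.indicator_of_mem hy, Pi.one_apply, abs_one, one_mul] at h2
    exact h2.symm
  · intro h0
    refine h.eq_zero_of_fn ?_
    filter_upwards [h.fn_smul (Linf.ind (ae μ) E hE) (v - w), Linf.fn_ind hE, h0] with y h1 h2 h3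
    rw [h1, h2]
    by_cases hy : y ∈ E
    · rw [h3 hy, mul_zero]
    · rw [Set.indicator_of_notMem hy, abs_zero, zero_mul]

/-- Every element can be approximated, uniformly off a null set, by countably valued sections of a
generating set. -/
theorem exists_approx (h : IsNormedModule pn) {V : Set N} (hV : Generates pn V) (w : N) {ε : ℝ}
    (hε : 0 < ε) : ∃ (k : Y → ℕ) (v : ℕ → N), AEMeasurable k μ ∧ (∀ n, v n ∈ V) ∧
      ∀ᵐ y ∂μ, Linf.fn (pn (w - v (k y))) y ≤ ε := by
  obtain ⟨u, hu, E, hE, v, hv, -, huv⟩ := hV w ε hε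
  obtain ⟨k, hk, hEk⟩ := PtSeminorm.exists_index hE
  have hk' : NullMeasurable k μ := hk
  refine ⟨k, v, hk'.aemeasurable, hv, ?_⟩
  have h1 : ∀ n, ∀ᵐ y ∂μ, y ∈ E n → Linf.fn (pn (u - v n)) y = 0 := fun n =>
    (h.ind_smul_eq_iff (hE.measurable n) u (v n)).1 (huv n)
  filter_upwards [ae_all_iff.2 h1, ae_all_iff.2 fun n => h.fn_sub_le_sub_add_sub w u (v n),
    Linf.abs_fn_le_nrm (pn (w - u))] with y h2 h3 h4
  have h5 := h2 (k y) ((hEk _ _).2 rfl)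
  linarith [h3 (k y), le_abs_self (Linf.fn (pn (w - u)) y)]

/-- The normed module axioms pass to a module which is linearly isomorphic, with the same pointwise
norm. -/
theorem of_equiv {N' : Type*} [AddCommGroup N'] [Module (LinfMu μ) N'] {pn' : N' → LinfMu μ}
    (h : IsNormedModule pn) (e : N' ≃ₗ[LinfMu μ] N) (he : ∀ q, pn (e q) = pn' q) :
    IsNormedModule pn' where
  nonneg v := he v ▸ h.nonneg (e v)
  eq_zero_iff v := by rw [← he, h.eq_zero_iff, LinearEquiv.map_eq_zero_iff]
  add_le v w := by
    rw [← he, ← he, ← he, map_add]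
    exact h.add_le _ _
  smul_eq f v := by
    rw [← he, ← he, map_smul]
    exact h.smul_eq _ _
  glueing E hE v hv := by
    obtain ⟨w, hw⟩ := h.glueing E hE (fun n => e (v n)) (by simpa only [he] using hv)
    refine ⟨e.symm w, fun n => e.injective ?_⟩
    rw [map_smul, map_smul, e.apply_symm_apply, hw]
  complete u hu := by
    obtain ⟨w, hw⟩ := h.complete (fun n => e (u n)) (by simpa only [← map_sub, he] using hu)
    refine ⟨e.symm w, ?_⟩
    simpa only [← he, map_sub, e.apply_symm_apply] using hw

end IsNormedModule

end ModuleAE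

/-! ### The dual of a normed module -/

section DualAE

variable {Y : Type*} [MeasurableSpace Y] {μ : Measure Y}
  {N : Type*} [AddCommGroup N] [Module (LinfMu μ) N] {pn : N → LinfMu μ}

/-- A family of functions which depends `L^∞`-linearly on the vector off null sets, with a uniform
bound, defines an element of the dual. -/
theorem Dual.exists_of_ae (h : IsNormedModule pn) (G : N → Y → ℝ) (C : ℝ)
    (hG : ∀ v, AEMeasurable (G v) μ)
    (hadd : ∀ v w, ∀ᵐ y ∂μ, G (v + w) y = G v y + G w y)
    (hsmul : ∀ (f : LinfMu μ) v, ∀ᵐ y ∂μ, G (f • v) y = Linf.fn f y * G v y)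
    (hC : ∀ v, ∀ᵐ y ∂μ, |G v y| ≤ C * Linf.fn (pn v) y) :
    ∃ L : Dual pn, ∀ v, ∀ᵐ y ∂μ, Linf.fn (L.1 v) y = G v y := by
  have hb : ∀ v, ∀ᵐ y ∂μ, |G v y| ≤ |C| * Linf.nrm (pn v) := by
    intro v
    filter_upwards [hC v, Linf.abs_fn_le_nrm (pn v), h.fn_nonneg v] with y h1 h2 h3
    rw [abs_of_nonneg h3] at h2
    exact h1.trans (mul_le_mul (le_abs_self C) h2 h3 (abs_nonneg C))
  choose l hl using fun v => Linf.exists_fn_eq (hG v) (hb v)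
  refine ⟨⟨⟨⟨l, fun v w => Linf.eq_iff.2 ?_⟩, fun f v => Linf.eq_iff.2 ?_⟩, |C|, fun v => ?_⟩,
    hl⟩
  · filter_upwards [hl v, hl w, hl (v + w), hadd v w, Linf.fn_add (l v) (l w)] with y h1 h2 h3 h4 h5
    rw [h3, h4, h5, h1, h2]
  · filter_upwards [hl v, hl (f • v), hsmul f v, Linf.fn_mul f (l v)] with y h1 h2 h3 h4
    change Linf.fn (l (f • v)) y = Linf.fn (f * l v) y
    rw [h2, h3, h4, h1]
  · refine (Linf.nrm_le_iff _ (mul_nonneg (abs_nonneg _) (Linf.nrm_nonneg _))).2 ?_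
    filter_upwards [hb v, hl v] with y h1 h2
    change |Linf.fn (l v) y| ≤ _
    rwa [h2]

theorem Dual.fn_smul (L : Dual pn) (f : LinfMu μ) (v : N) :
    ∀ᵐ y ∂μ, Linf.fn (L.1 (f • v)) y = Linf.fn f y * Linf.fn (L.1 v) y := by
  rw [map_smul]
  exact Linf.fn_mul f (L.1 v)

theorem Dual.fn_add (L : Dual pn) (v w : N) :
    ∀ᵐ y ∂μ, Linf.fn (L.1 (v + w)) y = Linf.fn (L.1 v) y + Linf.fn (L.1 w) y := by
  rw [map_add]
  exact Linf.fn_add _ _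

/-- A bound for `L` on the unit ball is a bound for `|L v| / |v|`: apply it to
`(|v| + ε)⁻¹ v` and let `ε` tend to `0`. -/
theorem Dual.abs_fn_le_of_unit (h : IsNormedModule pn) (L : Dual pn) {G : Y → ℝ}
    (hG : ∀ v, Linf.nrm (pn v) ≤ 1 → ∀ᵐ y ∂μ, |Linf.fn (L.1 v) y| ≤ G y) (v : N) :
    ∀ᵐ y ∂μ, |Linf.fn (L.1 v) y| ≤ G y * Linf.fn (pn v) y := by
  have key : ∀ n : ℕ, ∀ᵐ y ∂μ,
      |Linf.fn (L.1 v) y| ≤ G y * (Linf.fn (pn v) y + 1 / ((n : ℝ) + 1)) := by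
    intro n
    have hε : (0 : ℝ) < 1 / ((n : ℝ) + 1) := by positivity
    set ε : ℝ := 1 / ((n : ℝ) + 1)
    have hb : ∀ᵐ y ∂μ, |(Linf.fn (pn v) y + ε)⁻¹| ≤ ε⁻¹ := by
      filter_upwards [h.fn_nonneg v] with y h1
      rw [abs_of_nonneg (by positivity)]
      exact inv_anti₀ hε (by linarith)
    obtain ⟨f, hf⟩ := Linf.exists_fn_eq ((Linf.aemeasurable_fn (pn v)).add_const ε).inv hb
    have hball : Linf.nrm (pn (f • v)) ≤ 1 := by
      refine (Linf.nrm_le_iff _ zero_le_one).2 ?_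
      filter_upwards [h.fn_smul f v, hf, h.fn_nonneg v] with y h1 h2 h3
      have h4 : 0 < Linf.fn (pn v) y + ε := by linarith
      rw [h1, h2, Pi.inv_apply, abs_of_pos (inv_pos.2 h4), abs_of_nonneg (by positivity),
        inv_mul_le_iff₀ h4]
      linarith
    filter_upwards [hG _ hball, Dual.fn_smul L f v, hf, h.fn_nonneg v] with y h1 h2 h3 h5
    have h4 : 0 < Linf.fn (pn v) y + ε := by linarith
    rw [h2, h3, Pi.inv_apply, abs_mul, abs_of_pos (inv_pos.2 h4), inv_mul_le_iff₀ h4] at h1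
    linarith
  filter_upwards [ae_all_iff.2 key] with y hy
  have ht : Tendsto (fun n : ℕ => G y * (Linf.fn (pn v) y + 1 / ((n : ℝ) + 1))) atTop
      (𝓝 (G y * (Linf.fn (pn v) y + 0))) :=
    (tendsto_const_nhds.add tendsto_one_div_add_atTop_nhds_zero_nat).const_mul _
  rw [add_zero] at ht
  exact ge_of_tendsto' ht hy

theorem Dual.exists_bound (h : IsNormedModule pn) (L : Dual pn) :
    ∃ C : ℝ, 0 ≤ C ∧ ∀ v, ∀ᵐ y ∂μ, |Linf.fn (L.1 v) y| ≤ C * Linf.fn (pn v) y := by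
  obtain ⟨C, hC⟩ := L.2
  refine ⟨|C|, abs_nonneg C, Dual.abs_fn_le_of_unit h L (G := fun _ => |C|) fun v hv => ?_⟩
  filter_upwards [Linf.abs_fn_le_nrm (L.1 v)] with y hy
  refine hy.trans ((hC v).trans ?_)
  calc C * Linf.nrm (pn v) ≤ |C| * 1 :=
        mul_le_mul (le_abs_self C) hv (Linf.nrm_nonneg _) (abs_nonneg C)
    _ = |C| := mul_one _

/-- The family whose essential supremum is the pointwise norm of `L`. -/
def Dual.unitValues (L : Dual pn) : Set (LinfMu μ) :=
  {g | ∃ v : N, Linf.nrm (pn v) ≤ 1 ∧ (g : Germ (ae μ) ℝ) = |(L.1 v : Germ (ae μ) ℝ)|}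

theorem Dual.mem_upperBounds_iff (L : Dual pn) (g : LinfMu μ) :
    g ∈ upperBounds (Dual.unitValues L) ↔
      ∀ v, Linf.nrm (pn v) ≤ 1 → ∀ᵐ y ∂μ, |Linf.fn (L.1 v) y| ≤ Linf.fn g y := by
  constructor
  · intro hg v hv
    obtain ⟨s, hs⟩ := Linf.exists_fn_eq (f := fun y => |Linf.fn (L.1 v) y|)
      (C := Linf.nrm (L.1 v)) (continuous_abs.measurable.comp_aemeasurable (Linf.aemeasurable_fn _))
      (by simpa only [abs_abs] using Linf.abs_fn_le_nrm (L.1 v))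
    filter_upwards [hs, Linf.le_iff.1 (hg ⟨v, hv, (Linf.coe_eq_abs_iff _ _).2 hs⟩)] with y h1 h2
    rwa [h1] at h2
  · rintro hg s ⟨v, hv, hs⟩
    refine Linf.le_iff.2 ?_
    filter_upwards [hg v hv, (Linf.coe_eq_abs_iff _ _).1 hs] with y h1 h2
    rwa [h2]

theorem Dual.isLUB_dualNorm [SigmaFinite μ] (h : IsNormedModule pn) (L : Dual pn) :
    IsLUB (Dual.unitValues L) (dualNorm pn L) := by
  obtain ⟨C, hC0, hC⟩ := Dual.exists_bound h L
  have hnn : ∀ s ∈ Dual.unitValues L, 0 ≤ s := by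
    rintro s ⟨v, -, hs⟩
    refine Linf.le_iff.2 ?_
    filter_upwards [(Linf.coe_eq_abs_iff _ _).1 hs, Linf.fn_zero (μ := μ)] with y h1 h2
    rw [h1, h2]
    exact abs_nonneg _
  refine Linf.isLUB_esssup (Linf.exists_isLUB ⟨0, 0, ?_, ?_⟩ hnn C ?_)
  · rw [(h.eq_zero_iff 0).2 rfl, Linf.nrm_zero]
    exact zero_le_one
  · rw [map_zero, Linf.coe_eq_abs_iff]
    filter_upwards [Linf.fn_zero (μ := μ)] with y hy
    rw [hy, abs_zero]
  · rintro s ⟨v, hv, hs⟩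
    filter_upwards [(Linf.coe_eq_abs_iff _ _).1 hs, hC v,
      (Linf.nrm_le_iff _ zero_le_one).1 hv] with y h1 h2 h3
    rw [h1]
    exact h2.trans (mul_le_of_le_one_right hC0 ((le_abs_self _).trans h3))

theorem Dual.dualNorm_nonneg [SigmaFinite μ] (h : IsNormedModule pn) (L : Dual pn) :
    ∀ᵐ y ∂μ, 0 ≤ Linf.fn (dualNorm pn L) y := by
  filter_upwards [(Dual.mem_upperBounds_iff L _).1 (Dual.isLUB_dualNorm h L).1 0 (by
    rw [(h.eq_zero_iff 0).2 rfl, Linf.nrm_zero]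
    exact zero_le_one)] with y hy
  exact (abs_nonneg _).trans hy

theorem Dual.abs_fn_le_dualNorm [SigmaFinite μ] (h : IsNormedModule pn) (L : Dual pn) (v : N) :
    ∀ᵐ y ∂μ, |Linf.fn (L.1 v) y| ≤ Linf.fn (dualNorm pn L) y * Linf.fn (pn v) y :=
  Dual.abs_fn_le_of_unit h L
    ((Dual.mem_upperBounds_iff L _).1 (Dual.isLUB_dualNorm h L).1) v

/-- The pointwise norm of `L` is the smallest `G ≥ 0` with `|L v| ≤ G |v|`. -/
theorem Dual.dualNorm_le [SigmaFinite μ] (h : IsNormedModule pn) (L : Dual pn) {G : Y → ℝ}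
    (hm : AEMeasurable G μ) {C : ℝ} (hC : ∀ᵐ y ∂μ, |G y| ≤ C) (h0 : ∀ᵐ y ∂μ, 0 ≤ G y)
    (hG : ∀ v, ∀ᵐ y ∂μ, |Linf.fn (L.1 v) y| ≤ G y * Linf.fn (pn v) y) :
    ∀ᵐ y ∂μ, Linf.fn (dualNorm pn L) y ≤ G y := by
  obtain ⟨g, hg⟩ := Linf.exists_fn_eq hm hC
  have hub : g ∈ upperBounds (Dual.unitValues L) := by
    rw [Dual.mem_upperBounds_iff]
    intro v hv
    filter_upwards [hg, h0, hG v, (Linf.nrm_le_iff _ zero_le_one).1 hv] with y h1 h2 h3 h4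
    rw [h1]
    exact h3.trans (mul_le_of_le_one_right h2 ((le_abs_self _).trans h4))
  filter_upwards [hg, Linf.le_iff.1 ((Dual.isLUB_dualNorm h L).2 hub)] with y h1 h2
  rwa [h1] at h2

theorem Dual.fn_coe_add (L L' : Dual pn) (v : N) :
    ∀ᵐ y ∂μ, Linf.fn ((L + L').1 v) y = Linf.fn (L.1 v) y + Linf.fn (L'.1 v) y :=
  Linf.fn_add (L.1 v) (L'.1 v)

theorem Dual.fn_coe_sub (L L' : Dual pn) (v : N) :
    ∀ᵐ y ∂μ, Linf.fn ((L - L').1 v) y = Linf.fn (L.1 v) y - Linf.fn (L'.1 v) y :=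
  Linf.fn_sub (L.1 v) (L'.1 v)

theorem Dual.fn_coe_smul (f : LinfMu μ) (L : Dual pn) (v : N) :
    ∀ᵐ y ∂μ, Linf.fn ((f • L).1 v) y = Linf.fn f y * Linf.fn (L.1 v) y :=
  Linf.fn_mul f (L.1 v)

theorem Dual.ext_fn {L L' : Dual pn} (h : ∀ v, ∀ᵐ y ∂μ, Linf.fn (L.1 v) y = Linf.fn (L'.1 v) y) :
    L = L' :=
  Subtype.ext (LinearMap.ext fun v => Linf.eq_iff.2 (h v))

theorem Dual.dualNorm_smul [SigmaFinite μ] (h : IsNormedModule pn) (f : LinfMu μ) (L : Dual pn) :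
    ∀ᵐ y ∂μ, Linf.fn (dualNorm pn (f • L)) y = |Linf.fn f y| * Linf.fn (dualNorm pn L) y := by
  have hfm : AEMeasurable (fun y => |Linf.fn f y|) μ :=
    continuous_abs.measurable.comp_aemeasurable (Linf.aemeasurable_fn f)
  have hle : ∀ᵐ y ∂μ,
      Linf.fn (dualNorm pn (f • L)) y ≤ |Linf.fn f y| * Linf.fn (dualNorm pn L) y := by
    refine Dual.dualNorm_le h _ (hfm.mul (Linf.aemeasurable_fn _))
      (C := Linf.nrm f * Linf.nrm (dualNorm pn L)) ?_ ?_ fun v => ?_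
    · filter_upwards [Linf.abs_fn_le_nrm f, Linf.abs_fn_le_nrm (dualNorm pn L)] with y h1 h2
      rw [abs_mul, abs_abs]
      exact mul_le_mul h1 h2 (abs_nonneg _) (Linf.nrm_nonneg _)
    · filter_upwards [Dual.dualNorm_nonneg h L] with y h1
      exact mul_nonneg (abs_nonneg _) h1
    · filter_upwards [Dual.fn_coe_smul f L v, Dual.abs_fn_le_dualNorm h L v] with y h1 h2
      rw [h1, abs_mul, mul_assoc]
      exact mul_le_mul_of_nonneg_left h2 (abs_nonneg _)
  -- On the set where `|f| ≥ 1 / (n + 1)`, the function `|f L| / |f|` is a bounded admissible bound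
  -- for `L`.
  have hge : ∀ n : ℕ, ∀ᵐ y ∂μ, 1 / ((n : ℝ) + 1) ≤ |Linf.fn f y| →
      |Linf.fn f y| * Linf.fn (dualNorm pn L) y ≤ Linf.fn (dualNorm pn (f • L)) y := by
    intro n
    have hε : (0 : ℝ) < 1 / ((n : ℝ) + 1) := by positivity
    set ε : ℝ := 1 / ((n : ℝ) + 1)
    classical
    let k : Y → ℕ := fun y => if ε ≤ |Linf.fn f y| then 0 else 1
    have hk : AEMeasurable k μ := by
      have : Measurable fun t : ℝ => if ε ≤ t then (0 : ℕ) else 1 :=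
        Measurable.ite measurableSet_Ici measurable_const measurable_const
      exact this.comp_aemeasurable hfm
    let B : ℕ → Y → ℝ := fun i y => Nat.casesOn i
      (Linf.fn (dualNorm pn (f • L)) y / |Linf.fn f y|) fun _ => Linf.fn (dualNorm pn L) y
    have hB : ∀ i, AEMeasurable (B i) μ := by
      rintro (_ | i)
      · exact (Linf.aemeasurable_fn _).div hfm
      · exact Linf.aemeasurable_fn _
    have hk0 : ∀ y, ε ≤ |Linf.fn f y| →
        B (k y) y = Linf.fn (dualNorm pn (f • L)) y / |Linf.fn f y| := by
      intro y hy
      have : k y = 0 := if_pos hy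
      rw [this]
      rfl
    have hk1 : ∀ y, ¬ε ≤ |Linf.fn f y| → B (k y) y = Linf.fn (dualNorm pn L) y := by
      intro y hy
      have : k y = 1 := if_neg hy
      rw [this]
      rfl
    have hG : ∀ᵐ y ∂μ, Linf.fn (dualNorm pn L) y ≤ B (k y) y := by
      refine Dual.dualNorm_le h L (aemeasurable_glue hk hB)
        (C := max (Linf.nrm (dualNorm pn (f • L)) / ε) (Linf.nrm (dualNorm pn L))) ?_ ?_
        fun v => ?_
      · filter_upwards [Linf.abs_fn_le_nrm (dualNorm pn (f • L)),
          Linf.abs_fn_le_nrm (dualNorm pn L)] with y h1 h2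
        by_cases hy : ε ≤ |Linf.fn f y|
        · rw [hk0 y hy, abs_div, abs_abs]
          exact (div_le_div₀ (Linf.nrm_nonneg _) h1 hε hy).trans (le_max_left _ _)
        · rw [hk1 y hy]
          exact h2.trans (le_max_right _ _)
      · filter_upwards [Dual.dualNorm_nonneg h L, Dual.dualNorm_nonneg h (f • L)] with y h1 h2
        by_cases hy : ε ≤ |Linf.fn f y|
        · rw [hk0 y hy]
          positivity
        · rwa [hk1 y hy]
      · filter_upwards [Dual.abs_fn_le_dualNorm h L v, Dual.abs_fn_le_dualNorm h (f • L) v,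
          Dual.fn_coe_smul f L v] with y h1 h2 h3
        by_cases hy : ε ≤ |Linf.fn f y|
        · rw [hk0 y hy, div_mul_eq_mul_div, le_div_iff₀ (hε.trans_le hy)]
          rw [h3, abs_mul] at h2
          linarith
        · rwa [hk1 y hy]
    filter_upwards [hG] with y h1 hy
    rw [hk0 y hy, le_div_iff₀ (hε.trans_le hy)] at h1
    linarith
  filter_upwards [hle, ae_all_iff.2 hge, Dual.dualNorm_nonneg h (f • L)] with y h1 h2 h3
  refine le_antisymm h1 ?_
  rcases (abs_nonneg (Linf.fn f y)).eq_or_lt with h4 | h4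
  · rwa [← h4, zero_mul]
  · obtain ⟨n, hn⟩ := exists_nat_one_div_lt h4
    exact h2 n hn.le

theorem Dual.dualNorm_add_le [SigmaFinite μ] (h : IsNormedModule pn) (L L' : Dual pn) :
    dualNorm pn (L + L') ≤ dualNorm pn L + dualNorm pn L' := by
  refine Linf.le_iff.2 (Dual.dualNorm_le h _ (Linf.aemeasurable_fn _) (Linf.abs_fn_le_nrm _)
    ?_ fun v => ?_)
  · filter_upwards [Dual.dualNorm_nonneg h L, Dual.dualNorm_nonneg h L', Linf.fn_add (dualNorm pn L)
      (dualNorm pn L')] with y h1 h2 h3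
    rw [h3]
    positivity
  · filter_upwards [Dual.abs_fn_le_dualNorm h L v, Dual.abs_fn_le_dualNorm h L' v,
      Linf.fn_add (dualNorm pn L) (dualNorm pn L'), Dual.fn_coe_add L L' v] with y h1 h2 h3 h4
    rw [h3, h4, add_mul]
    exact (abs_add_le _ _).trans (add_le_add h1 h2)

theorem Dual.exists_glue [SigmaFinite μ] (h : IsNormedModule pn) (E : ℕ → Set Y)
    (hE : IsPartition (complSigma μ) E) (L : ℕ → Dual pn) (C : ℝ)
    (hC : ∀ n, Linf.nrm (Linf.ind (ae μ) (E n) (hE.measurable n) * dualNorm pn (L n)) ≤ C) :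
    ∃ L' : Dual pn, ∀ n, Linf.ind (ae μ) (E n) (hE.measurable n) • L' =
      Linf.ind (ae μ) (E n) (hE.measurable n) • L n := by
  obtain ⟨k, hk, hEk⟩ := PtSeminorm.exists_index hE
  have hk' : NullMeasurable k μ := hk
  have hb : ∀ n, ∀ᵐ y ∂μ, y ∈ E n → Linf.fn (dualNorm pn (L n)) y ≤ C := by
    intro n
    filter_upwards [Linf.abs_fn_le_nrm (Linf.ind (ae μ) (E n) (hE.measurable n) *
      dualNorm pn (L n)), Linf.fn_mul (Linf.ind (ae μ) (E n) (hE.measurable n))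
      (dualNorm pn (L n)), Linf.fn_ind (hE.measurable n)] with y h1 h2 h3 hy
    rw [h2, h3, Set.indicator_of_mem hy, Pi.one_apply, one_mul] at h1
    exact (le_abs_self _).trans (h1.trans (hC n))
  obtain ⟨L', hL'⟩ := Dual.exists_of_ae h (fun v y => Linf.fn ((L (k y)).1 v) y) C
    (fun v => aemeasurable_glue (g := fun n => Linf.fn ((L n).1 v)) hk'.aemeasurable
      fun n => Linf.aemeasurable_fn _)
    (fun v w => by
      filter_upwards [ae_all_iff.2 fun n => Dual.fn_add (L n) v w] with y hy using hy (k y))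
    (fun f v => by
      filter_upwards [ae_all_iff.2 fun n => Dual.fn_smul (L n) f v] with y hy using hy (k y))
    (fun v => by
      filter_upwards [ae_all_iff.2 hb, h.fn_nonneg v,
        ae_all_iff.2 fun n => Dual.abs_fn_le_dualNorm h (L n) v] with y h1 h2 h3
      exact (h3 (k y)).trans
        (mul_le_mul_of_nonneg_right (h1 (k y) ((hEk _ _).2 rfl)) h2))
  refine ⟨L', fun n => Dual.ext_fn fun v => ?_⟩
  filter_upwards [hL' v, Dual.fn_coe_smul (Linf.ind (ae μ) (E n) (hE.measurable n)) L' v,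
    Dual.fn_coe_smul (Linf.ind (ae μ) (E n) (hE.measurable n)) (L n) v,
    Linf.fn_ind (hE.measurable n)] with y h1 h2 h3 h4
  rw [h2, h3, h4, h1]
  by_cases hy : y ∈ E n
  · rw [(hEk n y).1 hy]
  · rw [Set.indicator_of_notMem hy, zero_mul, zero_mul]

theorem Dual.exists_limit [SigmaFinite μ] (h : IsNormedModule pn) (u : ℕ → Dual pn)
    (hu : ∀ ε : ℝ, 0 < ε → ∃ N, ∀ i, N ≤ i → ∀ j, N ≤ j →
      Linf.nrm (dualNorm pn (u i - u j)) < ε) :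
    ∃ w : Dual pn, Tendsto (fun n => Linf.nrm (dualNorm pn (u n - w))) atTop (𝓝 0) := by
  have hd : ∀ ε : ℝ, 0 < ε → ∃ K, ∀ i, K ≤ i → ∀ j, K ≤ j → ∀ v, ∀ᵐ y ∂μ,
      |Linf.fn ((u i).1 v) y - Linf.fn ((u j).1 v) y| ≤ ε * Linf.fn (pn v) y := by
    intro ε hε
    obtain ⟨K, hK⟩ := hu ε hε
    refine ⟨K, fun i hi j hj v => ?_⟩
    filter_upwards [Dual.fn_coe_sub (u i) (u j) v, Dual.abs_fn_le_dualNorm h (u i - u j) v,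
      Linf.abs_fn_le_nrm (dualNorm pn (u i - u j)), h.fn_nonneg v] with y h1 h2 h3 h4
    rw [← h1]
    refine h2.trans (mul_le_mul_of_nonneg_right ?_ h4)
    exact (le_abs_self _).trans (h3.trans (hK i hi j hj).le)
  -- Off a null set depending on `v`, `limUnder` is a genuine limit.
  have ht : ∀ v, ∀ᵐ y ∂μ, Tendsto (fun n => Linf.fn ((u n).1 v) y) atTop
      (𝓝 (limUnder atTop fun n => Linf.fn ((u n).1 v) y)) := by
    intro v
    have h1 : ∀ m : ℕ, ∃ K, ∀ᵐ y ∂μ, ∀ i, K ≤ i → ∀ j, K ≤ j →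
        |Linf.fn ((u i).1 v) y - Linf.fn ((u j).1 v) y| ≤
          1 / ((m : ℝ) + 1) * Linf.fn (pn v) y := by
      intro m
      obtain ⟨K, hK⟩ := hd (1 / ((m : ℝ) + 1)) (by positivity)
      refine ⟨K, ?_⟩
      simp only [ae_all_iff]
      exact fun i hi j hj => hK i hi j hj v
    choose K hK using h1
    filter_upwards [ae_all_iff.2 hK, h.fn_nonneg v] with y h2 h3
    refine tendsto_nhds_limUnder
      (cauchySeq_tendsto_of_complete (Metric.cauchySeq_iff'.2 fun ε hε => ?_))
    have h4 : 0 < ε / (Linf.fn (pn v) y + 1) := by positivity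
    obtain ⟨m, hm⟩ := exists_nat_one_div_lt h4
    refine ⟨K m, fun i hi => ?_⟩
    rw [Real.dist_eq]
    refine (h2 m i hi (K m) le_rfl).trans_lt ?_
    rw [lt_div_iff₀ (by positivity)] at hm
    refine lt_of_le_of_lt ?_ hm
    gcongr
    linarith
  obtain ⟨K₁, hK₁⟩ := hd 1 one_pos
  obtain ⟨C, hC0, hC⟩ := Dual.exists_bound h (u K₁)
  have hlim : ∀ ε i v, (∃ K, ∀ j, K ≤ j → ∀ᵐ y ∂μ,
      |Linf.fn ((u i).1 v) y - Linf.fn ((u j).1 v) y| ≤ ε * Linf.fn (pn v) y) → ∀ᵐ y ∂μ,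
      |Linf.fn ((u i).1 v) y - limUnder atTop fun n => Linf.fn ((u n).1 v) y| ≤
        ε * Linf.fn (pn v) y := by
    rintro ε i v ⟨K, hK⟩
    have h1 : ∀ᵐ y ∂μ, ∀ j, K ≤ j →
        |Linf.fn ((u i).1 v) y - Linf.fn ((u j).1 v) y| ≤ ε * Linf.fn (pn v) y := by
      simpa only [ae_all_iff] using hK
    filter_upwards [h1, ht v] with y h2 h3
    refine le_of_tendsto (tendsto_const_nhds.sub h3).abs ?_
    filter_upwards [eventually_ge_atTop K] with j hj using h2 j hj
  obtain ⟨w, hw⟩ := Dual.exists_of_ae h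
    (fun v y => limUnder atTop fun n => Linf.fn ((u n).1 v) y) (C + 1)
    (fun v => aemeasurable_of_tendsto_metrizable_ae atTop
      (fun n => Linf.aemeasurable_fn ((u n).1 v)) (ht v))
    (fun v w => by
      filter_upwards [ht v, ht w, ht (v + w), ae_all_iff.2 fun n => Dual.fn_add (u n) v w]
        with y h1 h2 h3 h4
      refine tendsto_nhds_unique h3 ?_
      simp only [h4]
      exact h1.add h2)
    (fun f v => by
      filter_upwards [ht v, ht (f • v), ae_all_iff.2 fun n => Dual.fn_smul (u n) f v] with y h1 h2 h3
      refine tendsto_nhds_unique h2 ?_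
      simp only [h3]
      exact h1.const_mul _)
    (fun v => by
      filter_upwards [hC v, hlim 1 K₁ v ⟨K₁, fun j hj => hK₁ K₁ le_rfl j hj v⟩] with y h1 h2
      rw [abs_sub_comm] at h2
      linarith [abs_sub_abs_le_abs_sub (limUnder atTop fun n => Linf.fn ((u n).1 v) y)
        (Linf.fn ((u K₁).1 v) y)])
  refine ⟨w, Metric.tendsto_atTop.2 fun ε hε => ?_⟩
  obtain ⟨K, hK⟩ := hd (ε / 2) (half_pos hε)
  refine ⟨K, fun i hi => ?_⟩
  rw [Real.dist_eq, sub_zero, abs_of_nonneg (Linf.nrm_nonneg _)]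
  refine lt_of_le_of_lt ((Linf.nrm_le_iff _ (half_pos hε).le).2 ?_) (half_lt_self hε)
  have h1 : ∀ᵐ y ∂μ, Linf.fn (dualNorm pn (u i - w)) y ≤ ε / 2 := by
    refine Dual.dualNorm_le h _ aemeasurable_const (C := ε / 2)
      (Eventually.of_forall fun _ => (abs_of_pos (half_pos hε)).le)
      (Eventually.of_forall fun _ => (half_pos hε).le) fun v => ?_
    filter_upwards [hlim (ε / 2) i v ⟨K, fun j hj => hK i hi j hj v⟩, hw v,
      Dual.fn_coe_sub (u i) w v] with y h2 h3 h4
    rwa [h4, h3]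
  filter_upwards [h1, Dual.dualNorm_nonneg h (u i - w)] with y h2 h3
  rwa [abs_of_nonneg h3]

/-- The dual of a normed module over `L^∞(μ)` is a normed module. -/
theorem Dual.isNormedModule [SigmaFinite μ] (h : IsNormedModule pn) :
    IsNormedModule (dualNorm pn) where
  nonneg L := by
    refine Linf.le_iff.2 ?_
    filter_upwards [Dual.dualNorm_nonneg h L, Linf.fn_zero (μ := μ)] with y h1 h2
    rwa [h2]
  eq_zero_iff L := by
    constructor
    · intro h0
      refine Dual.ext_fn fun v => ?_
      filter_upwards [Dual.abs_fn_le_dualNorm h L v, Linf.eq_iff.1 h0, Linf.fn_zero (μ := μ)]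
        with y h1 h2 h3
      rw [h2, h3, zero_mul] at h1
      change _ = Linf.fn (0 : LinfMu μ) y
      rw [h3]
      exact abs_nonpos_iff.1 h1
    · rintro rfl
      refine Linf.eq_iff.2 ?_
      have h1 : ∀ᵐ y ∂μ, Linf.fn (dualNorm pn 0) y ≤ 0 := by
        refine Dual.dualNorm_le h 0 aemeasurable_const (C := 0) (by simp) (by simp) fun v => ?_
        filter_upwards [Linf.fn_zero (μ := μ)] with y hy
        change |Linf.fn (0 : LinfMu μ) y| ≤ _
        rw [hy, abs_zero, zero_mul]
      filter_upwards [h1, Dual.dualNorm_nonneg h (0 : Dual pn), Linf.fn_zero (μ := μ)]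
        with y h2 h3 h4
      rw [h4]
      exact le_antisymm h2 h3
  add_le := Dual.dualNorm_add_le h
  smul_eq f L := by
    rw [← Linf.coe_fn (dualNorm pn L), ← Linf.coe_fn f]
    exact (Linf.coe_eq_iff _ fun y => |Linf.fn f y| * Linf.fn (dualNorm pn L) y).2
      (Dual.dualNorm_smul h f L)
  glueing E hE L := fun ⟨C, hC⟩ => Dual.exists_glue h E hE L C hC
  complete u hu := Dual.exists_limit h u hu

end DualAE

/-! ### Extension from a generating set -/

section Extension

variable {Y : Type*} [MeasurableSpace Y] {μ : Measure Y}

theorem ae_le_of_forall_pos {A B K : Y → ℝ}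
    (h : ∀ ε : ℝ, 0 < ε → ∀ᵐ y ∂μ, A y ≤ B y + K y * ε) : ∀ᵐ y ∂μ, A y ≤ B y := by
  filter_upwards [ae_all_iff.2 fun n : ℕ => h (1 / ((n : ℝ) + 1)) (by positivity)] with y hy
  have ht : Tendsto (fun n : ℕ => B y + K y * (1 / ((n : ℝ) + 1))) atTop (𝓝 (B y + K y * 0)) :=
    (tendsto_one_div_add_atTop_nhds_zero_nat.const_mul _).const_add _
  rw [mul_zero, add_zero] at ht
  exact ge_of_tendsto' ht hy

theorem le_of_forall_rat_le_add_abs_sub_mul {A B D x : ℝ}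
    (h : ∀ q : ℚ, A ≤ D + |x - q| * B) : A ≤ D := by
  refine le_of_forall_pos_le_add fun ε hε => ?_
  have hB : 0 < |B| + 1 := by positivity
  obtain ⟨q, hq, hq'⟩ := exists_rat_btwn (show x < x + ε / (|B| + 1) by
    linarith [div_pos hε hB])
  have h1 : |x - q| ≤ ε / (|B| + 1) := by
    rw [abs_le]
    constructor <;> linarith
  have h2 : |x - q| * B ≤ ε / (|B| + 1) * (|B| + 1) :=
    (mul_le_mul_of_nonneg_left ((le_abs_self B).trans (by linarith)) (abs_nonneg _)).trans
      (mul_le_mul_of_nonneg_right h1 hB.le)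
  rw [div_mul_cancel₀ _ hB.ne'] at h2
  linarith [h q]

variable {N : Type*} [AddCommGroup N] [Module (LinfMu μ) N] {pn : N → LinfMu μ}
  {M : Type*} [AddCommGroup M] [Module ℝ M] [Module ℝ N]

theorem IsNormedModule.exists_approx_map (h : IsNormedModule pn) {P : M →ₗ[ℝ] N}
    (hP : Generates pn (Set.range P)) (V : N) {ε : ℝ} (hε : 0 < ε) :
    ∃ (k : Y → ℕ) (v : ℕ → M), AEMeasurable k μ ∧
      ∀ᵐ y ∂μ, Linf.fn (pn (V - P (v (k y)))) y ≤ ε := by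
  obtain ⟨k, u, hk, hu, hV⟩ := h.exists_approx hP V hε
  choose v hv using hu
  exact ⟨k, v, hk, by simpa only [hv] using hV⟩

/-- An element of the dual is determined by its values on a generating set. -/
theorem Dual.ext_of_generates (h : IsNormedModule pn) {P : M →ₗ[ℝ] N}
    (hP : Generates pn (Set.range P)) {L L' : Dual pn} (hL : ∀ v, L.1 (P v) = L'.1 (P v)) :
    L = L' := by
  obtain ⟨C, hC0, hC⟩ := Dual.exists_bound h (L - L')
  refine Dual.ext_fn fun V => ?_
  have h1 : ∀ᵐ y ∂μ, |Linf.fn ((L - L').1 V) y| ≤ 0 := by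
    refine ae_le_of_forall_pos (K := fun _ => C) fun ε hε => ?_
    obtain ⟨k, v, -, hv⟩ := h.exists_approx_map hP V hε
    filter_upwards [hv, ae_all_iff.2 fun n => hC (V - P (v n))] with y h2 h3
    have h4 : (L - L').1 (V - P (v (k y))) = (L - L').1 V := by
      have h5 : (L - L').1 (P (v (k y))) = 0 := sub_eq_zero.2 (hL _)
      rw [map_sub, h5, sub_zero]
    have h6 := h3 (k y)
    rw [h4] at h6
    rw [zero_add]
    exact h6.trans (mul_le_mul_of_nonneg_left h2 hC0)
  filter_upwards [h1, Dual.fn_coe_sub L L' V] with y h2 h3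
  rw [h3] at h2
  exact sub_eq_zero.1 (abs_nonpos_iff.1 h2)

/-- Extension from a generating set: a linear family of functions `S v` with `|S v| ≤ C |P v|` is
the restriction of an element of the dual. The value `g` at `V` is characterised by
`|g - S v| ≤ C |V - P v|` for every `v`, and this property is compatible with the module
operations. -/
theorem Dual.exists_extension [IsScalarTower ℝ (LinfMu μ) N] (h : IsNormedModule pn) {P : M →ₗ[ℝ] N}
    (hP : Generates pn (Set.range P)) (S : M → Y → ℝ) (hS : ∀ v, AEMeasurable (S v) μ)
    (hadd : ∀ v w, ∀ᵐ y ∂μ, S (v + w) y = S v y + S w y)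
    (hsmul : ∀ (c : ℝ) v, ∀ᵐ y ∂μ, S (c • v) y = c * S v y) {C : ℝ} (hC0 : 0 ≤ C)
    (hC : ∀ v, ∀ᵐ y ∂μ, |S v y| ≤ C * Linf.fn (pn (P v)) y) :
    ∃ L : Dual pn, ∀ v, ∀ᵐ y ∂μ, Linf.fn (L.1 (P v)) y = S v y := by
  have hsub : ∀ v w, ∀ᵐ y ∂μ, |S v y - S w y| ≤ C * Linf.fn (pn (P v - P w)) y := by
    intro v w
    have h1 := hadd v ((-1 : ℝ) • w)
    have h2 := hC (v + (-1 : ℝ) • w)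
    have e : P (v + (-1 : ℝ) • w) = P v - P w := by
      rw [map_add, map_smul, neg_one_smul, ← sub_eq_add_neg]
    rw [e] at h2
    filter_upwards [h1, h2, hsmul (-1) w] with y h3 h4 h5
    rwa [h3, h5, neg_one_mul, ← sub_eq_add_neg] at h4
  let Rel : N → (Y → ℝ) → Prop := fun V g =>
    ∀ v, ∀ᵐ y ∂μ, |g y - S v y| ≤ C * Linf.fn (pn (V - P v)) y
  have hex : ∀ V, ∃ g, AEMeasurable g μ ∧ Rel V g := by
    intro V
    choose k v hk hv using fun j : ℕ =>
      h.exists_approx_map hP V (show (0 : ℝ) < 1 / ((j : ℝ) + 1) by positivity)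
    let g : ℕ → Y → ℝ := fun j y => S (v j (k j y)) y
    have hgm : ∀ j, AEMeasurable (g j) μ := fun j =>
      aemeasurable_glue (g := fun n => S (v j n)) (hk j) fun n => hS _
    have hgv : ∀ w, ∀ᵐ y ∂μ, ∀ j,
        |g j y - S w y| ≤ C * (1 / ((j : ℝ) + 1) + Linf.fn (pn (V - P w)) y) := by
      intro w
      rw [ae_all_iff]
      intro j
      filter_upwards [hv j, ae_all_iff.2 fun n => hsub (v j n) w,
        ae_all_iff.2 fun n => h.fn_sub_le_sub_add_sub (P (v j n)) V (P w),
        ae_all_iff.2 fun n => h.fn_sub_comm V (P (v j n))] with y h1 h2 h3 h4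
      refine (h2 (k j y)).trans (mul_le_mul_of_nonneg_left ?_ hC0)
      have h5 := h3 (k j y)
      rw [← h4] at h5
      linarith
    have hgg : ∀ᵐ y ∂μ, ∀ i j, |g i y - g j y| ≤
        C * (1 / ((i : ℝ) + 1) + 1 / ((j : ℝ) + 1)) := by
      rw [ae_all_iff]
      intro i
      rw [ae_all_iff]
      intro j
      filter_upwards [hv j, ae_all_iff.2 fun n => hgv (v j n)] with y h1 h2
      refine (h2 (k j y) i).trans (mul_le_mul_of_nonneg_left ?_ hC0)
      linarith
    have hlim : ∀ᵐ y ∂μ, Tendsto (fun j => g j y) atTop (𝓝 (limUnder atTop fun j => g j y)) := by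
      filter_upwards [hgg] with y h1
      refine tendsto_nhds_limUnder
        (cauchySeq_tendsto_of_complete (Metric.cauchySeq_iff'.2 fun ε hε => ?_))
      obtain ⟨n, hn⟩ := exists_nat_one_div_lt (show 0 < ε / (2 * (C + 1)) by positivity)
      refine ⟨n, fun i hi => ?_⟩
      rw [Real.dist_eq]
      have h2 : 1 / ((i : ℝ) + 1) ≤ 1 / ((n : ℝ) + 1) := Nat.one_div_le_one_div hi
      rw [lt_div_iff₀ (by positivity)] at hn
      have h3 : C * (1 / ((i : ℝ) + 1) + 1 / ((n : ℝ) + 1)) ≤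
          (C + 1) * (1 / ((n : ℝ) + 1) + 1 / ((n : ℝ) + 1)) := by
        gcongr
        linarith
      have h4 := h1 i n
      nlinarith
    refine ⟨_, aemeasurable_of_tendsto_metrizable_ae atTop hgm hlim, fun w => ?_⟩
    filter_upwards [hgv w, hlim] with y h1 h2
    have h3 : Tendsto (fun j : ℕ => C * (1 / ((j : ℝ) + 1) + Linf.fn (pn (V - P w)) y)) atTop
        (𝓝 (C * (0 + Linf.fn (pn (V - P w)) y))) :=
      (tendsto_one_div_add_atTop_nhds_zero_nat.add_const _).const_mul _
    rw [zero_add] at h3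
    exact le_of_tendsto_of_tendsto' (h2.sub_const _).abs h3 h1
  have huniq : ∀ V g g', Rel V g → Rel V g' → ∀ᵐ y ∂μ, g y = g' y := by
    intro V g g' hg hg'
    have h1 : ∀ᵐ y ∂μ, |g y - g' y| ≤ 0 := by
      refine ae_le_of_forall_pos (K := fun _ => 2 * C) fun ε hε => ?_
      obtain ⟨k, v, -, hv⟩ := h.exists_approx_map hP V hε
      filter_upwards [hv, ae_all_iff.2 fun n => hg (v n), ae_all_iff.2 fun n => hg' (v n)]
        with y h2 h3 h4
      have h5 := abs_sub_le (g y) (S (v (k y)) y) (g' y)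
      rw [abs_sub_comm (S (v (k y)) y) (g' y)] at h5
      have h6 := mul_le_mul_of_nonneg_left h2 hC0
      linarith [h3 (k y), h4 (k y)]
    filter_upwards [h1] with y h2
    exact sub_eq_zero.1 (abs_nonpos_iff.1 h2)
  have hradd : ∀ V W g g', Rel V g → Rel W g' → Rel (V + W) fun y => g y + g' y := by
    intro V W g g' hg hg' w
    refine ae_le_of_forall_pos (K := fun _ => 4 * C) fun ε hε => ?_
    obtain ⟨k, v, -, hv⟩ := h.exists_approx_map hP V hε
    obtain ⟨k', v', -, hv'⟩ := h.exists_approx_map hP W hε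
    have h1 : ∀ n m, ∀ᵐ y ∂μ, Linf.fn (pn (P (v n + v' m) - P w)) y ≤
        Linf.fn (pn (V - P (v n))) y + Linf.fn (pn (W - P (v' m))) y +
          Linf.fn (pn (V + W - P w)) y := by
      intro n m
      have e : P (v n + v' m) - P w =
          (P (v n) - V) + (P (v' m) - W) + (V + W - P w) := by
        rw [map_add]
        abel
      rw [e]
      filter_upwards [h.fn_add_le (P (v n) - V + (P (v' m) - W)) (V + W - P w),
        h.fn_add_le (P (v n) - V) (P (v' m) - W), h.fn_sub_comm V (P (v n)),
        h.fn_sub_comm W (P (v' m))] with y h2 h3 h4 h5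
      linarith
    filter_upwards [hv, hv', ae_all_iff.2 fun n => hg (v n), ae_all_iff.2 fun n => hg' (v' n),
      ae_all_iff.2 fun n => ae_all_iff.2 (h1 n),
      ae_all_iff.2 fun n => ae_all_iff.2 fun m => hsub (v n + v' m) w,
      ae_all_iff.2 fun n => ae_all_iff.2 fun m => hadd (v n) (v' m)] with y h2 h3 h4 h5 h6 h7 h8
    have e : g y + g' y - S w y = (g y - S (v (k y)) y) + (g' y - S (v' (k' y)) y) +
        (S (v (k y) + v' (k' y)) y - S w y) := by
      rw [h8]
      ring
    have h9 := mul_le_mul_of_nonneg_left h2 hC0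
    have h10 := mul_le_mul_of_nonneg_left h3 hC0
    have h11 := mul_le_mul_of_nonneg_left (h6 (k y) (k' y)) hC0
    rw [e]
    linarith [abs_add_le ((g y - S (v (k y)) y) + (g' y - S (v' (k' y)) y))
      (S (v (k y) + v' (k' y)) y - S w y), abs_add_le (g y - S (v (k y)) y)
      (g' y - S (v' (k' y)) y), h4 (k y), h5 (k' y), h7 (k y) (k' y)]
  have hrsmul : ∀ V g (f : LinfMu μ), Rel V g → Rel (f • V) fun y => Linf.fn f y * g y := by
    intro V g f hg w
    -- The scalar `f y` is replaced by a rational number, for which the real-linearity of `S` can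
    -- be used off a common null set.
    have hrat : ∀ u, ∀ᵐ y ∂μ, |Linf.fn f y * S u y - S w y| ≤
        C * (|Linf.fn f y| * Linf.fn (pn (V - P u)) y + Linf.fn (pn (f • V - P w)) y) := by
      intro u
      have h1 : ∀ q : ℚ, ∀ᵐ y ∂μ, Linf.fn (pn (P ((q : ℝ) • u) - P w)) y ≤
          |Linf.fn f y - q| * Linf.fn (pn (P u)) y +
            |Linf.fn f y| * Linf.fn (pn (V - P u)) y + Linf.fn (pn (f • V - P w)) y := by
        intro q
        set c : LinfMu μ := algebraMap ℝ (LinfMu μ) (q : ℝ)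
        have e : P ((q : ℝ) • u) - P w =
            (c - f) • P u + f • (P u - V) + (f • V - P w) := by
          rw [map_smul, ← algebraMap_smul (LinfMu μ) (q : ℝ) (P u), sub_smul, smul_sub]
          abel
        rw [e]
        filter_upwards [h.fn_add_le ((c - f) • P u + f • (P u - V)) (f • V - P w),
          h.fn_add_le ((c - f) • P u) (f • (P u - V)), h.fn_smul (c - f) (P u),
          h.fn_smul f (P u - V), h.fn_sub_comm V (P u), Linf.fn_sub c f,
          Linf.fn_algebraMap (μ := μ) (q : ℝ)] with y h2 h3 h4 h5 h6 h7 h8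
        rw [h4, h5, h7, h8, ← h6, abs_sub_comm] at h3
        linarith
      filter_upwards [ae_all_iff.2 h1, ae_all_iff.2 fun q : ℚ => hsub ((q : ℝ) • u) w,
        ae_all_iff.2 fun q : ℚ => hsmul (q : ℝ) u, hC u] with y h2 h3 h4 h5
      refine le_of_forall_rat_le_add_abs_sub_mul (x := Linf.fn f y)
        (B := 2 * (C * Linf.fn (pn (P u)) y)) fun q => ?_
      have h6 := h3 q
      rw [h4 q] at h6
      have h7 := mul_le_mul_of_nonneg_left (h2 q) hC0
      have h8 := mul_le_mul_of_nonneg_left h5 (abs_nonneg (Linf.fn f y - q))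
      have e : Linf.fn f y * S u y - S w y =
          (Linf.fn f y - q) * S u y + ((q : ℝ) * S u y - S w y) := by ring
      rw [e]
      refine (abs_add_le _ _).trans ?_
      rw [abs_mul]
      linarith
    refine ae_le_of_forall_pos (K := fun y => 2 * (C * |Linf.fn f y|)) fun ε hε => ?_
    obtain ⟨k, v, -, hv⟩ := h.exists_approx_map hP V hε
    filter_upwards [hv, ae_all_iff.2 fun n => hg (v n), ae_all_iff.2 fun n => hrat (v n)]
      with y h1 h2 h3
    have e : Linf.fn f y * g y - S w y = Linf.fn f y * (g y - S (v (k y)) y) +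
        (Linf.fn f y * S (v (k y)) y - S w y) := by ring
    rw [e]
    refine (abs_add_le _ _).trans ?_
    rw [abs_mul]
    have h4 := mul_le_mul_of_nonneg_left (h2 (k y)) (abs_nonneg (Linf.fn f y))
    have h5 := mul_le_mul_of_nonneg_left h1 (mul_nonneg hC0 (abs_nonneg (Linf.fn f y)))
    linarith [h3 (k y)]
  choose G hGm hG using hex
  obtain ⟨L, hL⟩ := Dual.exists_of_ae h G C hGm
    (fun V W => huniq _ _ _ (hG _) (hradd V W _ _ (hG V) (hG W)))
    (fun f V => huniq _ _ _ (hG _) (hrsmul V _ f (hG V)))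
    (fun V => by
      have h1 := hG V 0
      rw [map_zero, sub_zero] at h1
      have h2 := hsmul 0 0
      rw [zero_smul] at h2
      filter_upwards [h1, h2] with y h3 h4
      rwa [h4, zero_mul, sub_zero] at h3)
  refine ⟨L, fun v => ?_⟩
  filter_upwards [hL (P v), huniq _ _ _ (hG (P v)) (hsub v)] with y h1 h2
  rw [h1, h2]

end Extension

/-! ### Liftings of functions and measure preserving maps -/

section LiftingFun

variable {X Y : Type*} [MeasurableSpace X] [MeasurableSpace Y] {μX : Measure X} {μY : Measure Y}

theorem Lifting.funLift_congr (ℓ : Lifting μX) {f g : X → ℝ}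
    (hf : f ∈ boundedMeasurable (complSigma μX)) (hg : g ∈ boundedMeasurable (complSigma μX))
    (h : ∀ᵐ x ∂μX, f x = g x) (x : X) : ℓ.funLift f x = ℓ.funLift g x :=
  le_antisymm (ℓ.funLift_mono hf hg (h.mono fun _ hy => hy.le) x)
    (ℓ.funLift_mono hg hf (h.mono fun _ hy => hy.ge) x)

/-- Compatibility of two liftings with a measure preserving map extends from measurable to null
measurable sets. -/
theorem Lifting.toFun_preimage (ℓX : Lifting μX) (ℓY : Lifting μY) {φ : Y → X}
    (hφ : @MeasurePreserving (NullMeasurableSpace Y μY) (NullMeasurableSpace X μX) _ _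
      φ μY.completion μX.completion)
    (hℓ : ∀ E : Set X, MeasurableSet E → ℓY.toFun (φ ⁻¹' E) = φ ⁻¹' (ℓX.toFun E))
    {E : Set X} (hE : NullMeasurableSet E μX) : ℓY.toFun (φ ⁻¹' E) = φ ⁻¹' (ℓX.toFun E) := by
  obtain ⟨F, hF, hEF⟩ := hE
  have hEF' : ∀ᵐ x ∂μX, x ∈ E ↔ x ∈ F := hEF.mono fun x hx => iff_of_eq hx
  have h2 : Tendsto φ (ae μY) (ae μX) := hφ.quasiMeasurePreserving.tendsto_ae
  have hE' : NullMeasurableSet E μX := ⟨F, hF, hEF⟩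
  have hm : ∀ {A : Set X}, NullMeasurableSet A μX → NullMeasurableSet (φ ⁻¹' A) μY :=
    fun hA => hφ.measurable hA
  rw [ℓX.congr E F hE' hF.nullMeasurableSet (by
      rw [measure_symmDiff_eq_zero_iff]
      exact hEF), ← hℓ F hF]
  refine ℓY.congr _ _ (hm hE') (hm hF.nullMeasurableSet) ?_
  rw [measure_symmDiff_eq_zero_iff]
  exact (h2.eventually hEF').mono fun y hy => propext hy

theorem Lifting.funLift_comp (ℓX : Lifting μX) (ℓY : Lifting μY) {φ : Y → X}
    (hφ : @MeasurePreserving (NullMeasurableSpace Y μY) (NullMeasurableSpace X μX) _ _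
      φ μY.completion μX.completion)
    (hℓ : ∀ E : Set X, MeasurableSet E → ℓY.toFun (φ ⁻¹' E) = φ ⁻¹' (ℓX.toFun E))
    {f : X → ℝ} (hf : f ∈ boundedMeasurable (complSigma μX)) (y : Y) :
    ℓY.funLift (f ∘ φ) y = ℓX.funLift f (φ y) := by
  unfold Lifting.funLift
  congr 1
  ext c
  have h := ℓX.toFun_preimage ℓY hφ hℓ (Lifting.nullMeasurableSet_lt hf c)
  exact Set.ext_iff.1 h y

end LiftingFun

/-! ### Fibres -/

section FibreNorm

variable {X : Type*} [MeasurableSpace X] {μ : Measure X}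
  {LM : Type*} [AddCommGroup LM] [Module (LinfTop (complSigma μ)) LM]
  [Module ℝ LM] [IsScalarTower ℝ (LinfTop (complSigma μ)) LM]
  {pnL : LM → LinfTop (complSigma μ)}

theorem norm_valueAt (h : IsNormedModule pnL) (ℓ : Lifting μ) (x : X) (v : LM) :
    ‖valueAt h ℓ x v‖ = Linf.eval x (pnL v) := by
  have h1 : ‖valueAt h ℓ x v‖ = Linf.eval x (pnL (ℓ.fibreInd x • v)) :=
    SeparationQuotient.norm_mk _
  have h2 : Linf.eval x (ℓ.fibreInd x) = 1 :=
    Set.indicator_of_mem (ℓ.mem_fibreSet x) (1 : X → ℝ)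
  rw [h1, h.eval_smul, h2, abs_one, one_mul]

/-- The map `v ↦ v_x` to the fibre at `x`, as a real-linear map. -/
def valueAtLinear (h : IsNormedModule pnL) (ℓ : Lifting μ) (x : X) : LM →ₗ[ℝ] Fibre h ℓ x where
  toFun := valueAt h ℓ x
  map_add' v w := congrArg (SeparationQuotient.mk (X := PreFibre h ℓ x))
    (Subtype.ext (smul_add (ℓ.fibreInd x) v w))
  map_smul' c v := congrArg (SeparationQuotient.mk (X := PreFibre h ℓ x)) (Subtype.ext (by
    change ℓ.fibreInd x • c • v = c • ℓ.fibreInd x • v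
    rw [← algebraMap_smul (LinfTop (complSigma μ)) c v,
      ← algebraMap_smul (LinfTop (complSigma μ)) c (ℓ.fibreInd x • v), smul_smul, smul_smul,
      mul_comm]))

/-- A linear form which is bounded by the norm of a linear map `τ` factors through `τ` and a
continuous linear form on the target, by the Hahn-Banach theorem. -/
theorem exists_strongDual_comp_eq {M V : Type*} [AddCommGroup M] [Module ℝ M]
    [NormedAddCommGroup V] [NormedSpace ℝ V] (τ : M →ₗ[ℝ] V) (f : M →ₗ[ℝ] ℝ) (C : ℝ)
    (hC : ∀ v, |f v| ≤ C * ‖τ v‖) : ∃ F : StrongDual ℝ V, ∀ v, F (τ v) = f v := by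
  have hker : LinearMap.ker τ ≤ LinearMap.ker f := by
    intro v hv
    rw [LinearMap.mem_ker] at hv ⊢
    have h1 := hC v
    rw [hv, norm_zero, mul_zero] at h1
    exact abs_nonpos_iff.1 h1
  let f0 : LinearMap.range τ →ₗ[ℝ] ℝ :=
    (Submodule.liftQ _ f hker).comp τ.quotKerEquivRange.symm.toLinearMap
  have hf0 : ∀ v, f0 ⟨τ v, v, rfl⟩ = f v := by
    intro v
    have h1 : τ.quotKerEquivRange.symm ⟨τ v, v, rfl⟩ = Submodule.Quotient.mk v :=
      (LinearEquiv.symm_apply_eq _).2 rfl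
    change Submodule.liftQ _ f hker (τ.quotKerEquivRange.symm ⟨τ v, v, rfl⟩) = f v
    rw [h1]
    rfl
  obtain ⟨F, hF, -⟩ := exists_extension_norm_eq (LinearMap.range τ) (f0.mkContinuous C (by
    rintro ⟨_, v, rfl⟩
    rw [hf0]
    exact hC v))
  exact ⟨F, fun v => (hF ⟨τ v, v, rfl⟩).trans (hf0 v)⟩

end FibreNorm

/-! ### Sections of the dual spaces and the dual module -/

section WeakDual

variable {Y : Type*} [MeasurableSpace Y] {μ : Measure Y} {V : Y → Type*}
  [∀ y, NormedAddCommGroup (V y)] [∀ y, NormedSpace ℝ (V y)]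

theorem LinfWeak.mk_eq_iff {Test : Set (∀ y, V y)} {ω ω' : weakSections μ Test} :
    LinfWeak.mk ω = LinfWeak.mk ω' ↔ ∀ v ∈ Test, ∀ᵐ y ∂μ, ω.1 y (v y) = ω'.1 y (v y) := by
  have h1 : LinfWeak.mk ω = LinfWeak.mk ω' ↔ ω - ω' ∈ weakNull μ Test :=
    Submodule.Quotient.eq _
  rw [h1]
  refine forall₂_congr fun v _ => eventually_congr (Eventually.of_forall fun y => ?_)
  change ω.1 y (v y) - ω'.1 y (v y) = 0 ↔ _
  rw [sub_eq_zero]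

theorem LinfWeak.mk_surjective {Test : Set (∀ y, V y)} :
    Function.Surjective (LinfWeak.mk : weakSections μ Test → LinfWeak μ Test) :=
  Submodule.Quotient.mk_surjective _

theorem LinfWeak.ae_eq_of_mem_combinations {Test : Set (∀ y, V y)} {ω ω' : weakSections μ Test}
    (h : LinfWeak.mk ω = LinfWeak.mk ω') {v : ∀ y, V y} (hv : v ∈ combinations μ Test) :
    ∀ᵐ y ∂μ, ω.1 y (v y) = ω'.1 y (v y) := by
  obtain ⟨n, f, t, -, ht, hv⟩ := hv
  filter_upwards [ae_all_iff.2 fun i => LinfWeak.mk_eq_iff.1 h (t i) (ht i)] with y hy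
  rw [hv, map_sum, map_sum]
  simp only [map_smul, hy]

theorem weakSections.aemeasurable {Test : Set (∀ y, V y)} (ω : weakSections μ Test)
    {v : ∀ y, V y} (hv : v ∈ combinations μ Test) : AEMeasurable (fun y => ω.1 y (v y)) μ := by
  obtain ⟨n, f, t, hf, ht, hv⟩ := hv
  have h1 : (fun y => ω.1 y (v y)) = fun y => ∑ i, f i y * ω.1 y (t i y) := by
    funext y
    rw [hv, map_sum]
    simp only [map_smul, smul_eq_mul]
  rw [h1]
  refine Finset.aemeasurable_fun_sum _ fun i _ => ?_
  have hfi : NullMeasurable (f i) μ := hf i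
  exact hfi.aemeasurable.mul (ω.2.1 _ (ht i))

/-- The family whose essential supremum is the pointwise norm of an element of
`L^∞_weak(V'; μ)`. -/
def LinfWeak.unitValues {Test : Set (∀ y, V y)} (q : LinfWeak μ Test) : Set (LinfMu μ) :=
  {g | ∃ w : weakSections μ Test, LinfWeak.mk w = q ∧
    ∃ v ∈ combinations μ Test, (∀ y, ‖v y‖ ≤ 1) ∧
      (g : Germ (ae μ) ℝ) = ((fun y => w.1 y (v y) : Y → ℝ) : Germ (ae μ) ℝ)}

theorem LinfWeak.mem_upperBounds_iff {Test : Set (∀ y, V y)} (ω : weakSections μ Test)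
    (g : LinfMu μ) : g ∈ upperBounds (LinfWeak.unitValues (LinfWeak.mk ω)) ↔
      ∀ v ∈ combinations μ Test, (∀ y, ‖v y‖ ≤ 1) → ∀ᵐ y ∂μ, ω.1 y (v y) ≤ Linf.fn g y := by
  constructor
  · intro hg v hv h1
    obtain ⟨C, hC⟩ := ω.2.2
    obtain ⟨s, hs⟩ := Linf.exists_fn_eq (weakSections.aemeasurable ω hv) (hC v hv h1)
    filter_upwards [hs, Linf.le_iff.1 (hg ⟨ω, rfl, v, hv, h1, (Linf.coe_eq_iff _ _).2 hs⟩)]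
      with y h2 h3
    rwa [h2] at h3
  · rintro hg s ⟨ω', hω', v, hv, h1, hs⟩
    refine Linf.le_iff.2 ?_
    filter_upwards [hg v hv h1, (Linf.coe_eq_iff _ _).1 hs,
      LinfWeak.ae_eq_of_mem_combinations hω' hv] with y h2 h3 h4
    rwa [h3, h4]

variable {N : Type*} [AddCommGroup N] {pn : N → LinfMu μ}
  {M : Type*} [AddCommGroup M] [Module ℝ M] [Module ℝ N]

/-- The test vectors `τ v`, `v ∈ M`. -/
def testVectors (τ : ∀ y, M →ₗ[ℝ] V y) : Set (∀ y, V y) := Set.range fun v y => τ y v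

variable {P : M →ₗ[ℝ] N} {τ : ∀ y, M →ₗ[ℝ] V y} {ℓ : Lifting μ}

theorem measurable_norm_test (hτ : ∀ v y, ‖τ y v‖ = ℓ.funLift (Linf.fn (pn (P v))) y) (v : M) :
    Measurable[complSigma μ] fun y => ‖τ y v‖ := by
  simp only [hτ]
  exact (ℓ.funLift_mem (Linf.rep (pn (P v))).2).1

theorem ae_norm_test_eq (hτ : ∀ v y, ‖τ y v‖ = ℓ.funLift (Linf.fn (pn (P v))) y) (v : M) :
    ∀ᵐ y ∂μ, ‖τ y v‖ = Linf.fn (pn (P v)) y := by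
  simp only [hτ]
  exact ℓ.funLift_ae_eq (Linf.rep (pn (P v))).2

/-- A bound on the admissible combinations bounds `⟨ω, τ v⟩ / |τ v|`: use the combinations
`± (|τ v| + ε)⁻¹ τ v` and let `ε` tend to `0`. -/
theorem abs_apply_test_le (hτ : ∀ v y, ‖τ y v‖ = ℓ.funLift (Linf.fn (pn (P v))) y)
    (ω : DualSections V) {G : Y → ℝ}
    (hG : ∀ w ∈ combinations μ (testVectors τ), (∀ y, ‖w y‖ ≤ 1) → ∀ᵐ y ∂μ, ω y (w y) ≤ G y)
    (v : M) : ∀ᵐ y ∂μ, |ω y (τ y v)| ≤ G y * ‖τ y v‖ := by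
  refine ae_le_of_forall_pos (K := G) fun ε hε => ?_
  have hpos : ∀ y, 0 < ‖τ y v‖ + ε := fun y => by positivity
  have hfm : Measurable[complSigma μ] fun y => (‖τ y v‖ + ε)⁻¹ :=
    ((measurable_norm_test hτ v).add_const ε).inv
  have key : ∀ σ : ℝ, |σ| = 1 → ∀ᵐ y ∂μ, σ * ω y (τ y v) ≤ G y * (‖τ y v‖ + ε) := by
    intro σ hσ
    have hw := hG (fun y => (σ * (‖τ y v‖ + ε)⁻¹) • τ y v)
      ⟨1, fun _ y => σ * (‖τ y v‖ + ε)⁻¹, fun _ y => τ y v,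
        fun _ => measurable_const.mul hfm, fun _ => ⟨v, rfl⟩, fun y => by simp⟩ (fun y => by
        rw [norm_smul, Real.norm_eq_abs, abs_mul, hσ, one_mul, abs_of_pos (inv_pos.2 (hpos y)),
          inv_mul_le_iff₀ (hpos y)]
        linarith)
    filter_upwards [hw] with y hy
    rw [map_smul, smul_eq_mul, mul_right_comm, ← div_eq_mul_inv, div_le_iff₀ (hpos y)] at hy
    exact hy
  filter_upwards [key 1 abs_one, key (-1) (by rw [abs_neg, abs_one])] with y h1 h2
  rw [← mul_add]
  exact abs_le.2 ⟨by linarith, by linarith⟩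

variable [Module (LinfMu μ) N]

/-- The section `ω` of the dual spaces represents `L`: `L(P v) = ⟨ω, τ v⟩` off a null set, for the
test vectors `τ v`. -/
def Represents (P : M →ₗ[ℝ] N) (τ : ∀ y, M →ₗ[ℝ] V y) (ω : DualSections V) (L : Dual pn) : Prop :=
  ∀ v, ∀ᵐ y ∂μ, Linf.fn (L.1 (P v)) y = ω y (τ y v)

/-- The pointwise norm of a combination of elements `P v` is at most the norm of the corresponding
combination in the fibres. The scalars are replaced, one at a time, by rational numbers which
approximate them at the given point. -/
theorem fn_sum_smul_le [IsScalarTower ℝ (LinfMu μ) N] (h : IsNormedModule pn)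
    (hτ : ∀ v y, ‖τ y v‖ = ℓ.funLift (Linf.fn (pn (P v))) y) {ι : Type*} (s : Finset ι)
    (c : ι → LinfMu μ) (v : ι → M) (u : M) :
    ∀ᵐ y ∂μ, Linf.fn (pn (∑ i ∈ s, c i • P (v i) + P u)) y ≤
      ‖∑ i ∈ s, Linf.fn (c i) y • τ y (v i) + τ y u‖ := by
  classical
  induction s using Finset.induction_on generalizing u with
  | empty =>
    simp only [Finset.sum_empty, zero_add]
    filter_upwards [ae_norm_test_eq hτ u] with y hy using hy.ge
  | insert j s hj ih =>
    have h1 : ∀ q : ℚ, ∀ᵐ y ∂μ, Linf.fn (pn (∑ i ∈ insert j s, c i • P (v i) + P u)) y ≤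
        |Linf.fn (c j) y - q| * ‖τ y (v j)‖ +
          ‖∑ i ∈ s, Linf.fn (c i) y • τ y (v i) + τ y (u + (q : ℝ) • v j)‖ := by
      intro q
      set a : LinfMu μ := algebraMap ℝ (LinfMu μ) (q : ℝ)
      have e : ∑ i ∈ insert j s, c i • P (v i) + P u =
          (c j - a) • P (v j) + (∑ i ∈ s, c i • P (v i) + P (u + (q : ℝ) • v j)) := by
        rw [Finset.sum_insert hj, map_add, map_smul,
          ← algebraMap_smul (LinfMu μ) (q : ℝ) (P (v j)), sub_smul]
        abel
      rw [e]
      filter_upwards [h.fn_add_le ((c j - a) • P (v j))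
        (∑ i ∈ s, c i • P (v i) + P (u + (q : ℝ) • v j)), h.fn_smul (c j - a) (P (v j)),
        Linf.fn_sub (c j) a, Linf.fn_algebraMap (μ := μ) (q : ℝ), ae_norm_test_eq hτ (v j),
        ih (u + (q : ℝ) • v j)] with y h2 h3 h4 h5 h6 h7
      rw [h3, h4, h5, ← h6] at h2
      linarith
    filter_upwards [ae_all_iff.2 h1] with y h2
    refine le_of_forall_rat_le_add_abs_sub_mul (x := Linf.fn (c j) y) (B := 2 * ‖τ y (v j)‖)
      fun q => ?_
    have e : ∑ i ∈ s, Linf.fn (c i) y • τ y (v i) + τ y (u + (q : ℝ) • v j) =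
        (∑ i ∈ insert j s, Linf.fn (c i) y • τ y (v i) + τ y u) -
          (Linf.fn (c j) y - q) • τ y (v j) := by
      rw [Finset.sum_insert hj, map_add, map_smul, sub_smul]
      abel
    have h3 := h2 q
    rw [e] at h3
    have h4 := norm_sub_le (∑ i ∈ insert j s, Linf.fn (c i) y • τ y (v i) + τ y u)
      ((Linf.fn (c j) y - q) • τ y (v j))
    rw [norm_smul, Real.norm_eq_abs] at h4
    linarith

/-- A bound for `L` on the unit ball bounds `⟨ω, w⟩` for every combination `w` of test vectors with
norm at most `1`. The coefficients of `w` are unbounded, so `w` is cut off where they are large in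
order to obtain an element of the module. -/
theorem Represents.apply_le [IsScalarTower ℝ (LinfMu μ) N] (h : IsNormedModule pn)
    (hτ : ∀ v y, ‖τ y v‖ = ℓ.funLift (Linf.fn (pn (P v))) y) {ω : DualSections V} {L : Dual pn}
    (hω : Represents P τ ω L) {G : Y → ℝ}
    (hG : ∀ v, Linf.nrm (pn v) ≤ 1 → ∀ᵐ y ∂μ, |Linf.fn (L.1 v) y| ≤ G y) {w : ∀ y, V y}
    (hw : w ∈ combinations μ (testVectors τ)) (hw1 : ∀ y, ‖w y‖ ≤ 1) :
    ∀ᵐ y ∂μ, ω y (w y) ≤ G y := by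
  classical
  obtain ⟨n, f, t, hf, ht, hw⟩ := hw
  choose v hv using ht
  -- On the set `E` where the coefficients are at most `K`, `w` comes from the unit ball of the
  -- module.
  have key : ∀ K : ℕ, ∀ᵐ y ∂μ, (∀ i, |f i y| ≤ K) → ω y (w y) ≤ G y := by
    intro K
    set E : Set Y := {y | ∀ i, |f i y| ≤ K} with hE
    have hEm : MeasurableSet[complSigma μ] E := by
      rw [hE, Set.ofPred_forall]
      exact MeasurableSet.iInter fun i =>
        measurableSet_le (continuous_abs.measurable.comp (hf i)) measurable_const
    have hcm : ∀ i, AEMeasurable (E.indicator (f i)) μ := fun i =>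
      NullMeasurable.aemeasurable ((hf i).indicator hEm)
    have hcb : ∀ i, ∀ᵐ y ∂μ, |E.indicator (f i) y| ≤ (K : ℝ) := fun i =>
      Eventually.of_forall fun y => by
        by_cases hy : y ∈ E
        · rw [Set.indicator_of_mem hy]
          exact hy i
        · rw [Set.indicator_of_notMem hy, abs_zero]
          positivity
    choose c hc using fun i => Linf.exists_fn_eq (hcm i) (hcb i)
    have hball : Linf.nrm (pn (∑ i, c i • P (v i))) ≤ 1 := by
      refine (Linf.nrm_le_iff _ zero_le_one).2 ?_
      have h1 := fn_sum_smul_le h hτ Finset.univ c v 0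
      simp only [map_zero, add_zero] at h1
      filter_upwards [h1, ae_all_iff.2 hc, h.fn_nonneg (∑ i, c i • P (v i))] with y h2 h3 h4
      rw [abs_of_nonneg h4]
      refine h2.trans ?_
      simp only [h3]
      by_cases hy : y ∈ E
      · simp only [Set.indicator_of_mem hy]
        have h5 := hw1 y
        rw [hw] at h5
        simpa only [← hv] using h5
      · simp only [Set.indicator_of_notMem hy, zero_smul, Finset.sum_const_zero, norm_zero,
          zero_le_one]
    have hsum : ∀ s : Finset (Fin n), ∀ᵐ y ∂μ, Linf.fn (L.1 (∑ i ∈ s, c i • P (v i))) y =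
        ∑ i ∈ s, Linf.fn (c i) y * ω y (τ y (v i)) := by
      intro s
      induction s using Finset.induction_on with
      | empty =>
        simp only [Finset.sum_empty, map_zero]
        exact Linf.fn_zero
      | insert j s hj ih =>
        rw [Finset.sum_insert hj]
        filter_upwards [ih, Dual.fn_add L (c j • P (v j)) (∑ i ∈ s, c i • P (v i)),
          Dual.fn_smul L (c j) (P (v j)), hω (v j)] with y h1 h2 h3 h4
        rw [h2, h3, h4, h1, Finset.sum_insert hj]
    filter_upwards [hG _ hball, hsum Finset.univ, ae_all_iff.2 hc] with y h1 h2 h3 hy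
    have hy' : y ∈ E := hy
    have h4 : ω y (w y) = Linf.fn (L.1 (∑ i, c i • P (v i))) y := by
      rw [h2, hw, map_sum]
      refine Finset.sum_congr rfl fun i _ => ?_
      rw [map_smul, smul_eq_mul, h3, Set.indicator_of_mem hy', ← hv]
    rw [h4]
    exact (le_abs_self _).trans h1
  filter_upwards [ae_all_iff.2 key] with y hy
  obtain ⟨K, hK⟩ := exists_nat_ge (∑ i, |f i y|)
  exact hy K fun i =>
    (Finset.single_le_sum (fun i _ => abs_nonneg (f i y)) (Finset.mem_univ i)).trans hK

/-- A bound for `⟨ω, w⟩` on the combinations of norm at most `1` bounds `L` on the unit ball, by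
approximation with the elements `P v`. -/
theorem Represents.abs_fn_le (h : IsNormedModule pn) (hP : Generates pn (Set.range P))
    (hτ : ∀ v y, ‖τ y v‖ = ℓ.funLift (Linf.fn (pn (P v))) y) {ω : DualSections V} {L : Dual pn}
    (hω : Represents P τ ω L) {G : Y → ℝ}
    (hG : ∀ w ∈ combinations μ (testVectors τ), (∀ y, ‖w y‖ ≤ 1) → ∀ᵐ y ∂μ, ω y (w y) ≤ G y)
    (U : N) (hU : Linf.nrm (pn U) ≤ 1) : ∀ᵐ y ∂μ, |Linf.fn (L.1 U) y| ≤ G y := by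
  obtain ⟨C, hC0, hC⟩ := Dual.exists_bound h L
  have hG0 : ∀ᵐ y ∂μ, 0 ≤ G y := by
    have h1 := hG (fun _ => 0) ⟨0, fun _ _ => 0, fun _ _ => 0, fun i => i.elim0, fun i => i.elim0,
      fun y => by simp⟩ fun y => by rw [norm_zero]; exact zero_le_one
    simpa only [map_zero] using h1
  refine ae_le_of_forall_pos (K := fun y => G y + C) fun ε hε => ?_
  obtain ⟨k, v, -, hv⟩ := h.exists_approx_map hP U hε
  filter_upwards [hv, hG0, ae_all_iff.2 fun n => hC (U - P (v n)),
    ae_all_iff.2 fun n => abs_apply_test_le hτ ω hG (v n), ae_all_iff.2 fun n => hω (v n),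
    ae_all_iff.2 fun n => ae_norm_test_eq hτ (v n),
    ae_all_iff.2 fun n => h.fn_sub_le U (U - P (v n)), (Linf.nrm_le_iff _ zero_le_one).1 hU,
    ae_all_iff.2 fun n => Dual.fn_add L (U - P (v n)) (P (v n))] with y h1 h2 h3 h4 h5 h6 h7 h8 h9
  have h10 := h7 (k y)
  rw [sub_sub_cancel, ← h6] at h10
  have h11 := h9 (k y)
  rw [sub_add_cancel, h5] at h11
  have h12 : ‖τ y (v (k y))‖ ≤ 1 + ε := by linarith [le_abs_self (Linf.fn (pn U) y)]
  rw [h11]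
  have h13 := mul_le_mul_of_nonneg_left h12 h2
  have h14 := mul_le_mul_of_nonneg_left h1 hC0
  refine (abs_add_le _ _).trans ?_
  linarith [h3 (k y), h4 (k y)]

theorem Represents.dualNorm_eq [IsScalarTower ℝ (LinfMu μ) N] (h : IsNormedModule pn)
    (hP : Generates pn (Set.range P))
    (hτ : ∀ v y, ‖τ y v‖ = ℓ.funLift (Linf.fn (pn (P v))) y)
    {ω : weakSections μ (testVectors τ)} {L : Dual pn} (hω : Represents P τ ω.1 L) :
    dualNorm pn L = weakNorm (LinfWeak.mk ω) := by
  refine Linf.esssup_congr (S := Dual.unitValues L)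
    (S' := LinfWeak.unitValues (LinfWeak.mk ω)) (Set.ext fun g => ?_)
  rw [Dual.mem_upperBounds_iff, LinfWeak.mem_upperBounds_iff]
  exact ⟨fun hg w hw hw1 => hω.apply_le h hτ hg hw hw1, fun hg U hU => hω.abs_fn_le h hP hτ hg U hU⟩

theorem exists_represents_of_weakSection [IsScalarTower ℝ (LinfMu μ) N] (h : IsNormedModule pn)
    (hP : Generates pn (Set.range P))
    (hτ : ∀ v y, ‖τ y v‖ = ℓ.funLift (Linf.fn (pn (P v))) y)
    (ω : weakSections μ (testVectors τ)) : ∃ L : Dual pn, Represents P τ ω.1 L := by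
  obtain ⟨C, hC⟩ := ω.2.2
  refine Dual.exists_extension h hP (fun v y => ω.1 y (τ y v)) (fun v => ω.2.1 _ ⟨v, rfl⟩)
    (fun v w => Eventually.of_forall fun y => by rw [map_add, map_add])
    (fun c v => Eventually.of_forall fun y => by rw [map_smul, map_smul, smul_eq_mul])
    (abs_nonneg C) fun v => ?_
  have h1 := abs_apply_test_le hτ ω.1 (G := fun _ => |C|) (fun w hw hw1 => by
    filter_upwards [hC w hw hw1] with y hy
    exact (le_abs_self _).trans (hy.trans (le_abs_self C))) v
  filter_upwards [h1, ae_norm_test_eq hτ v] with y h2 h3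
  rwa [← h3]

/-- Every element of the dual is represented by a section: at each point `y`, the linear form
`v ↦ ℓ(L(P v))(y)` is bounded by the norm of `τ y v`, and it extends to the fibre by the
Hahn-Banach theorem. -/
theorem Dual.exists_represents [IsScalarTower ℝ (LinfMu μ) N] (h : IsNormedModule pn)
    (hτ : ∀ v y, ‖τ y v‖ = ℓ.funLift (Linf.fn (pn (P v))) y) (L : Dual pn) :
    ∃ ω : weakSections μ (testVectors τ), Represents P τ ω.1 L := by
  obtain ⟨C, hC0, hC⟩ := Dual.exists_bound h L
  have hmem : ∀ g : LinfMu μ, Linf.fn g ∈ boundedMeasurable (complSigma μ) := fun g =>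
    (Linf.rep g).2
  let f : ∀ _ : Y, M →ₗ[ℝ] ℝ := fun y =>
    { toFun := fun v => ℓ.funLift (Linf.fn (L.1 (P v))) y
      map_add' := fun v w => by
        rw [← ℓ.funLift_add (hmem _) (hmem _)]
        refine ℓ.funLift_congr (hmem _) (add_mem (hmem _) (hmem _)) ?_ y
        rw [map_add]
        exact Dual.fn_add L _ _
      map_smul' := fun c v => by
        rw [RingHom.id_apply, smul_eq_mul, ← ℓ.funLift_smul (hmem _)]
        refine ℓ.funLift_congr (hmem _) (smul_mem_boundedMeasurable (hmem _) c) ?_ y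
        rw [map_smul, ← algebraMap_smul (LinfMu μ) c (P v), map_smul, algebraMap_smul]
        exact Linf.fn_smul c _ }
  have hf : ∀ y v, |f y v| ≤ C * ‖τ y v‖ := by
    intro y v
    have hCm := smul_mem_boundedMeasurable (hmem (pn (P v))) C
    rw [hτ, ← ℓ.funLift_smul (hmem _)]
    refine abs_le'.2 ⟨ℓ.funLift_mono (hmem _) hCm ?_ y, ?_⟩
    · filter_upwards [hC (P v)] with x hx using (le_abs_self _).trans hx
    · change -ℓ.funLift _ y ≤ _
      rw [← ℓ.funLift_neg (hmem _)]
      refine ℓ.funLift_mono (neg_mem (hmem _)) hCm ?_ y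
      filter_upwards [hC (P v)] with x hx using (neg_le_abs _).trans hx
  choose F hF using fun y => exists_strongDual_comp_eq (τ y) (f y) C (hf y)
  have hrep : ∀ v, ∀ᵐ y ∂μ, Linf.fn (L.1 (P v)) y = F y (τ y v) := by
    intro v
    filter_upwards [ℓ.funLift_ae_eq (hmem (L.1 (P v)))] with y hy
    rw [hF]
    exact hy.symm
  have hR : Represents P τ (F : DualSections V) L := hrep
  have hle : ∀ w ∈ combinations μ (testVectors τ), (∀ y, ‖w y‖ ≤ 1) → ∀ᵐ y ∂μ, F y (w y) ≤ C :=
    fun w hw hw1 => hR.apply_le h hτ (G := fun _ => C) (fun U hU => by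
      filter_upwards [hC U, (Linf.nrm_le_iff _ zero_le_one).1 hU] with y h1 h2
      exact h1.trans (mul_le_of_le_one_right hC0 ((le_abs_self _).trans h2))) hw hw1
  refine ⟨⟨F, ?_, C, fun w hw hw1 => ?_⟩, hR⟩
  · rintro _ ⟨v, rfl⟩
    exact (Linf.aemeasurable_fn _).congr (hrep v)
  · have hneg : (fun y => -w y) ∈ combinations μ (testVectors τ) := by
      obtain ⟨n, f, t, hf, ht, hw⟩ := hw
      exact ⟨n, fun i y => -f i y, t, fun i => (hf i).neg, ht, fun y => by
        simp only [hw, neg_smul, Finset.sum_neg_distrib]⟩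
    filter_upwards [hle w hw hw1, hle _ hneg fun y => by rw [norm_neg]; exact hw1 y] with y h1 h2
    rw [map_neg] at h2
    exact abs_le.2 ⟨by linarith, h1⟩

/-- The sections of the dual spaces represent exactly the elements of the dual module, linearly and
isometrically. -/
theorem exists_linfWeak_equiv_dual [SigmaFinite μ] [IsScalarTower ℝ (LinfMu μ) N]
    (h : IsNormedModule pn) (hP : Generates pn (Set.range P))
    (hτ : ∀ v y, ‖τ y v‖ = ℓ.funLift (Linf.fn (pn (P v))) y) :
    IsNormedModule (weakNorm : LinfWeak μ (testVectors τ) → LinfMu μ) ∧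
    ∃ I : LinfWeak μ (testVectors τ) ≃ₗ[LinfMu μ] Dual pn,
      (∀ (ω : weakSections μ (testVectors τ)) (L : Dual pn),
        L = I (LinfWeak.mk ω) ↔ Represents P τ ω.1 L) ∧
      ∀ q, dualNorm pn (I q) = weakNorm q := by
  have huniq : ∀ {ω : DualSections V} {L L' : Dual pn}, Represents P τ ω L →
      Represents P τ ω L' → L = L' := by
    intro ω L L' hL hL'
    refine Dual.ext_of_generates h hP fun v => Linf.eq_iff.2 ?_
    filter_upwards [hL v, hL' v] with y h1 h2
    rw [h1, h2]
  have hex : ∀ q : LinfWeak μ (testVectors τ), ∃ L : Dual pn, ∀ ω, LinfWeak.mk ω = q →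
      Represents P τ ω.1 L := by
    intro q
    obtain ⟨ω, rfl⟩ := LinfWeak.mk_surjective q
    obtain ⟨L, hL⟩ := exists_represents_of_weakSection h hP hτ ω
    refine ⟨L, fun ω' hω' v => ?_⟩
    filter_upwards [hL v, LinfWeak.mk_eq_iff.1 hω' _ ⟨v, rfl⟩] with y h1 h2
    rw [h1, ← h2]
  choose I hI using hex
  have hadd : ∀ q q', I (q + q') = I q + I q' := by
    intro q q'
    obtain ⟨ω, rfl⟩ := LinfWeak.mk_surjective q
    obtain ⟨ω', rfl⟩ := LinfWeak.mk_surjective q'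
    refine huniq (hI _ (ω + ω') rfl) fun v => ?_
    filter_upwards [hI _ ω rfl v, hI _ ω' rfl v,
      Dual.fn_coe_add (I (LinfWeak.mk ω)) (I (LinfWeak.mk ω')) (P v)] with y h1 h2 h3
    rw [h3, h1, h2]
    rfl
  have hsmul : ∀ (g : LinfMu μ) q, I (g • q) = g • I q := by
    intro g q
    obtain ⟨ω, rfl⟩ := LinfWeak.mk_surjective q
    refine huniq (hI _ (Linf.rep g • ω) rfl) fun v => ?_
    filter_upwards [hI _ ω rfl v, Dual.fn_coe_smul g (I (LinfWeak.mk ω)) (P v)] with y h1 h2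
    rw [h2, h1]
    rfl
  let Iₗ : LinfWeak μ (testVectors τ) →ₗ[LinfMu μ] Dual pn := ⟨⟨I, hadd⟩, hsmul⟩
  have hbij : Function.Bijective Iₗ := by
    constructor
    · intro q q' hqq'
      obtain ⟨ω, rfl⟩ := LinfWeak.mk_surjective q
      obtain ⟨ω', rfl⟩ := LinfWeak.mk_surjective q'
      have hqq : I (LinfWeak.mk ω) = I (LinfWeak.mk ω') := hqq'
      refine LinfWeak.mk_eq_iff.2 ?_
      rintro _ ⟨v, rfl⟩
      filter_upwards [hI _ ω rfl v, hI _ ω' rfl v] with y h1 h2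
      rw [← h1, ← h2, hqq]
    · intro L
      obtain ⟨ω, hω⟩ := Dual.exists_represents h hτ L
      exact ⟨LinfWeak.mk ω, huniq (hI _ ω rfl) hω⟩
  let e := LinearEquiv.ofBijective Iₗ hbij
  have hnorm : ∀ q, dualNorm pn (e q) = weakNorm q := by
    intro q
    obtain ⟨ω, rfl⟩ := LinfWeak.mk_surjective q
    exact Represents.dualNorm_eq h hP hτ (hI _ ω rfl)
  refine ⟨(Dual.isNormedModule h).of_equiv e hnorm, e, fun ω L => ?_, hnorm⟩
  constructor
  · rintro rfl
    exact hI _ ω rfl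
  · exact fun hL => huniq hL (hI _ ω rfl)

end WeakDual

end LinftyModule

end

theorem mainTheorem2
    {X Y : Type*} [MeasurableSpace X] [MeasurableSpace Y]
    (μX : Measure X) (μY : Measure Y) [SigmaFinite μX] [SigmaFinite μY]
    (φ : Y → X)
    (hφ : @MeasurePreserving (NullMeasurableSpace Y μY) (NullMeasurableSpace X μX) _ _
      φ μY.completion μX.completion)
    (ℓX : Lifting μX) (ℓY : Lifting μY)
    (hℓ : ∀ E : Set X, MeasurableSet E → ℓY.toFun (φ ⁻¹' E) = φ ⁻¹' (ℓX.toFun E))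
    -- the `L^∞(μX)`-normed module `M`
    {M : Type*} [AddCommGroup M] [Module (LinfMu μX) M]
    [Module ℝ M] [IsScalarTower ℝ (LinfMu μX) M]
    (pn : M → LinfMu μX) (hM : IsNormedModule pn)
    -- its lifting `(LM, T)`
    {LM : Type*} [AddCommGroup LM] [Module (LinfTop (complSigma μX)) LM]
    [Module ℝ LM] [IsScalarTower ℝ (LinfTop (complSigma μX)) LM]
    (pnL : LM → LinfTop (complSigma μX)) (T : M →ₗ[ℝ] LM)
    (hT : IsModuleLifting ℓX pn pnL T)
    -- its pullback `(PM, P)`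
    {PM : Type*} [AddCommGroup PM] [Module (LinfMu μY) PM]
    [Module ℝ PM] [IsScalarTower ℝ (LinfMu μY) PM]
    (pnP : PM → LinfMu μY) (P : M →ₗ[ℝ] PM)
    (hP : IsPullback φ pn pnP P) :
    IsNormedModule
      (weakNorm : LinfWeak μY (pullbackTest hT.normed ℓX φ T) → LinfMu μY) ∧
    ∃ I : LinfWeak μY (pullbackTest hT.normed ℓX φ T) ≃ₗ[LinfMu μY] Dual pnP,
      (∀ (ω : weakSections μY (pullbackTest hT.normed ℓX φ T)) (L : Dual pnP),
        L = I (LinfWeak.mk ω) ↔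
          ∀ v : M, (L.1 (P v) : Germ (ae μY) ℝ) =
            ((fun y => ω.1 y (valueAt hT.normed ℓX (φ y) (T v)) : Y → ℝ) : Germ (ae μY) ℝ)) ∧
      ∀ q, dualNorm pnP (I q) = weakNorm q := by
  let τ : ∀ y, M →ₗ[ℝ] Fibre hT.normed ℓX (φ y) := fun y =>
    (valueAtLinear hT.normed ℓX (φ y)).comp T
  have hτ : ∀ v y, ‖τ y v‖ = ℓY.funLift (Linf.fn (pnP (P v))) y := by
    intro v y
    -- Both sides are the lifting of `|v|` at `φ y`: the lifting of `|P v| = |v| ∘ φ` for `μY` is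
    -- the lifting of `|v|` for `μX` composed with `φ`.
    have h1 : ‖τ y v‖ = ℓX.funLift (Linf.rep (pn v)) (φ y) := by
      change ‖valueAt hT.normed ℓX (φ y) (T v)‖ = _
      rw [norm_valueAt, hT.norm_map]
      rfl
    obtain ⟨hm, C, hC⟩ := (Linf.rep (pn v)).2
    have hcomp : (Linf.rep (pn v)).1 ∘ φ ∈ boundedMeasurable (complSigma μY) :=
      ⟨hm.comp hφ.measurable, C, fun y => hC (φ y)⟩
    rw [h1, ← ℓX.funLift_comp ℓY hφ hℓ (Linf.rep (pn v)).2]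
    refine ℓY.funLift_congr hcomp (Linf.rep (pnP (P v))).2 ?_ y
    have h2 := hP.norm_map v (Linf.fn (pn v)) (Linf.coe_fn (pn v)).symm
    filter_upwards [(Linf.coe_eq_iff _ _).1 h2] with x hx
    exact hx.symm
  obtain ⟨h1, I, hI, hnorm⟩ := exists_linfWeak_equiv_dual hP.normed hP.generates hτ
  refine ⟨h1, I, fun ω L => (hI ω L).trans (forall_congr' fun v => ?_), hnorm⟩
  exact (Linf.coe_eq_iff _ _).symm
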